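/- **Notation.** A differential operator is an operator $\sum_{j\le m}a_j(x)\,\partial^j$, $\partial=d/dx$, with real smooth coefficients on $\mathbb R$, acting on $C^\infty(\mathbb R)$; it has order at most $m$. A difference operator of order at most $2k$ acts on sequences $(h_n)_{n\ge0}$ by $(Lh)_n=\sum_{|j|\le k,\;n+j\ge0}L_{n,n+j}h_{n+j}$ with real coefficients; it is symmetric if the matrix $(L_{n,m})_{n,m\ge0}$ is symmetric. For a sequence $(q_n)_{n\ge0}$ of polynomials, $\mathcal F^{d,k}_{x,sym}$ is the vector space of differential operators $D$ of order at most $2d$ such that $Dq_n=(Lq)_n$ for all $n\ge0$, for some symmetric difference operator $L$ of order at most $2k$. Write $(\delta^jh)_n=h_{n+j}$. **Setting.** Let $H_n(x)=(-1)^ne^{x^2}\partial^n e^{-x^2}$, let $X=\{1,2\}$, $w(x)=\dfrac{e^{-x^2}}{(1+2x^2)^2}$ on $\mathbb R$, and $$q_n(x)=\frac{\sqrt{(n-1)(n-2)}}{\sqrt[4]{\pi}\sqrt{2^nn!}}\left(H_n(x)+4nH_{n-2}(x)+4n(n-3)H_{n-4}(x)\right),\qquad n\ge0,$$ where terms with zero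 coefficient are read as zero. Let \begin{align*} D_0&=\partial^2-\frac{2(2x^3+5x)}{2x^2+1}\,\partial,\qquad D_1=x\,\partial^2-\frac{4x^4+8x^2-1}{2x^2+1}\,\partial,\\ D_2&=\Big(-\tfrac1{56}x^2+\tfrac{17}{112}\Big)\partial^2+\frac{4x^5-28x^3-87x}{56(2x^2+1)}\,\partial+1,\qquad D_3=\tfrac43x^3+2x, \end{align*} \begin{align*} L_0={}&-2n,\\ L_1={}&-\sqrt2\sqrt{n-1}\sqrt{n-3}\sqrt n\;\delta^{-1}-\sqrt2\sqrt{n+1}\sqrt{n-2}\sqrt n\;\delta,\\ L_2={}&\tfrac1{56}\sqrt{(n-2)(n-3)(n-4)n}\;\delta^{-2}+\tfrac{(n-4)(n-7)}{28}+\tfrac1{56}\sqrt{(n+2)(n-1)(n-2)n}\;\delta^{2},\\ L_3={}&\tfrac{\sqrt2}3\sqrt{n(n-4)(n-5)}\;\delta^{-3}+\sqrt{2n(n-1)(n-3)}\;\delta^{-1}+\sqrt{2(n+1)n(n-2)}\;\delta+\tfrac{\sqrt2}3\sqrt{(n+3)(n-1)(n-2)}\;\delta^{3}, \end{align*} where the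 square root of a negative number (which never enters a nonzero coefficient acting on a nonzero $q_m$) is read as $0$. For $N\in\mathbb N_0$ and $\Omega\in\mathbb R$ let $$(Sf)(x)=\int_{-\infty}^{\Omega}f(y)\,w(y)\sum_{n=0}^Nq_n(x)q_n(y)\,dy .$$ **Theorem.** 1. $q_n\equiv0$ exactly for $n\in X$; for $n\notin X$, $q_n$ is a polynomial of degree $n$; and $\{q_n\}_{n\notin X}$ is a complete orthonormal system in $L^2(\mathbb R,w(x)dx)$. 2. For $j=0,1,2,3$, $L_j$ is a symmetric difference operator of order at most $2j$, and $D_jq_n=(L_jq)_n$ for all $n\ge0$. 3. The 14 operators $$\mathrm{Id},\;D_0,\;D_1,\;D_2,\;D_3,\;D_0^2,\;D_0^3,\;D_1^2,\;D_3D_0+D_0D_3,\;D_3D_0^2+D_0^2D_3,\;D_0D_1+D_1D_0,$$ $$D_3D_0^3+D_0^3D_3,\;D_0^2D_1+D_1D_0^2,\;D_0D_1^2+D_1^2D_0$$ belong to $\mathcal F^{3,3}_{x,sym}$ and are linearly independent over $\mathbb R$. 4. Let $N\in\mathbb N_0$, $\Omega\in\mathbb R$ and \begin{align*} T={}&-\Omega^3D_0^3+\tfrac34(2\Omega^2-1)(D_1D_0^2+D_0^2D_1)-\tfrac32\Omega(D_1^2D_0+D_0D_1^2)+\tfrac38(D_3D_0^3+D_0^3D_3)\\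 &+3(N\Omega^2+2\Omega^2-\tfrac32N-4)(D_1D_0+D_0D_1)-3(2\Omega^2-1)\Omega\,D_0^2\\ &-2\Omega(54N^2+4\Omega^2+48N-3)D_0-6(2N+1)\Omega\,D_1^2+\tfrac98(2N+1)(D_3D_0^2+D_0^2D_3)\\ &+\tfrac32(3N^2+3N-7)(D_0D_3+D_3D_0)+3(6N\Omega^2-4N^2+2\Omega^2-17N-7)D_1\\ &+672(N+1)N\Omega\,D_2+\tfrac32(2N^2+2N-15)(2N+1)D_3 . \end{align*} Then $T\in\mathcal F^{3,3}_{x,sym}$, $T$ has order exactly six, and $$T=w^{-1/2}\Big(\sum_{k=0}^3\partial^kf_k\,\partial^k\Big)w^{1/2},$$ where $f_3=(x-\Omega)^3$ and $$f_2=\frac{3(\Omega-x)^2}{(2x^2+1)^2}\big(4 \Omega x^{6} - 4 x^{7} + 8 N x^{5} + 8 \Omega x^{4} - 12 x^{5} + 8 N x^{3} + 21 \Omega x^{2} - 17 x^{3} + 2 N x - 7 \Omega + 10 x\big),$$ $$f_1=-\frac{3(\Omega-x)}{(2x^2+1)^4}\big(16 \Omega^{2} x^{12} - 32 \Omega x^{13}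 + 16 x^{14} + 64 N \Omega x^{11} - 64 N x^{12} + 64 N^{2} x^{10} + 64 \Omega^{2} x^{10} - 160 \Omega x^{11} + 96 x^{12} + 192 N \Omega x^{9} - 256 N x^{10} + 160 N^{2} x^{8} + 168 \Omega^{2} x^{8} - 272 \Omega x^{9} + 72 x^{10} + 416 N \Omega x^{7} - 448 N x^{8} + 160 N^{2} x^{6} + 152 \Omega^{2} x^{6} - 192 \Omega x^{7} - 120 x^{8} + 160 N \Omega x^{5} - 128 N x^{6} + 80 N^{2} x^{4} - 279 \Omega^{2} x^{4} + 334 \Omega x^{5} - 359 x^{6} - 76 N \Omega x^{3} + 92 N x^{4} + 20 N^{2} x^{2} + 1210 \Omega^{2} x^{2} - 1662 \Omega x^{3} + 324 x^{4} - 36 N \Omega x + 32 N x^{2} + 2 N^{2} - 83 \Omega^{2} + 610 \Omega x - 497 x^{2} - 2 N + 18\big),$$ $$f_0=\frac1{(2x^2+1)^6}\big(64 \Omega^{3} x^{18} - 192 \Omega^{2} x^{19} + 192 \Omega x^{20} - 64 x^{21} + 384 N \Omega^{2} x^{17} - 768 N \Omega x^{18} + 384 N x^{19} + 768 N^{2}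 \Omega x^{16} + 384 \Omega^{3} x^{16} - 768 N^{2} x^{17} - 1344 \Omega^{2} x^{17} + 1536 \Omega x^{18} - 576 x^{19} + 512 N^{3} x^{15} + 1920 N \Omega^{2} x^{15} - 4608 N \Omega x^{16} + 2688 N x^{17} + 3456 N^{2} \Omega x^{14} + 624 \Omega^{3} x^{14} - 4224 N^{2} x^{15} - 1296 \Omega^{2} x^{15} + 336 \Omega x^{16} + 336 x^{17} + 2304 N^{3} x^{13} + 4128 N \Omega^{2} x^{13} - 8640 N \Omega x^{14} + 4000 N x^{15} + 50496 N^{2} \Omega x^{12} + 112 \Omega^{3} x^{12} - 10176 N^{2} x^{13} + 3552 \Omega^{2} x^{13} - 10896 \Omega x^{14} + 7616 x^{15} + 4224 N^{3} x^{11} + 3840 N \Omega^{2} x^{11} + 37824 N \Omega x^{12} - 1344 N x^{13} + 137184 N^{2} \Omega x^{10} - 1332 \Omega^{3} x^{10} - 12192 N^{2} x^{11} + 12156 \Omega^{2} x^{11} - 29052 \Omega x^{12} + 18996 x^{13} + 4160 N^{3} x^{9} - 1464 N \Omega^{2} x^{9} + 134928 N \Omega x^{10} - 10584 N x^{11} +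 165360 N^{2} \Omega x^{8} + 1200 \Omega^{3} x^{8} - 7440 N^{2} x^{9} + 9804 \Omega^{2} x^{9} - 31272 \Omega x^{10} + 20940 x^{11} + 2400 N^{3} x^{7} + 11160 N \Omega^{2} x^{7} + 153312 N \Omega x^{8} - 9176 N x^{9} + 107784 N^{2} \Omega x^{6} + 17521 \Omega^{3} x^{6} - 1944 N^{2} x^{7} - 24975 \Omega^{2} x^{7} - 1917 \Omega x^{8} + 9851 x^{9} + 816 N^{3} x^{5} + 8670 N \Omega^{2} x^{5} + 109500 N \Omega x^{6} - 12858 N x^{7} + 39708 N^{2} \Omega x^{4} - 139845 \Omega^{3} x^{4} + 108 N^{2} x^{5} + 266580 \Omega^{2} x^{5} - 160785 \Omega x^{6} + 31338 x^{7} + 152 N^{3} x^{3} - 1044 N \Omega^{2} x^{3} + 51324 N \Omega x^{4} - 9792 N x^{5} + 7818 N^{2} \Omega x^{2} + 69189 \Omega^{3} x^{2} + 162 N^{2} x^{3} - 247383 \Omega^{2} x^{3} + 242145 \Omega x^{4} - 68367 x^{5} + 12 N^{3} x - 1134 N \Omega^{2} x + 11466 N \Omega x^{2} - 1964 N x^{3}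 + 642 N^{2} \Omega - 2097 \Omega^{3} + 24 N^{2} x + 27432 \Omega^{2} x - 56673 \Omega x^{2} + 29088 x^{3} + 582 N \Omega + 144 N x + 1134 \Omega - 1512 x\big).$$ The operator $T$ is symmetric in $L^2((-\infty,\Omega),w(x)dx)$ on the domain of smooth functions of temperate growth (the function and all its derivatives are bounded by polynomials): for such $f,g$, the function $(Tf)\,w\,g$ is integrable on $(-\infty,\Omega)$ and $\int_{-\infty}^\Omega (Tf)\,w\,g\,dx=\int_{-\infty}^\Omega f\,w\,(Tg)\,dx$. For $n\le N$, $Tq_n$ is a polynomial of degree at most $N$. Finally, $T$ commutes with $S$: if $f\in C^\infty(\mathbb R)$ and both $f$ and $Tf$ are in $L^2((-\infty,\Omega),w(x)dx)$, then $Sf$ is smooth and $T(Sf)=S(Tf)$ on $\mathbb R$. -/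

import Mathlib

open Set MeasureTheory Polynomial
open scoped ContDiff

noncomputable section

namespace ExcHermite

/-! Differential operators with smooth coefficients on the real line -/

/-- The algebra of smooth functions `ℝ → ℝ`. -/
def SmoothFun : Subalgebra ℝ (ℝ → ℝ) where
  carrier := {f | ContDiff ℝ ∞ f}
  mul_mem' {f g} hf hg := by
    change ContDiff ℝ ∞ (f * g)
    exact ContDiff.mul hf hg
  add_mem' {f g} hf hg := by
    change ContDiff ℝ ∞ (f + g)
    exact ContDiff.add hf hg
  algebraMap_mem' c := by
    change ContDiff ℝ ∞ fun _ : ℝ => c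
    exact contDiff_const

/-- The derivation `∂ = d/dx` on smooth functions. -/
def ddx : Module.End ℝ SmoothFun where
  toFun f := ⟨deriv f.1, (contDiff_infty_iff_deriv.1 f.2).2⟩
  map_add' f g := Subtype.ext <| funext fun x =>
    deriv_add ((contDiff_infty_iff_deriv.1 f.2).1 x) ((contDiff_infty_iff_deriv.1 g.2).1 x)
  map_smul' c f := Subtype.ext <| funext fun x =>
    deriv_const_smul c ((contDiff_infty_iff_deriv.1 f.2).1 x)

/-- The operator of multiplication by a smooth function. -/
def mulOp (a : SmoothFun) : Module.End ℝ SmoothFun := LinearMap.mulLeft ℝ a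

/-- `D` is a differential operator of order at most `m`: `D = ∑_{j ≤ m} a_j ∂^j`. -/
def IsDiffOp (m : ℕ) (D : Module.End ℝ SmoothFun) : Prop :=
  ∃ a : ℕ → SmoothFun, D = ∑ j ∈ Finset.range (m + 1), mulOp (a j) * ddx ^ j

/-! Difference operators and the symmetric part of the Fourier algebra -/

/-- A difference operator of order at most `2 * k` (shifts between `-k` and `k`), as a
`(2k+1)`-diagonal semi-infinite matrix. -/
def IsDiffceOp (k : ℕ) (L : Matrix ℕ ℕ ℝ) : Prop :=
  ∀ n m : ℕ, n + k < m ∨ m + k < n → L n m = 0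

/-- The action `(L h)_n = ∑_{|m - n| ≤ k} L_{n,m} h_m` of a difference operator of order at most
`2 * k` (the truncated subtraction discards the negative indices). -/
def diffceApply (k : ℕ) (L : Matrix ℕ ℕ ℝ) (h : ℕ → SmoothFun) (n : ℕ) : SmoothFun :=
  ∑ m ∈ Finset.Icc (n - k) (n + k), L n m • h m

/-- The space `F_{x,sym}^{d,k}` of the sequence `q`: differential operators `D` of order at most
`2 * d` such that `D q_n = (L q)_n` for all `n`, for some symmetric difference operator `L` of
order at most `2 * k`. -/
def fourierSym (q : ℕ → SmoothFun) (d k : ℕ) : Submodule ℝ (Module.End ℝ SmoothFun) where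
  carrier := {D | IsDiffOp (2 * d) D ∧ ∃ L : Matrix ℕ ℕ ℝ, L.IsSymm ∧ IsDiffceOp k L ∧
    ∀ n, D (q n) = diffceApply k L q n}
  add_mem' := by
    rintro D E ⟨⟨a, ha⟩, L, hL, hk, h⟩ ⟨⟨b, hb⟩, M, hM, hk', h'⟩
    refine ⟨⟨a + b, ?_⟩, L + M, hL.add hM, fun n m hnm => ?_, fun n => ?_⟩
    · rw [ha, hb, ← Finset.sum_add_distrib]
      refine Finset.sum_congr rfl fun j _ => ?_
      rw [← add_mul]
      congr 1
      ext1 f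
      simp [mulOp, add_mul]
    · simp [hk n m hnm, hk' n m hnm]
    · simp [h n, h' n, diffceApply, add_smul, Finset.sum_add_distrib]
  zero_mem' := by
    refine ⟨⟨0, ?_⟩, 0, Matrix.isSymm_zero, fun _ _ _ => rfl, fun n => ?_⟩
    · simp [mulOp]
    · simp [diffceApply]
  smul_mem' := by
    rintro c D ⟨⟨a, ha⟩, L, hL, hk, h⟩
    refine ⟨⟨c • a, ?_⟩, c • L, hL.smul c, fun n m hnm => ?_, fun n => ?_⟩
    · rw [ha, Finset.smul_sum]
      refine Finset.sum_congr rfl fun j _ => ?_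
      ext1 f
      simp [mulOp]
    · simp [hk n m hnm]
    · simp [h n, diffceApply, Finset.smul_sum, smul_smul]

/-! The exceptional Hermite polynomials -/

/-- The classical (physicists') Hermite polynomials, by the Rodrigues formula. -/
def hermiteH (n : ℕ) : SmoothFun :=
  ⟨fun x => (-1) ^ n * Real.exp (x ^ 2) * iteratedDeriv n (fun t => Real.exp (-t ^ 2)) x, by
    have h : ContDiff ℝ ∞ (fun t : ℝ => Real.exp (-t ^ 2)) := by fun_prop
    have h2 : ContDiff ℝ ∞ (iteratedDeriv n (fun t : ℝ => Real.exp (-t ^ 2))) := by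
      rw [contDiff_infty] at h ⊢
      exact fun k => by
        rw [iteratedDeriv_eq_iterate]
        exact ContDiff.iterate_deriv' k n (h (k + n))
    change ContDiff ℝ ∞ _
    fun_prop⟩

/-- The exceptional Hermite polynomials `q_n`, with `q_n = 0` for `n = 1, 2`. Wherever an index
`n - 2` or `n - 4` is truncated at `0`, its coefficient (or the prefactor) vanishes. -/
def q (n : ℕ) : SmoothFun :=
  (√(((n : ℝ) - 1) * ((n : ℝ) - 2)) / (Real.pi ^ (1 / 4 : ℝ) * √(2 ^ n * (n.factorial : ℝ)))) •
    (hermiteH n + (4 * (n : ℝ)) • hermiteH (n - 2) +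
      (4 * (n : ℝ) * ((n : ℝ) - 3)) • hermiteH (n - 4))

/-- The set of exceptional degrees. -/
def excDegrees : Set ℕ := {1, 2}

/-- The weight `w(x) = e^{-x²} / (1 + 2x²)²`. -/
def w (x : ℝ) : ℝ := Real.exp (-x ^ 2) / (1 + 2 * x ^ 2) ^ 2

/-- The measure `w(x) dx` on the real line. -/
def wMeasure : Measure ℝ := volume.withDensity fun x => ENNReal.ofReal (w x)

theorem contDiff_div_pow {p : ℝ → ℝ} (k : ℕ) (hp : ContDiff ℝ ∞ p) :
    ContDiff ℝ ∞ fun x => p x / (2 * x ^ 2 + 1) ^ k :=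
  hp.div (by fun_prop) fun x => by positivity

theorem contDiff_div_eta {p : ℝ → ℝ} (hp : ContDiff ℝ ∞ p) :
    ContDiff ℝ ∞ fun x => p x / (2 * x ^ 2 + 1) :=
  hp.div (by fun_prop) fun x => by positivity

theorem w_pos (x : ℝ) : 0 < w x := by unfold w; positivity

theorem contDiff_sqrt_w : ContDiff ℝ ∞ fun x => √(w x) := by
  refine ContDiff.sqrt ?_ fun x => (w_pos x).ne'
  unfold w
  exact ContDiff.div (by fun_prop) (by fun_prop) fun x => by positivity

/-- The function `w^{1/2}`. -/
def sqrtW : SmoothFun := ⟨fun x => √(w x), contDiff_sqrt_w⟩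

/-- The function `w^{-1/2}`. -/
def invSqrtW : SmoothFun :=
  ⟨fun x => (√(w x))⁻¹, contDiff_sqrt_w.inv fun x => (Real.sqrt_pos.2 (w_pos x)).ne'⟩

/-! The operators `D₀, …, D₃` and the difference operators `L₀, …, L₃` -/

def D0 : Module.End ℝ SmoothFun :=
  ddx ^ 2 - mulOp ⟨fun x => (2 * (2 * x ^ 3 + 5 * x)) / (2 * x ^ 2 + 1),
    contDiff_div_eta (by fun_prop)⟩ * ddx

def D1 : Module.End ℝ SmoothFun :=
  mulOp ⟨fun x => x, by change ContDiff ℝ ∞ _; fun_prop⟩ * ddx ^ 2 -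
    mulOp ⟨fun x => (4 * x ^ 4 + 8 * x ^ 2 - 1) / (2 * x ^ 2 + 1),
      contDiff_div_eta (by fun_prop)⟩ * ddx

def D2 : Module.End ℝ SmoothFun :=
  mulOp ⟨fun x => -(1 / 56) * x ^ 2 + 17 / 112, by change ContDiff ℝ ∞ _; fun_prop⟩ * ddx ^ 2 +
    mulOp ⟨fun x => ((4 * x ^ 5 - 28 * x ^ 3 - 87 * x) / 56) / (2 * x ^ 2 + 1),
      contDiff_div_eta (by fun_prop)⟩ * ddx + 1

def D3 : Module.End ℝ SmoothFun :=
  mulOp ⟨fun x => 4 * x ^ 3 / 3 + 2 * x, by change ContDiff ℝ ∞ _; fun_prop⟩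

def L0 : Matrix ℕ ℕ ℝ := fun n m => if m = n then -2 * (n : ℝ) else 0

def L1 : Matrix ℕ ℕ ℝ := fun n m =>
  if m + 1 = n then -(√2 * √((n : ℝ) - 1) * √((n : ℝ) - 3) * √(n : ℝ))
  else if m = n + 1 then -(√2 * √((n : ℝ) + 1) * √((n : ℝ) - 2) * √(n : ℝ))
  else 0

def L2 : Matrix ℕ ℕ ℝ := fun n m =>
  if m + 2 = n then √(((n : ℝ) - 2) * ((n : ℝ) - 3) * ((n : ℝ) - 4) * (n : ℝ)) / 56
  else if m = n then ((n : ℝ) - 4) * ((n : ℝ) - 7) / 28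
  else if m = n + 2 then √(((n : ℝ) + 2) * ((n : ℝ) - 1) * ((n : ℝ) - 2) * (n : ℝ)) / 56
  else 0

def L3 : Matrix ℕ ℕ ℝ := fun n m =>
  if m + 3 = n then √2 / 3 * √((n : ℝ) * ((n : ℝ) - 4) * ((n : ℝ) - 5))
  else if m + 1 = n then √(2 * (n : ℝ) * ((n : ℝ) - 1) * ((n : ℝ) - 3))
  else if m = n + 1 then √(2 * ((n : ℝ) + 1) * (n : ℝ) * ((n : ℝ) - 2))
  else if m = n + 3 then √2 / 3 * √(((n : ℝ) + 3) * ((n : ℝ) - 1) * ((n : ℝ) - 2))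
  else 0

/-- The list `Y` of fourteen operators. -/
def Y : Fin 14 → Module.End ℝ SmoothFun :=
  ![1, D0, D1, D2, D3, D0 ^ 2, D0 ^ 3, D1 ^ 2, D3 * D0 + D0 * D3,
    D3 * D0 ^ 2 + D0 ^ 2 * D3, D0 * D1 + D1 * D0, D3 * D0 ^ 3 + D0 ^ 3 * D3,
    D0 ^ 2 * D1 + D1 * D0 ^ 2, D0 * D1 ^ 2 + D1 ^ 2 * D0]

/-! The commuting operator -/

/-- The operator `T` in Perline form. -/
def T (N Ω : ℝ) : Module.End ℝ SmoothFun :=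
  -(Ω ^ 3 • D0 ^ 3)
  + (3 / 4 * (2 * Ω ^ 2 - 1)) • (D1 * D0 ^ 2 + D0 ^ 2 * D1)
  - (3 / 2 * Ω) • (D1 ^ 2 * D0 + D0 * D1 ^ 2)
  + (3 / 8 : ℝ) • (D3 * D0 ^ 3 + D0 ^ 3 * D3)
  + (3 * (N * Ω ^ 2 + 2 * Ω ^ 2 - 3 / 2 * N - 4)) • (D1 * D0 + D0 * D1)
  - (3 * (2 * Ω ^ 2 - 1) * Ω) • D0 ^ 2
  - (2 * Ω * (54 * N ^ 2 + 4 * Ω ^ 2 + 48 * N - 3)) • D0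
  - (6 * (2 * N + 1) * Ω) • D1 ^ 2
  + (9 / 8 * (2 * N + 1)) • (D3 * D0 ^ 2 + D0 ^ 2 * D3)
  + (3 / 2 * (3 * N ^ 2 + 3 * N - 7)) • (D0 * D3 + D3 * D0)
  + (3 * (6 * N * Ω ^ 2 - 4 * N ^ 2 + 2 * Ω ^ 2 - 17 * N - 7)) • D1
  + (672 * (N + 1) * N * Ω) • D2
  + (3 / 2 * (2 * N ^ 2 + 2 * N - 15) * (2 * N + 1)) • D3

/-- The coefficient `f₃ = (x - Ω)³`. -/
def f3 (_N Ω : ℝ) : SmoothFun :=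
  ⟨fun x => (x - Ω) ^ 3, by change ContDiff ℝ ∞ _; fun_prop⟩

/-- The coefficient `f₂`. -/
def f2 (N Ω : ℝ) : SmoothFun :=
  ⟨fun x => (3 * (Ω - x) ^ 2 *
      (4 * Ω * x ^ 6 - 4 * x ^ 7 + 8 * N * x ^ 5 + 8 * Ω * x ^ 4 - 12 * x ^ 5
        + 8 * N * x ^ 3 + 21 * Ω * x ^ 2 - 17 * x ^ 3 + 2 * N * x - 7 * Ω + 10 * x)) /
      (2 * x ^ 2 + 1) ^ 2, contDiff_div_pow 2 (by fun_prop)⟩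

/-- The coefficient `f₁`. -/
def f1 (N Ω : ℝ) : SmoothFun :=
  ⟨fun x => (-3 * (Ω - x) *
      (16 * Ω ^ 2 * x ^ 12 - 32 * Ω * x ^ 13 + 16 * x ^ 14 + 64 * N * Ω * x ^ 11
        - 64 * N * x ^ 12 + 64 * N ^ 2 * x ^ 10 + 64 * Ω ^ 2 * x ^ 10 - 160 * Ω * x ^ 11
        + 96 * x ^ 12 + 192 * N * Ω * x ^ 9 - 256 * N * x ^ 10 + 160 * N ^ 2 * x ^ 8
        + 168 * Ω ^ 2 * x ^ 8 - 272 * Ω * x ^ 9 + 72 * x ^ 10 + 416 * N * Ω * x ^ 7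
        - 448 * N * x ^ 8 + 160 * N ^ 2 * x ^ 6 + 152 * Ω ^ 2 * x ^ 6 - 192 * Ω * x ^ 7
        - 120 * x ^ 8 + 160 * N * Ω * x ^ 5 - 128 * N * x ^ 6 + 80 * N ^ 2 * x ^ 4
        - 279 * Ω ^ 2 * x ^ 4 + 334 * Ω * x ^ 5 - 359 * x ^ 6 - 76 * N * Ω * x ^ 3
        + 92 * N * x ^ 4 + 20 * N ^ 2 * x ^ 2 + 1210 * Ω ^ 2 * x ^ 2 - 1662 * Ω * x ^ 3
        + 324 * x ^ 4 - 36 * N * Ω * x + 32 * N * x ^ 2 + 2 * N ^ 2 - 83 * Ω ^ 2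
        + 610 * Ω * x - 497 * x ^ 2 - 2 * N + 18)) /
      (2 * x ^ 2 + 1) ^ 4, contDiff_div_pow 4 (by fun_prop)⟩

/-- The coefficient `f₀`. -/
def f0 (N Ω : ℝ) : SmoothFun :=
  ⟨fun x =>
      (64 * Ω ^ 3 * x ^ 18 - 192 * Ω ^ 2 * x ^ 19 + 192 * Ω * x ^ 20 - 64 * x ^ 21
        + 384 * N * Ω ^ 2 * x ^ 17 - 768 * N * Ω * x ^ 18 + 384 * N * x ^ 19
        + 768 * N ^ 2 * Ω * x ^ 16 + 384 * Ω ^ 3 * x ^ 16 - 768 * N ^ 2 * x ^ 17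
        - 1344 * Ω ^ 2 * x ^ 17 + 1536 * Ω * x ^ 18 - 576 * x ^ 19 + 512 * N ^ 3 * x ^ 15
        + 1920 * N * Ω ^ 2 * x ^ 15 - 4608 * N * Ω * x ^ 16 + 2688 * N * x ^ 17
        + 3456 * N ^ 2 * Ω * x ^ 14 + 624 * Ω ^ 3 * x ^ 14 - 4224 * N ^ 2 * x ^ 15
        - 1296 * Ω ^ 2 * x ^ 15 + 336 * Ω * x ^ 16 + 336 * x ^ 17 + 2304 * N ^ 3 * x ^ 13
        + 4128 * N * Ω ^ 2 * x ^ 13 - 8640 * N * Ω * x ^ 14 + 4000 * N * x ^ 15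
        + 50496 * N ^ 2 * Ω * x ^ 12 + 112 * Ω ^ 3 * x ^ 12 - 10176 * N ^ 2 * x ^ 13
        + 3552 * Ω ^ 2 * x ^ 13 - 10896 * Ω * x ^ 14 + 7616 * x ^ 15 + 4224 * N ^ 3 * x ^ 11
        + 3840 * N * Ω ^ 2 * x ^ 11 + 37824 * N * Ω * x ^ 12 - 1344 * N * x ^ 13
        + 137184 * N ^ 2 * Ω * x ^ 10 - 1332 * Ω ^ 3 * x ^ 10 - 12192 * N ^ 2 * x ^ 11
        + 12156 * Ω ^ 2 * x ^ 11 - 29052 * Ω * x ^ 12 + 18996 * x ^ 13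
        + 4160 * N ^ 3 * x ^ 9 - 1464 * N * Ω ^ 2 * x ^ 9 + 134928 * N * Ω * x ^ 10
        - 10584 * N * x ^ 11 + 165360 * N ^ 2 * Ω * x ^ 8 + 1200 * Ω ^ 3 * x ^ 8
        - 7440 * N ^ 2 * x ^ 9 + 9804 * Ω ^ 2 * x ^ 9 - 31272 * Ω * x ^ 10 + 20940 * x ^ 11
        + 2400 * N ^ 3 * x ^ 7 + 11160 * N * Ω ^ 2 * x ^ 7 + 153312 * N * Ω * x ^ 8
        - 9176 * N * x ^ 9 + 107784 * N ^ 2 * Ω * x ^ 6 + 17521 * Ω ^ 3 * x ^ 6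
        - 1944 * N ^ 2 * x ^ 7 - 24975 * Ω ^ 2 * x ^ 7 - 1917 * Ω * x ^ 8 + 9851 * x ^ 9
        + 816 * N ^ 3 * x ^ 5 + 8670 * N * Ω ^ 2 * x ^ 5 + 109500 * N * Ω * x ^ 6
        - 12858 * N * x ^ 7 + 39708 * N ^ 2 * Ω * x ^ 4 - 139845 * Ω ^ 3 * x ^ 4
        + 108 * N ^ 2 * x ^ 5 + 266580 * Ω ^ 2 * x ^ 5 - 160785 * Ω * x ^ 6 + 31338 * x ^ 7
        + 152 * N ^ 3 * x ^ 3 - 1044 * N * Ω ^ 2 * x ^ 3 + 51324 * N * Ω * x ^ 4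
        - 9792 * N * x ^ 5 + 7818 * N ^ 2 * Ω * x ^ 2 + 69189 * Ω ^ 3 * x ^ 2
        + 162 * N ^ 2 * x ^ 3 - 247383 * Ω ^ 2 * x ^ 3 + 242145 * Ω * x ^ 4 - 68367 * x ^ 5
        + 12 * N ^ 3 * x - 1134 * N * Ω ^ 2 * x + 11466 * N * Ω * x ^ 2 - 1964 * N * x ^ 3
        + 642 * N ^ 2 * Ω - 2097 * Ω ^ 3 + 24 * N ^ 2 * x + 27432 * Ω ^ 2 * x
        - 56673 * Ω * x ^ 2 + 29088 * x ^ 3 + 582 * N * Ω + 144 * N * x + 1134 * Ω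
        - 1512 * x) /
      (2 * x ^ 2 + 1) ^ 6, contDiff_div_pow 6 (by fun_prop)⟩

/-- The operator `w^{-1/2} (∑_{k ≤ 3} ∂^k f_k ∂^k) w^{1/2}`. -/
def symForm (N Ω : ℝ) : Module.End ℝ SmoothFun :=
  mulOp invSqrtW *
    (∑ k : Fin 4, ddx ^ (k : ℕ) * mulOp ((![f0 N Ω, f1 N Ω, f2 N Ω, f3 N Ω]) k) * ddx ^ (k : ℕ)) *
    mulOp sqrtW

/-! The time-and-band limiting operator -/

/-- The kernel `k(x, y) = ∑_{n ≤ N} q_n(x) q_n(y)`. -/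
def kernel (N : ℕ) (x y : ℝ) : ℝ := ∑ n ∈ Finset.range (N + 1), (q n).1 x * (q n).1 y

/-- The integral operator `(S f)(x) = ∫_{-∞}^Ω f(y) w(y) k(x, y) dy`. -/
def S (N : ℕ) (Ω : ℝ) (f : ℝ → ℝ) (x : ℝ) : ℝ := ∫ y in Iio Ω, f y * w y * kernel N x y

/-- Symmetry of a differential operator in `L²((-∞, Ω), w(x) dx)`, on the dense domain of all smooth
functions of temperate growth (which contains all polynomials, and no condition at `Ω`). -/
def IsSymmOn (Ω : ℝ) (D : Module.End ℝ SmoothFun) : Prop :=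
  ∀ f g : SmoothFun, Function.HasTemperateGrowth f.1 → Function.HasTemperateGrowth g.1 →
    IntegrableOn (fun x => (D f).1 x * w x * g.1 x) (Iio Ω) ∧
    ∫ x in Iio Ω, (D f).1 x * w x * g.1 x = ∫ x in Iio Ω, f.1 x * w x * (D g).1 x

/-- `D` commutes with `S`: for every smooth `f` with `f` and `D f` in `L²((-∞, Ω), w(x) dx)`, the
function `S f` is smooth and `D (S f) = S (D f)`. -/
def CommutesWithS (N : ℕ) (Ω : ℝ) (D : Module.End ℝ SmoothFun) : Prop :=
  ∀ f : SmoothFun, MemLp f.1 2 (wMeasure.restrict (Iio Ω)) →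
    MemLp (D f).1 2 (wMeasure.restrict (Iio Ω)) →
    ∃ g : SmoothFun, g.1 = S N Ω f.1 ∧ (D g).1 = S N Ω (D f).1

end ExcHermite

end

/-!
The proof rests on three facts: the operators `D_j` act on the exceptional polynomials by
symmetric band matrices, `T` is a formally symmetric differential operator
`w^{-1/2} (∑ ∂^k f_k ∂^k) w^{1/2}` in which `f_k` vanishes to order `k` at `Ω`, and the matrix of
`T` decouples the degrees `≤ N` from the degrees `> N`.

*Intertwining.* Up to a constant factor `q n` equals `excP n`, a combination of `H_n` and `H_n'`
with polynomial coefficients, whose derivative is divisible by `η = 2 x² + 1`. Hence the relations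
`D_j q_n = (L_j q)_n` follow from the Hermite equation alone (`D0_excP`, …, `D3_excP`), and the
difference operators of the fourteen operators `Y` are built from `L₀, …, L₃` (`intertwines_Y`).

*The symmetric form of `T`.* Conjugation by `w^{1/2}` turns `∂` into `∇ = nab`. Both `T` and the
operator `symForm` are expanded as `∑ c_j ∇^j` with coefficients in `ℝ[x, η⁻¹]`, and the
coefficients agree (`T_eq_symForm`). The form `∑ ∇^k f_k ∇^k` yields an explicit concomitant
(`wDeriv_concomitant`) which vanishes at `Ω`, by the order of vanishing of the `f_k`. At `-∞` a
cutoff is used, and dominated convergence then gives `∫ (T f) w g = ∫ f w (T g)` over `(-∞, Ω)` as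
soon as `f` and `T f` are square integrable and `g` is of temperate growth (`setIntegral_T_mul`).

*Commutation.* For `n ≤ N < m` the entry `(n, m)` of the matrix of `T` vanishes when neither
degree is exceptional (`Tmat_eq_zero`): the coefficients of `T` are made for that. So `T` maps the
span of `q 0, …, q N` to itself by a symmetric matrix, and applying the previous identity to `f`
and `q n` shows that `T` commutes with the finite rank operator `S` (`commutesWithS_T`).

*Orthonormality and completeness.* The operator `D₀` is symmetric with distinct eigenvalues, so
the `q n` are orthogonal; the symmetric operators `D₁` and `D₃` with symmetric matrices force the
norms to be equal, and the norm of the constant `q 0` is computed directly (`ip_q_self`). The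
`q n` span all polynomials `p` with `η ∣ p'`, since they contain one of each possible degree; among
these are all multiples of `η²`. A function `f` orthogonal to them makes all moments of `f η² w`
vanish, and a finite measure with exponential moments is determined by its moments
(`ae_eq_zero_of_orthogonal`).

*Linear independence.* By orthonormality a linear relation between the fourteen operators is one
between the entries of their matrices. On each of the diagonals `m - n = 3, 2, 1, 0`, taken in
this order, it says that a polynomial in `n` vanishes for all `n ≥ 3` (`eq_zero_of_sum_Ymat`).
-/

set_option linter.unusedSimpArgs false

namespace ExcHermite

/-! ### Smooth functions and the conjugated derivative -/

@[ext] theorem SmoothFun.ext' {f g : SmoothFun} (h : ∀ x, f.1 x = g.1 x) : f = g :=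
  Subtype.ext (funext h)

@[simp] theorem coe_add (f g : SmoothFun) (x : ℝ) : (f + g).1 x = f.1 x + g.1 x := rfl
@[simp] theorem coe_sub (f g : SmoothFun) (x : ℝ) : (f - g).1 x = f.1 x - g.1 x := rfl
@[simp] theorem coe_neg (f : SmoothFun) (x : ℝ) : (-f).1 x = -f.1 x := rfl
@[simp] theorem coe_mul (f g : SmoothFun) (x : ℝ) : (f * g).1 x = f.1 x * g.1 x := rfl
@[simp] theorem coe_smul (c : ℝ) (f : SmoothFun) (x : ℝ) : (c • f).1 x = c * f.1 x := rfl
@[simp] theorem coe_pow (f : SmoothFun) (n : ℕ) (x : ℝ) : (f ^ n).1 x = f.1 x ^ n := rfl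
@[simp] theorem coe_zero (x : ℝ) : (0 : SmoothFun).1 x = 0 := rfl
@[simp] theorem coe_one (x : ℝ) : (1 : SmoothFun).1 x = 1 := rfl
@[simp] theorem coe_natCast (n : ℕ) (x : ℝ) : (n : SmoothFun).1 x = n := rfl
@[simp] theorem coe_ofNat (n : ℕ) [n.AtLeastTwo] (x : ℝ) :
    (ofNat(n) : SmoothFun).1 x = ofNat(n) := rfl

@[simp] theorem coe_sum {ι : Type*} (s : Finset ι) (f : ι → SmoothFun) (x : ℝ) :
    (∑ i ∈ s, f i).1 x = ∑ i ∈ s, (f i).1 x := by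
  classical
  induction s using Finset.induction_on with
  | empty => simp
  | insert a s ha ih => rw [Finset.sum_insert ha, Finset.sum_insert ha, coe_add, ih]

@[simp] theorem mulOp_apply (a f : SmoothFun) : mulOp a f = a * f := rfl

theorem differentiable_coe (f : SmoothFun) : Differentiable ℝ f.1 :=
  (contDiff_infty_iff_deriv.1 f.2).1

theorem hasDerivAt_coe (f : SmoothFun) (x : ℝ) : HasDerivAt f.1 ((ddx f).1 x) x :=
  (differentiable_coe f x).hasDerivAt

theorem ddx_eq {f g : SmoothFun} (h : ∀ x, HasDerivAt f.1 (g.1 x) x) : ddx f = g :=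
  SmoothFun.ext' fun x => (h x).deriv

@[simp] theorem ddx_mul (f g : SmoothFun) : ddx (f * g) = ddx f * g + f * ddx g :=
  ddx_eq fun x => (hasDerivAt_coe f x).mul (hasDerivAt_coe g x)

@[simp] theorem ddx_one : ddx 1 = 0 := ddx_eq fun x => hasDerivAt_const x (1 : ℝ)

@[simp] theorem ddx_natCast (n : ℕ) : ddx (n : SmoothFun) = 0 :=
  ddx_eq fun x => hasDerivAt_const x (n : ℝ)

@[simp] theorem ddx_ofNat (n : ℕ) [n.AtLeastTwo] : ddx (ofNat(n) : SmoothFun) = 0 :=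
  ddx_natCast n

@[simp] theorem ddx_pow (f : SmoothFun) (n : ℕ) :
    ddx (f ^ n) = (n : SmoothFun) * f ^ (n - 1) * ddx f :=
  ddx_eq fun x => (hasDerivAt_coe f x).pow n

/-- The constant functions. -/
noncomputable def const (c : ℝ) : SmoothFun := algebraMap ℝ SmoothFun c

@[simp] theorem coe_const (c x : ℝ) : (const c).1 x = c := rfl

@[simp] theorem ddx_const (c : ℝ) : ddx (const c) = 0 := ddx_eq fun x => hasDerivAt_const x c

/-- The coordinate function. -/
def idX : SmoothFun := ⟨fun x => x, by change ContDiff ℝ ∞ _; fun_prop⟩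

@[simp] theorem coe_idX (x : ℝ) : idX.1 x = x := rfl

@[simp] theorem ddx_idX : ddx idX = 1 := ddx_eq fun x => hasDerivAt_id x

theorem contDiff_invEta : ContDiff ℝ ∞ fun x : ℝ => (2 * x ^ 2 + 1)⁻¹ :=
  ContDiff.inv (by fun_prop) fun x => by positivity

/-- The function `1 / η`, `η(x) = 2 x² + 1`. -/
noncomputable def invEta : SmoothFun := ⟨fun x => (2 * x ^ 2 + 1)⁻¹, contDiff_invEta⟩

@[simp] theorem coe_invEta (x : ℝ) : invEta.1 x = (2 * x ^ 2 + 1)⁻¹ := rfl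

@[simp] theorem ddx_invEta : ddx invEta = -(4 * idX * invEta ^ 2) := by
  refine ddx_eq fun x => ?_
  have h : HasDerivAt (fun x : ℝ => 2 * x ^ 2 + 1) (4 * x) x := by
    refine (((hasDerivAt_pow 2 x).const_mul 2).add_const 1).congr_deriv ?_
    norm_num; ring
  have h0 : (2 * x ^ 2 + 1 : ℝ) ≠ 0 := by positivity
  refine (h.inv h0).congr_deriv ?_
  simp only [coe_neg, coe_mul, coe_pow, coe_ofNat, coe_idX, coe_invEta]
  field_simp

/-- The logarithmic derivative of `w^{1/2}`. -/
noncomputable def logDerivSqrtW : SmoothFun := -idX - 4 * idX * invEta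

/-- The derivative conjugated by `w^{1/2}`: `∇ f = w^{-1/2} (w^{1/2} f)'`. In terms of `∇` the
operators `D₀, D₁` become Schrödinger-like, and the coefficients of all products stay short. -/
noncomputable def nab : Module.End ℝ SmoothFun := ddx + mulOp logDerivSqrtW

theorem nab_apply (f : SmoothFun) : nab f = ddx f + logDerivSqrtW * f := rfl

theorem nab_mul (a f : SmoothFun) : nab (a * f) = ddx a * f + a * nab f := by
  simp only [nab_apply, ddx_mul]; ring

theorem hasDerivAt_w (x : ℝ) : HasDerivAt w (2 * logDerivSqrtW.1 x * w x) x := by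
  have h1 : HasDerivAt (fun x : ℝ => Real.exp (-x ^ 2)) (-(2 * x) * Real.exp (-x ^ 2)) x := by
    refine (hasDerivAt_pow 2 x).neg.exp.congr_deriv ?_
    simp only [Pi.neg_apply]
    ring
  have h2 : HasDerivAt (fun x : ℝ => (1 + 2 * x ^ 2) ^ 2) (2 * (1 + 2 * x ^ 2) * (4 * x)) x := by
    refine ((((hasDerivAt_pow 2 x).const_mul 2).const_add 1).pow 2).congr_deriv ?_
    simp only [Nat.cast_ofNat, Nat.add_one_sub_one, pow_one]
    ring
  have h0 : (1 + 2 * x ^ 2 : ℝ) ≠ 0 := by positivity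
  have h0' : (2 * x ^ 2 + 1 : ℝ) ≠ 0 := by positivity
  refine (h1.div h2 (by positivity)).congr_deriv ?_
  simp only [logDerivSqrtW, w, coe_sub, coe_neg, coe_mul, coe_idX, coe_invEta, coe_ofNat]
  field_simp
  ring

theorem ddx_sqrtW : ddx sqrtW = logDerivSqrtW * sqrtW := by
  refine ddx_eq fun x => ?_
  refine ((hasDerivAt_w x).sqrt (w_pos x).ne').congr_deriv ?_
  have h : √(w x) ≠ 0 := (Real.sqrt_pos.2 (w_pos x)).ne'
  have h2 : √(w x) ^ 2 = w x := Real.sq_sqrt (w_pos x).le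
  change _ = logDerivSqrtW.1 x * √(w x)
  field_simp
  rw [h2]

theorem invSqrtW_mul_sqrtW : invSqrtW * sqrtW = 1 :=
  SmoothFun.ext' fun x => inv_mul_cancel₀ (Real.sqrt_pos.2 (w_pos x)).ne'

theorem ddx_sqrtW_mul (f : SmoothFun) : ddx (sqrtW * f) = sqrtW * nab f := by
  rw [ddx_mul, ddx_sqrtW, nab_apply]; ring

theorem ddx_pow_sqrtW_mul (k : ℕ) (f : SmoothFun) :
    (ddx ^ k) (sqrtW * f) = sqrtW * (nab ^ k) f := by
  induction k with
  | zero => simp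
  | succ k ih => rw [pow_succ', pow_succ', Module.End.mul_apply, ih, ddx_sqrtW_mul]; rfl

/-- Conjugation by `w^{1/2}` replaces every `∂` of the inner operator by `∇`. -/
theorem symForm_apply (N Ω : ℝ) (f : SmoothFun) :
    symForm N Ω f = f0 N Ω * f + nab (f1 N Ω * nab f) + nab (nab (f2 N Ω * nab (nab f))) +
      nab (nab (nab (f3 N Ω * nab (nab (nab f))))) := by
  have key : ∀ (k : ℕ) (a : SmoothFun), (ddx ^ k * mulOp a * ddx ^ k) (sqrtW * f) =
      sqrtW * (nab ^ k) (a * (nab ^ k) f) := fun k a => by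
    rw [Module.End.mul_apply, Module.End.mul_apply, ddx_pow_sqrtW_mul, mulOp_apply,
      show a * (sqrtW * (nab ^ k) f) = sqrtW * (a * (nab ^ k) f) by ring, ddx_pow_sqrtW_mul]
  have h : symForm N Ω f = invSqrtW * ((∑ k : Fin 4, ddx ^ (k : ℕ) *
      mulOp ((![f0 N Ω, f1 N Ω, f2 N Ω, f3 N Ω]) k) * ddx ^ (k : ℕ)) (sqrtW * f)) := rfl
  rw [h, LinearMap.sum_apply]
  simp only [key]
  rw [← Finset.mul_sum, ← mul_assoc, invSqrtW_mul_sqrtW, one_mul]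
  simp only [Fin.sum_univ_four]
  rfl

theorem D0_apply (f : SmoothFun) :
    D0 f = nab (nab f) - (idX ^ 2 + 3 + 8 * invEta - 16 * invEta ^ 2) * f := by
  ext x
  simp [D0, nab_apply, logDerivSqrtW, pow_two, mul_add, add_mul, sub_mul]
  field_simp
  ring

theorem D1_apply (f : SmoothFun) :
    D1 f = idX * nab (nab f) + nab f -
      (idX ^ 3 + 2 * idX + 4 * idX * invEta - 16 * idX * invEta ^ 2) * f := by
  ext x
  simp [D1, nab_apply, logDerivSqrtW, pow_two, mul_add, add_mul, sub_mul]
  field_simp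
  ring

theorem D2_apply (f : SmoothFun) :
    D2 f = (1 / 112 : ℝ) • ((17 - 2 * idX ^ 2) * nab (nab f) - 4 * idX * nab f +
      (2 * idX ^ 4 - 15 * idX ^ 2 + 288 * invEta ^ 2 - 152 * invEta + 61) * f) := by
  ext x
  simp [D2, nab_apply, logDerivSqrtW, pow_two, mul_add, add_mul, sub_mul]
  field_simp
  ring

theorem D3_apply (f : SmoothFun) : D3 f = (1 / 3 : ℝ) • ((4 * idX ^ 3 + 6 * idX) * f) := by
  ext x
  simp [D3]
  ring

/-! ### Normal forms of the products of the operators `D_j` -/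

/- A product of the `D_j` is written as `∑ c_j ∇^j` with coefficients `c_j` in the algebra generated
by `x` and `η⁻¹`. The relation `2 x² η⁻¹ = 1 - η⁻¹` reduces such a coefficient to a unique
combination of the functions `x^i`, `η^{-j}` and `x η^{-j}`. -/

set_option maxRecDepth 4000 in
theorem D0_D0_apply (f : SmoothFun) : D0 (D0 f) =
    nab (nab (nab (nab f))) + (-2 * idX ^ 2 + 32 * invEta ^ 2 - 16 * invEta - 6) * nab (nab f)
    + (-256 * idX * invEta ^ 3 + 64 * idX * invEta ^ 2 - 4 * idX) * nab f + (idX ^ 4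
    + 6 * idX ^ 2 - 512 * invEta ^ 4 + 512 * invEta ^ 3 - 112 * invEta ^ 2 + 24 * invEta
    + 15) * f := by
  rw [D0_apply (D0 f), D0_apply f]
  simp only [map_add, map_sub, map_neg, nab_mul, ddx_mul, ddx_pow, ddx_idX, ddx_invEta, ddx_ofNat,
    ddx_natCast, ddx_one, map_zero]
  ext x
  simp only [coe_add, coe_sub, coe_neg, coe_mul, coe_pow, coe_ofNat, coe_natCast, coe_zero, coe_one,
    coe_idX, coe_invEta]
  push_cast
  field_simp
  ring

set_option maxRecDepth 4000 in
theorem D0_D0_D0_apply (f : SmoothFun) : D0 (D0 (D0 f)) =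
    nab (nab (nab (nab (nab (nab f))))) + (-3 * idX ^ 2 + 48 * invEta ^ 2 - 24 * invEta
    - 9) * nab (nab (nab (nab f))) + (-768 * idX * invEta ^ 3 + 192 * idX * invEta ^ 2
    - 12 * idX) * nab (nab (nab f)) + (3 * idX ^ 4 + 18 * idX ^ 2 - 4608 * invEta ^ 4
    + 4608 * invEta ^ 3 - 720 * invEta ^ 2 + 72 * invEta + 37) * nab (nab f) + (12 * idX ^ 3
    + 36864 * idX * invEta ^ 5 - 27648 * idX * invEta ^ 4 + 3456 * idX * invEta ^ 3
    - 288 * idX * invEta ^ 2 + 36 * idX) * nab f + (-idX ^ 6 - 9 * idX ^ 4 - 25 * idX ^ 2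
    + 73728 * invEta ^ 6 - 110592 * invEta ^ 5 + 43776 * invEta ^ 4 - 4608 * invEta ^ 3
    + 316 * invEta ^ 2 - 62 * invEta - 63) * f := by
  rw [D0_D0_apply f, D0_apply]
  simp only [map_add, map_sub, map_neg, nab_mul, ddx_mul, ddx_pow, ddx_idX, ddx_invEta, ddx_ofNat,
    ddx_natCast, ddx_one, map_zero]
  ext x
  simp only [coe_add, coe_sub, coe_neg, coe_mul, coe_pow, coe_ofNat, coe_natCast, coe_zero, coe_one,
    coe_idX, coe_invEta]
  push_cast
  field_simp
  ring

set_option maxRecDepth 4000 in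
theorem D0_D1_apply (f : SmoothFun) : D0 (D1 f) =
    idX * nab (nab (nab (nab f))) + 3 * nab (nab (nab f)) + (-2 * idX ^ 3
    + 32 * idX * invEta ^ 2 - 12 * idX * invEta - 5 * idX) * nab (nab f) + (-7 * idX ^ 2
    + 128 * invEta ^ 3 - 96 * invEta ^ 2 - 7) * nab f + (idX ^ 5 + 5 * idX ^ 3
    - 512 * idX * invEta ^ 4 + 256 * idX * invEta ^ 3 - 48 * idX * invEta ^ 2
    + 6 * idX * invEta + 6 * idX) * f := by
  rw [D0_apply, D1_apply f]
  simp only [map_add, map_sub, map_neg, nab_mul, ddx_mul, ddx_pow, ddx_idX, ddx_invEta, ddx_ofNat,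
    ddx_natCast, ddx_one, map_zero]
  ext x
  simp only [coe_add, coe_sub, coe_neg, coe_mul, coe_pow, coe_ofNat, coe_natCast, coe_zero, coe_one,
    coe_idX, coe_invEta]
  push_cast
  field_simp
  ring

set_option maxRecDepth 4000 in
theorem D1_D0_apply (f : SmoothFun) : D1 (D0 f) =
    idX * nab (nab (nab (nab f))) + nab (nab (nab f)) + (-2 * idX ^ 3 + 32 * idX * invEta ^ 2
    - 12 * idX * invEta - 5 * idX) * nab (nab f) + (-5 * idX ^ 2 + 128 * invEta ^ 3
    - 144 * invEta ^ 2 + 24 * invEta - 3) * nab f + (idX ^ 5 + 5 * idX ^ 3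
    - 512 * idX * invEta ^ 4 + 448 * idX * invEta ^ 3 - 96 * idX * invEta ^ 2
    + 6 * idX * invEta + 8 * idX) * f := by
  rw [D1_apply, D0_apply f]
  simp only [map_add, map_sub, map_neg, nab_mul, ddx_mul, ddx_pow, ddx_idX, ddx_invEta, ddx_ofNat,
    ddx_natCast, ddx_one, map_zero]
  ext x
  simp only [coe_add, coe_sub, coe_neg, coe_mul, coe_pow, coe_ofNat, coe_natCast, coe_zero, coe_one,
    coe_idX, coe_invEta]
  push_cast
  field_simp
  ring

set_option maxRecDepth 4000 in
theorem D1_D1_apply (f : SmoothFun) : D1 (D1 f) =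
    (idX ^ 2) * nab (nab (nab (nab f))) + (4 * idX) * nab (nab (nab f)) + (-2 * idX ^ 4
    - 4 * idX ^ 2 - 16 * invEta ^ 2 + 20 * invEta - 2) * nab (nab f) + (-8 * idX ^ 3
    + 128 * idX * invEta ^ 3 - 80 * idX * invEta ^ 2 - 8 * idX) * nab f + (idX ^ 6
    + 4 * idX ^ 4 - idX ^ 2 + 256 * invEta ^ 4 - 352 * invEta ^ 3 + 128 * invEta ^ 2
    - 18 * invEta - 4) * f := by
  rw [D1_apply (D1 f), D1_apply f]
  simp only [map_add, map_sub, map_neg, nab_mul, ddx_mul, ddx_pow, ddx_idX, ddx_invEta, ddx_ofNat,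
    ddx_natCast, ddx_one, map_zero]
  ext x
  simp only [coe_add, coe_sub, coe_neg, coe_mul, coe_pow, coe_ofNat, coe_natCast, coe_zero, coe_one,
    coe_idX, coe_invEta]
  push_cast
  field_simp
  ring

set_option maxRecDepth 4000 in
theorem D0_cubic_apply (f : SmoothFun) : D0 ((4 * idX ^ 3 + 6 * idX) * f) =
    (4 * idX ^ 3 + 6 * idX) * nab (nab f) + (24 * idX ^ 2 + 12) * nab f + (-4 * idX ^ 5
    - 18 * idX ^ 3 + 64 * idX * invEta ^ 2 - 10 * idX) * f := by
  rw [D0_apply]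
  simp only [map_add, map_sub, map_neg, nab_mul, ddx_mul, ddx_pow, ddx_idX, ddx_invEta, ddx_ofNat,
    ddx_natCast, ddx_one, map_zero]
  ext x
  simp only [coe_add, coe_sub, coe_neg, coe_mul, coe_pow, coe_ofNat, coe_natCast, coe_zero, coe_one,
    coe_idX, coe_invEta]
  push_cast
  field_simp
  ring

set_option maxRecDepth 4000 in
theorem D0_D0_cubic_apply (f : SmoothFun) : D0 (D0 ((4 * idX ^ 3 + 6 * idX) * f)) =
    (4 * idX ^ 3 + 6 * idX) * nab (nab (nab (nab f))) + (48 * idX ^ 2 + 24) * nab (nab (nab f))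
    + (-8 * idX ^ 5 - 36 * idX ^ 3 + 128 * idX * invEta ^ 2 + 76 * idX) * nab (nab f)
    + (-64 * idX ^ 4 - 192 * idX ^ 2 + 512 * invEta ^ 3 - 384 * invEta ^ 2 + 192 * invEta
    - 104) * nab f + (4 * idX ^ 7 + 30 * idX ^ 5 - 2048 * idX * invEta ^ 4
    + 1024 * idX * invEta ^ 3 - 192 * idX * invEta ^ 2 - 128 * idX * invEta - 30 * idX) * f := by
  rw [D0_cubic_apply, D0_apply]
  simp only [map_add, map_sub, map_neg, nab_mul, ddx_mul, ddx_pow, ddx_idX, ddx_invEta, ddx_ofNat,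
    ddx_natCast, ddx_one, map_zero]
  ext x
  simp only [coe_add, coe_sub, coe_neg, coe_mul, coe_pow, coe_ofNat, coe_natCast, coe_zero, coe_one,
    coe_idX, coe_invEta]
  push_cast
  field_simp
  ring

set_option maxRecDepth 4000 in
theorem D0_D0_D0_cubic_apply (f : SmoothFun) : D0 (D0 (D0 ((4 * idX ^ 3 + 6 * idX) * f))) =
    (4 * idX ^ 3 + 6 * idX) * nab (nab (nab (nab (nab (nab f))))) + (72 * idX ^ 2 + 36) * nab
    (nab (nab (nab (nab f)))) + (-12 * idX ^ 5 - 54 * idX ^ 3 + 192 * idX * invEta ^ 2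
    + 258 * idX) * nab (nab (nab (nab f))) + (-192 * idX ^ 4 - 576 * idX ^ 2
    + 1536 * invEta ^ 3 - 1152 * invEta ^ 2 + 576 * invEta - 120) * nab (nab (nab f))
    + (12 * idX ^ 7 + 90 * idX ^ 5 - 608 * idX ^ 3 - 18432 * idX * invEta ^ 4
    + 9216 * idX * invEta ^ 3 - 576 * idX * invEta ^ 2 - 1152 * idX * invEta
    - 1146 * idX) * nab (nab f) + (120 * idX ^ 6 + 684 * idX ^ 4 + 168 * idX ^ 2
    - 73728 * invEta ^ 5 + 92160 * invEta ^ 4 - 25344 * invEta ^ 3 + 1728 * invEta ^ 2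
    - 864 * invEta + 156) * nab f + (-4 * idX ^ 9 - 42 * idX ^ 7 + 62 * idX ^ 5 + 534 * idX ^ 3
    + 294912 * idX * invEta ^ 6 - 294912 * idX * invEta ^ 5 + 64512 * idX * invEta ^ 4
    - 4608 * idX * invEta ^ 3 + 112 * idX * invEta ^ 2 + 384 * idX * invEta + 314 * idX) * f := by
  rw [D0_D0_cubic_apply, D0_apply]
  simp only [map_add, map_sub, map_neg, nab_mul, ddx_mul, ddx_pow, ddx_idX, ddx_invEta, ddx_ofNat,
    ddx_natCast, ddx_one, map_zero]
  ext x
  simp only [coe_add, coe_sub, coe_neg, coe_mul, coe_pow, coe_ofNat, coe_natCast, coe_zero, coe_one,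
    coe_idX, coe_invEta]
  push_cast
  field_simp
  ring

set_option maxRecDepth 4000 in
theorem D0_D0_D1_apply (f : SmoothFun) : D0 (D0 (D1 f)) =
    idX * nab (nab (nab (nab (nab (nab f))))) + 5 * nab (nab (nab (nab (nab f))))
    + (-3 * idX ^ 3 + 48 * idX * invEta ^ 2 - 20 * idX * invEta - 8 * idX) * nab (nab (nab (nab
    f))) + (-22 * idX ^ 2 + 384 * invEta ^ 3 - 288 * invEta ^ 2 - 26) * nab (nab (nab f))
    + (3 * idX ^ 5 + 16 * idX ^ 3 - 4608 * idX * invEta ^ 4 + 2304 * idX * invEta ^ 3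
    - 144 * idX * invEta ^ 2 + 36 * idX * invEta - 5 * idX) * nab (nab f) + (17 * idX ^ 4
    + 58 * idX ^ 2 - 18432 * invEta ^ 5 + 23040 * invEta ^ 4 - 6336 * invEta ^ 3
    + 432 * invEta ^ 2 + 8 * invEta + 47) * nab f + (-idX ^ 7 - 8 * idX ^ 5 - 5 * idX ^ 3
    + 73728 * idX * invEta ^ 6 - 73728 * idX * invEta ^ 5 + 16128 * idX * invEta ^ 4
    - 1152 * idX * invEta ^ 3 + 28 * idX * invEta ^ 2 + 11 * idX * invEta - 5 * idX) * f := by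
  rw [D0_D1_apply, D0_apply]
  simp only [map_add, map_sub, map_neg, nab_mul, ddx_mul, ddx_pow, ddx_idX, ddx_invEta, ddx_ofNat,
    ddx_natCast, ddx_one, map_zero]
  ext x
  simp only [coe_add, coe_sub, coe_neg, coe_mul, coe_pow, coe_ofNat, coe_natCast, coe_zero, coe_one,
    coe_idX, coe_invEta]
  push_cast
  field_simp
  ring

set_option maxRecDepth 4000 in
theorem D1_D0_D0_apply (f : SmoothFun) : D1 (D0 (D0 f)) =
    idX * nab (nab (nab (nab (nab (nab f))))) + nab (nab (nab (nab (nab f)))) + (-3 * idX ^ 3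
    + 48 * idX * invEta ^ 2 - 20 * idX * invEta - 8 * idX) * nab (nab (nab (nab f)))
    + (-14 * idX ^ 2 + 384 * invEta ^ 3 - 448 * invEta ^ 2 + 80 * invEta - 6) * nab (nab (nab
    f)) + (3 * idX ^ 5 + 16 * idX ^ 3 - 4608 * idX * invEta ^ 4 + 4224 * idX * invEta ^ 3
    - 624 * idX * invEta ^ 2 + 36 * idX * invEta + 19 * idX) * nab (nab f) + (13 * idX ^ 4
    + 38 * idX ^ 2 - 18432 * invEta ^ 5 + 30720 * invEta ^ 4 - 14016 * invEta ^ 3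
    + 1536 * invEta ^ 2 - 80 * invEta + 3) * nab f + (-idX ^ 7 - 8 * idX ^ 5 - 13 * idX ^ 3
    + 73728 * idX * invEta ^ 6 - 104448 * idX * invEta ^ 5 + 39168 * idX * invEta ^ 4
    - 3648 * idX * invEta ^ 3 + 204 * idX * invEta ^ 2 + 11 * idX * invEta - 25 * idX) * f := by
  rw [D0_D0_apply, D1_apply]
  simp only [map_add, map_sub, map_neg, nab_mul, ddx_mul, ddx_pow, ddx_idX, ddx_invEta, ddx_ofNat,
    ddx_natCast, ddx_one, map_zero]
  ext x
  simp only [coe_add, coe_sub, coe_neg, coe_mul, coe_pow, coe_ofNat, coe_natCast, coe_zero, coe_one,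
    coe_idX, coe_invEta]
  push_cast
  field_simp
  ring

set_option maxRecDepth 4000 in
theorem D0_D1_D1_apply (f : SmoothFun) : D0 (D1 (D1 f)) =
    (idX ^ 2) * nab (nab (nab (nab (nab (nab f))))) + (8 * idX) * nab (nab (nab (nab (nab f))))
    + (-3 * idX ^ 4 - 7 * idX ^ 2 - 24 * invEta ^ 2 + 32 * invEta + 4) * nab (nab (nab (nab
    f))) + (-28 * idX ^ 3 + 384 * idX * invEta ^ 3 - 176 * idX * invEta ^ 2 - 32 * idX * invEta
    - 36 * idX) * nab (nab (nab f)) + (3 * idX ^ 6 + 14 * idX ^ 4 - 51 * idX ^ 2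
    + 2304 * invEta ^ 4 - 2784 * invEta ^ 3 + 720 * invEta ^ 2 - 72 * invEta - 28) * nab (nab
    f) + (20 * idX ^ 5 + 64 * idX ^ 3 - 18432 * idX * invEta ^ 5 + 17664 * idX * invEta ^ 4
    - 3648 * idX * invEta ^ 3 + 216 * idX * invEta ^ 2 + 8 * idX * invEta + 4 * idX) * nab f
    + (-idX ^ 8 - 7 * idX ^ 6 + 15 * idX ^ 4 + 45 * idX ^ 2 - 36864 * invEta ^ 6
    + 62976 * invEta ^ 5 - 31488 * invEta ^ 4 + 4848 * invEta ^ 3 - 258 * invEta ^ 2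
    - 32 * invEta + 42) * f := by
  rw [D1_D1_apply, D0_apply]
  simp only [map_add, map_sub, map_neg, nab_mul, ddx_mul, ddx_pow, ddx_idX, ddx_invEta, ddx_ofNat,
    ddx_natCast, ddx_one, map_zero]
  ext x
  simp only [coe_add, coe_sub, coe_neg, coe_mul, coe_pow, coe_ofNat, coe_natCast, coe_zero, coe_one,
    coe_idX, coe_invEta]
  push_cast
  field_simp
  ring

set_option maxRecDepth 4000 in
theorem D1_D1_D0_apply (f : SmoothFun) : D1 (D1 (D0 f)) =
    (idX ^ 2) * nab (nab (nab (nab (nab (nab f))))) + (4 * idX) * nab (nab (nab (nab (nab f))))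
    + (-3 * idX ^ 4 - 7 * idX ^ 2 - 24 * invEta ^ 2 + 32 * invEta - 6) * nab (nab (nab (nab
    f))) + (-20 * idX ^ 3 + 384 * idX * invEta ^ 3 - 336 * idX * invEta ^ 2 + 32 * idX * invEta
    - 20 * idX) * nab (nab (nab f)) + (3 * idX ^ 6 + 14 * idX ^ 4 - 15 * idX ^ 2
    + 2304 * invEta ^ 4 - 3744 * invEta ^ 3 + 1632 * invEta ^ 2 - 168 * invEta - 4) * nab (nab
    f) + (16 * idX ^ 5 + 48 * idX ^ 3 - 18432 * idX * invEta ^ 5 + 25344 * idX * invEta ^ 4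
    - 9024 * idX * invEta ^ 3 + 744 * idX * invEta ^ 2 - 8 * idX * invEta + 8 * idX) * nab f
    + (-idX ^ 8 - 7 * idX ^ 6 + 5 * idX ^ 4 + 21 * idX ^ 2 - 36864 * invEta ^ 6
    + 78336 * invEta ^ 5 - 53760 * invEta ^ 4 + 13008 * invEta ^ 3 - 874 * invEta ^ 2
    - 24 * invEta + 32) * f := by
  rw [D1_D0_apply, D1_apply]
  simp only [map_add, map_sub, map_neg, nab_mul, ddx_mul, ddx_pow, ddx_idX, ddx_invEta, ddx_ofNat,
    ddx_natCast, ddx_one, map_zero]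
  ext x
  simp only [coe_add, coe_sub, coe_neg, coe_mul, coe_pow, coe_ofNat, coe_natCast, coe_zero, coe_one,
    coe_idX, coe_invEta]
  push_cast
  field_simp
  ring

set_option maxRecDepth 4000 in
theorem cubic_mul_D0_apply (f : SmoothFun) : (4 * idX ^ 3 + 6 * idX) * D0 f =
    (4 * idX ^ 3 + 6 * idX) * nab (nab f) + (-4 * idX ^ 5 - 18 * idX ^ 3
    + 64 * idX * invEta ^ 2 - 34 * idX) * f := by
  rw [D0_apply f]
  ext x
  simp only [coe_add, coe_sub, coe_neg, coe_mul, coe_pow, coe_ofNat, coe_idX, coe_invEta]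
  field_simp
  ring

set_option maxRecDepth 4000 in
theorem cubic_mul_D0_D0_apply (f : SmoothFun) : (4 * idX ^ 3 + 6 * idX) * D0 (D0 f) =
    (4 * idX ^ 3 + 6 * idX) * nab (nab (nab (nab f))) + (-8 * idX ^ 5 - 36 * idX ^ 3
    + 128 * idX * invEta ^ 2 - 68 * idX) * nab (nab f) + (-16 * idX ^ 4 - 24 * idX ^ 2
    + 512 * invEta ^ 3 - 384 * invEta ^ 2 - 192 * invEta + 64) * nab f + (4 * idX ^ 7
    + 30 * idX ^ 5 + 96 * idX ^ 3 - 2048 * idX * invEta ^ 4 + 1024 * idX * invEta ^ 3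
    + 576 * idX * invEta ^ 2 - 128 * idX * invEta + 138 * idX) * f := by
  rw [D0_D0_apply f]
  ext x
  simp only [coe_add, coe_sub, coe_neg, coe_mul, coe_pow, coe_ofNat, coe_idX, coe_invEta]
  field_simp
  ring

set_option maxRecDepth 4000 in
theorem cubic_mul_D0_D0_D0_apply (f : SmoothFun) : (4 * idX ^ 3 + 6 * idX) * D0 (D0 (D0 f)) =
    (4 * idX ^ 3 + 6 * idX) * nab (nab (nab (nab (nab (nab f))))) + (-12 * idX ^ 5
    - 54 * idX ^ 3 + 192 * idX * invEta ^ 2 - 102 * idX) * nab (nab (nab (nab f)))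
    + (-48 * idX ^ 4 - 72 * idX ^ 2 + 1536 * invEta ^ 3 - 1152 * invEta ^ 2 - 576 * invEta
    + 192) * nab (nab (nab f)) + (12 * idX ^ 7 + 90 * idX ^ 5 + 256 * idX ^ 3
    - 18432 * idX * invEta ^ 4 + 9216 * idX * invEta ^ 3 + 6336 * idX * invEta ^ 2
    - 1152 * idX * invEta + 366 * idX) * nab (nab f) + (48 * idX ^ 6 + 216 * idX ^ 4
    + 216 * idX ^ 2 - 73728 * invEta ^ 5 + 92160 * invEta ^ 4 + 2304 * invEta ^ 3
    - 23616 * invEta ^ 2 + 3168 * invEta - 288) * nab f + (-4 * idX ^ 9 - 42 * idX ^ 7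
    - 154 * idX ^ 5 - 402 * idX ^ 3 + 294912 * idX * invEta ^ 6 - 294912 * idX * invEta ^ 5
    - 46080 * idX * invEta ^ 4 + 69120 * idX * invEta ^ 3 - 7952 * idX * invEta ^ 2
    + 384 * idX * invEta - 502 * idX) * f := by
  rw [D0_D0_D0_apply f]
  ext x
  simp only [coe_add, coe_sub, coe_neg, coe_mul, coe_pow, coe_ofNat, coe_idX, coe_invEta]
  field_simp
  ring

/-! ### The Perline form of `T` -/

/- The coefficients `f_k` in the same normal form. -/

theorem f3_eq (N Ω : ℝ) : f3 N Ω = (idX - const Ω) ^ 3 := rfl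

set_option maxRecDepth 4000 in
set_option maxHeartbeats 1000000 in
theorem f2_eq (N Ω : ℝ) : f2 N Ω =
    -3 * idX ^ 5 + 9 * const Ω * idX ^ 4 + 6 * const N * idX ^ 3 - 9 * const Ω ^ 2 * idX ^ 3
    - 6 * idX ^ 3 - 12 * const N * const Ω * idX ^ 2 + 3 * const Ω ^ 3 * idX ^ 2
    + 15 * const Ω * idX ^ 2 + 144 * const Ω ^ 2 * idX * invEta ^ 2 - 24 * idX * invEta ^ 2
    - 60 * const Ω ^ 2 * idX * invEta + 30 * idX * invEta + 6 * const N * const Ω ^ 2 * idX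
    - 12 * const Ω ^ 2 * idX - 6 * idX - 48 * const Ω ^ 3 * invEta ^ 2
    + 72 * const Ω * invEta ^ 2 + 24 * const Ω ^ 3 * invEta - 96 * const Ω * invEta
    + 3 * const Ω ^ 3 + 24 * const Ω := by
  ext x
  simp only [coe_add, coe_sub, coe_neg, coe_mul, coe_pow, coe_ofNat, coe_natCast, coe_zero, coe_one,
    coe_idX, coe_invEta, coe_const]
  simp only [f2]
  field_simp
  ring

set_option maxRecDepth 4000 in
set_option maxHeartbeats 1000000 in
theorem f1_eq (N Ω : ℝ) : f1 N Ω =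
    3 * idX ^ 7 - 9 * const Ω * idX ^ 6 - 12 * const N * idX ^ 5 + 9 * const Ω ^ 2 * idX ^ 5
    + 12 * idX ^ 5 + 24 * const N * const Ω * idX ^ 4 - 3 * const Ω ^ 3 * idX ^ 4
    - 30 * const Ω * idX ^ 4 + 12 * const N ^ 2 * idX ^ 3
    - 12 * const N * const Ω ^ 2 * idX ^ 3 - 24 * const N * idX ^ 3
    + 24 * const Ω ^ 2 * idX ^ 3 - 15 * idX ^ 3 - 12 * const N ^ 2 * const Ω * idX ^ 2
    + 36 * const N * const Ω * idX ^ 2 - 6 * const Ω ^ 3 * idX ^ 2 + 9 * const Ω * idX ^ 2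
    - 6912 * const Ω ^ 2 * idX * invEta ^ 4 + 1152 * idX * invEta ^ 4
    + 5376 * const Ω ^ 2 * idX * invEta ^ 3 - 1536 * idX * invEta ^ 3
    + 192 * const N * const Ω ^ 2 * idX * invEta ^ 2 - 96 * const N * idX * invEta ^ 2
    - 528 * const Ω ^ 2 * idX * invEta ^ 2 + 504 * idX * invEta ^ 2
    - 72 * const N * const Ω ^ 2 * idX * invEta + 108 * const N * idX * invEta
    - 36 * const Ω ^ 2 * idX * invEta - 54 * idX * invEta + 6 * const N ^ 2 * idX
    - 12 * const N * const Ω ^ 2 * idX - 18 * const N * idX + 21 * const Ω ^ 2 * idX - 12 * idX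
    + 2304 * const Ω ^ 3 * invEta ^ 4 - 3456 * const Ω * invEta ^ 4
    - 2304 * const Ω ^ 3 * invEta ^ 3 + 5376 * const Ω * invEta ^ 3
    + 192 * const N * const Ω * invEta ^ 2 + 240 * const Ω ^ 3 * invEta ^ 2
    - 2184 * const Ω * invEta ^ 2 - 240 * const N * const Ω * invEta
    + 24 * const Ω ^ 3 * invEta + 192 * const Ω * invEta - 6 * const N ^ 2 * const Ω
    + 54 * const N * const Ω - 15 * const Ω ^ 3 + 18 * const Ω := by
  ext x
  simp only [coe_add, coe_sub, coe_neg, coe_mul, coe_pow, coe_ofNat, coe_natCast, coe_zero, coe_one,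
    coe_idX, coe_invEta, coe_const]
  simp only [f1]
  field_simp
  ring

set_option maxRecDepth 4000 in
set_option maxHeartbeats 1000000 in
theorem ddx_f2 (N Ω : ℝ) : ddx (f2 N Ω) =
    -15 * idX ^ 4 + 36 * const Ω * idX ^ 3 + 18 * const N * idX ^ 2
    - 27 * const Ω ^ 2 * idX ^ 2 - 18 * idX ^ 2 + 384 * const Ω ^ 3 * idX * invEta ^ 3
    - 576 * const Ω * idX * invEta ^ 3 - 96 * const Ω ^ 3 * idX * invEta ^ 2
    + 384 * const Ω * idX * invEta ^ 2 - 24 * const N * const Ω * idX + 6 * const Ω ^ 3 * idX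
    + 30 * const Ω * idX + 576 * const Ω ^ 2 * invEta ^ 3 - 96 * invEta ^ 3
    - 552 * const Ω ^ 2 * invEta ^ 2 + 132 * invEta ^ 2 + 60 * const Ω ^ 2 * invEta
    - 30 * invEta + 6 * const N * const Ω ^ 2 - 12 * const Ω ^ 2 - 6 := by
  rw [f2_eq]
  simp only [map_add, map_sub, map_neg, ddx_mul, ddx_pow, ddx_idX, ddx_invEta, ddx_ofNat,
    ddx_natCast, ddx_one, ddx_const, map_zero]
  ext x
  simp only [coe_add, coe_sub, coe_neg, coe_mul, coe_pow, coe_ofNat, coe_natCast, coe_zero, coe_one,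
    coe_idX, coe_invEta, coe_const]
  push_cast
  field_simp
  ring

set_option maxRecDepth 4000 in
set_option maxHeartbeats 1000000 in
theorem ddx_ddx_f2 (N Ω : ℝ) : ddx (ddx (f2 N Ω)) =
    -60 * idX ^ 3 + 108 * const Ω * idX ^ 2 - 6912 * const Ω ^ 2 * idX * invEta ^ 4
    + 1152 * idX * invEta ^ 4 + 4416 * const Ω ^ 2 * idX * invEta ^ 3 - 1056 * idX * invEta ^ 3
    - 240 * const Ω ^ 2 * idX * invEta ^ 2 + 120 * idX * invEta ^ 2 + 36 * const N * idX
    - 54 * const Ω ^ 2 * idX - 36 * idX + 2304 * const Ω ^ 3 * invEta ^ 4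
    - 3456 * const Ω * invEta ^ 4 - 2304 * const Ω ^ 3 * invEta ^ 3
    + 4416 * const Ω * invEta ^ 3 + 288 * const Ω ^ 3 * invEta ^ 2
    - 1152 * const Ω * invEta ^ 2 - 24 * const N * const Ω + 6 * const Ω ^ 3 + 30 * const Ω := by
  rw [ddx_f2]
  simp only [map_add, map_sub, map_neg, ddx_mul, ddx_pow, ddx_idX, ddx_invEta, ddx_ofNat,
    ddx_natCast, ddx_one, ddx_const, map_zero]
  ext x
  simp only [coe_add, coe_sub, coe_neg, coe_mul, coe_pow, coe_ofNat, coe_natCast, coe_zero, coe_one,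
    coe_idX, coe_invEta, coe_const]
  push_cast
  field_simp
  ring

set_option maxRecDepth 4000 in
set_option maxHeartbeats 1000000 in
theorem ddx_f1 (N Ω : ℝ) : ddx (f1 N Ω) =
    21 * idX ^ 6 - 54 * const Ω * idX ^ 5 - 60 * const N * idX ^ 4 + 45 * const Ω ^ 2 * idX ^ 4
    + 60 * idX ^ 4 + 96 * const N * const Ω * idX ^ 3 - 12 * const Ω ^ 3 * idX ^ 3
    - 120 * const Ω * idX ^ 3 + 36 * const N ^ 2 * idX ^ 2
    - 36 * const N * const Ω ^ 2 * idX ^ 2 - 72 * const N * idX ^ 2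
    + 72 * const Ω ^ 2 * idX ^ 2 - 45 * idX ^ 2 - 36864 * const Ω ^ 3 * idX * invEta ^ 5
    + 55296 * const Ω * idX * invEta ^ 5 + 27648 * const Ω ^ 3 * idX * invEta ^ 4
    - 64512 * const Ω * idX * invEta ^ 4 - 1536 * const N * const Ω * idX * invEta ^ 3
    - 1920 * const Ω ^ 3 * idX * invEta ^ 3 + 17472 * const Ω * idX * invEta ^ 3
    + 960 * const N * const Ω * idX * invEta ^ 2 - 96 * const Ω ^ 3 * idX * invEta ^ 2
    - 768 * const Ω * idX * invEta ^ 2 - 24 * const N ^ 2 * const Ω * idX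
    + 72 * const N * const Ω * idX - 12 * const Ω ^ 3 * idX + 18 * const Ω * idX
    - 55296 * const Ω ^ 2 * invEta ^ 5 + 9216 * invEta ^ 5 + 80640 * const Ω ^ 2 * invEta ^ 4
    - 17280 * invEta ^ 4 + 768 * const N * const Ω ^ 2 * invEta ^ 3
    - 384 * const N * invEta ^ 3 - 28992 * const Ω ^ 2 * invEta ^ 3 + 9696 * invEta ^ 3
    - 720 * const N * const Ω ^ 2 * invEta ^ 2 + 504 * const N * invEta ^ 2
    + 1512 * const Ω ^ 2 * invEta ^ 2 - 1620 * invEta ^ 2 + 72 * const N * const Ω ^ 2 * invEta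
    - 108 * const N * invEta + 36 * const Ω ^ 2 * invEta + 54 * invEta + 6 * const N ^ 2
    - 12 * const N * const Ω ^ 2 - 18 * const N + 21 * const Ω ^ 2 - 12 := by
  rw [f1_eq]
  simp only [map_add, map_sub, map_neg, ddx_mul, ddx_pow, ddx_idX, ddx_invEta, ddx_ofNat,
    ddx_natCast, ddx_one, ddx_const, map_zero]
  ext x
  simp only [coe_add, coe_sub, coe_neg, coe_mul, coe_pow, coe_ofNat, coe_natCast, coe_zero, coe_one,
    coe_idX, coe_invEta, coe_const]
  push_cast
  field_simp
  ring

set_option maxRecDepth 4000 in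
set_option maxHeartbeats 1000000 in
theorem coe_f0 (N Ω x : ℝ) : (f0 N Ω).1 x =
    -x ^ 9 + 3 * Ω * x ^ 8 + 6 * N * x ^ 7 - 3 * Ω ^ 2 * x ^ 7 - 6 * x ^ 7 - 12 * N * Ω * x ^ 6
    + Ω ^ 3 * x ^ 6 + 15 * Ω * x ^ 6 - 12 * N ^ 2 * x ^ 5 + 6 * N * Ω ^ 2 * x ^ 5
    + 24 * N * x ^ 5 - 12 * Ω ^ 2 * x ^ 5 + 27 * x ^ 5 + 12 * N ^ 2 * Ω * x ^ 4
    - 36 * N * Ω * x ^ 4 + 3 * Ω ^ 3 * x ^ 4 - 51 * Ω * x ^ 4 + 8 * N ^ 3 * x ^ 3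
    - 30 * N ^ 2 * x ^ 3 + 12 * N * Ω ^ 2 * x ^ 3 - 32 * N * x ^ 3 + 27 * Ω ^ 2 * x ^ 3
    + 63 * x ^ 3 + 18 * N ^ 2 * Ω * x ^ 2 + 18 * N * Ω * x ^ 2 - 3 * Ω ^ 3 * x ^ 2
    - 81 * Ω * x ^ 2 + 221184 * Ω ^ 2 * x * (2 * x ^ 2 + 1)⁻¹ ^ 6
    - 36864 * x * (2 * x ^ 2 + 1)⁻¹ ^ 6 - 267264 * Ω ^ 2 * x * (2 * x ^ 2 + 1)⁻¹ ^ 5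
    + 59904 * x * (2 * x ^ 2 + 1)⁻¹ ^ 5 - 3072 * N * Ω ^ 2 * x * (2 * x ^ 2 + 1)⁻¹ ^ 4
    + 1536 * N * x * (2 * x ^ 2 + 1)⁻¹ ^ 4 + 76800 * Ω ^ 2 * x * (2 * x ^ 2 + 1)⁻¹ ^ 4
    - 28416 * x * (2 * x ^ 2 + 1)⁻¹ ^ 4 + 2112 * N * Ω ^ 2 * x * (2 * x ^ 2 + 1)⁻¹ ^ 3
    - 1632 * N * x * (2 * x ^ 2 + 1)⁻¹ ^ 3 - 2976 * Ω ^ 2 * x * (2 * x ^ 2 + 1)⁻¹ ^ 3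
    + 3984 * x * (2 * x ^ 2 + 1)⁻¹ ^ 3 - 144 * N * Ω ^ 2 * x * (2 * x ^ 2 + 1)⁻¹ ^ 2
    + 312 * N * x * (2 * x ^ 2 + 1)⁻¹ ^ 2 - 420 * Ω ^ 2 * x * (2 * x ^ 2 + 1)⁻¹ ^ 2
    - 66 * x * (2 * x ^ 2 + 1)⁻¹ ^ 2 + 48 * N ^ 2 * x * (2 * x ^ 2 + 1)⁻¹
    - 36 * N * Ω ^ 2 * x * (2 * x ^ 2 + 1)⁻¹ - 42 * N * x * (2 * x ^ 2 + 1)⁻¹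
    + 81 * Ω ^ 2 * x * (2 * x ^ 2 + 1)⁻¹ - 153 / 2 * x * (2 * x ^ 2 + 1)⁻¹ + 12 * N ^ 3 * x
    - 24 * N ^ 2 * x + 6 * N * Ω ^ 2 * x - 30 * N * x + 27 * Ω ^ 2 * x + 45 / 2 * x
    - 73728 * Ω ^ 3 * (2 * x ^ 2 + 1)⁻¹ ^ 6 + 110592 * Ω * (2 * x ^ 2 + 1)⁻¹ ^ 6
    + 110592 * Ω ^ 3 * (2 * x ^ 2 + 1)⁻¹ ^ 5 - 211968 * Ω * (2 * x ^ 2 + 1)⁻¹ ^ 5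
    - 3072 * N * Ω * (2 * x ^ 2 + 1)⁻¹ ^ 4 - 40704 * Ω ^ 3 * (2 * x ^ 2 + 1)⁻¹ ^ 4
    + 124800 * Ω * (2 * x ^ 2 + 1)⁻¹ ^ 4 + 4224 * N * Ω * (2 * x ^ 2 + 1)⁻¹ ^ 3
    + 1536 * Ω ^ 3 * (2 * x ^ 2 + 1)⁻¹ ^ 3 - 23136 * Ω * (2 * x ^ 2 + 1)⁻¹ ^ 3
    - 1344 * N * Ω * (2 * x ^ 2 + 1)⁻¹ ^ 2 + 228 * Ω ^ 3 * (2 * x ^ 2 + 1)⁻¹ ^ 2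
    + 690 * Ω * (2 * x ^ 2 + 1)⁻¹ ^ 2 - 48 * N ^ 2 * Ω * (2 * x ^ 2 + 1)⁻¹
    + 72 * N * Ω * (2 * x ^ 2 + 1)⁻¹ - 18 * Ω ^ 3 * (2 * x ^ 2 + 1)⁻¹
    + 216 * Ω * (2 * x ^ 2 + 1)⁻¹ + 690 * N ^ 2 * Ω + 702 * N * Ω - 3 * Ω ^ 3 - 60 * Ω := by
  simp only [f0]
  field_simp
  ring

/-- The operator `symForm` with all derivatives moved to the right. -/
theorem symForm_apply_eq_sum (N Ω : ℝ) (f : SmoothFun) :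
    symForm N Ω f = f3 N Ω * nab (nab (nab (nab (nab (nab f))))) +
      9 * (idX - const Ω) ^ 2 * nab (nab (nab (nab (nab f)))) +
      (f2 N Ω + 18 * (idX - const Ω)) * nab (nab (nab (nab f))) +
      (2 * ddx (f2 N Ω) + 6) * nab (nab (nab f)) + (f1 N Ω + ddx (ddx (f2 N Ω))) * nab (nab f) +
      ddx (f1 N Ω) * nab f + f0 N Ω * f := by
  have h1 : ddx (f3 N Ω) = 3 * (idX - const Ω) ^ 2 := by simp [f3_eq]
  have h2 : ddx (3 * (idX - const Ω) ^ 2) = 6 * (idX - const Ω) := by simp; ring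
  have h3 : ddx (6 * (idX - const Ω)) = 6 := by simp
  rw [symForm_apply]
  simp only [map_add, nab_mul _ (nab _), h1, h2, h3]
  ring

theorem T_apply (N Ω : ℝ) (f : SmoothFun) : T N Ω f =
    -(Ω ^ 3 • D0 (D0 (D0 f)))
    + (3 / 4 * (2 * Ω ^ 2 - 1)) • (D1 (D0 (D0 f)) + D0 (D0 (D1 f)))
    - (3 / 2 * Ω) • (D1 (D1 (D0 f)) + D0 (D1 (D1 f)))
    + (3 / 8 : ℝ) • (D3 (D0 (D0 (D0 f))) + D0 (D0 (D0 (D3 f))))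
    + (3 * (N * Ω ^ 2 + 2 * Ω ^ 2 - 3 / 2 * N - 4)) • (D1 (D0 f) + D0 (D1 f))
    - (3 * (2 * Ω ^ 2 - 1) * Ω) • D0 (D0 f)
    - (2 * Ω * (54 * N ^ 2 + 4 * Ω ^ 2 + 48 * N - 3)) • D0 f
    - (6 * (2 * N + 1) * Ω) • D1 (D1 f)
    + (9 / 8 * (2 * N + 1)) • (D3 (D0 (D0 f)) + D0 (D0 (D3 f)))
    + (3 / 2 * (3 * N ^ 2 + 3 * N - 7)) • (D0 (D3 f) + D3 (D0 f))
    + (3 * (6 * N * Ω ^ 2 - 4 * N ^ 2 + 2 * Ω ^ 2 - 17 * N - 7)) • D1 f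
    + (672 * (N + 1) * N * Ω) • D2 f
    + (3 / 2 * (2 * N ^ 2 + 2 * N - 15) * (2 * N + 1)) • D3 f := rfl

set_option maxHeartbeats 4000000 in
set_option maxRecDepth 10000 in
/-- The Perline form of `T`: both sides are expanded as `∑ c_j ∇^j` with coefficients in the normal
form `∑ a_{ij} x^i η^{-j}`, and the coefficients are compared. -/
theorem T_eq_symForm (N Ω : ℝ) : T N Ω = symForm N Ω := by
  ext1 f
  rw [symForm_apply_eq_sum, T_apply]
  simp only [D3_apply, map_smul]
  rw [cubic_mul_D0_D0_D0_apply, cubic_mul_D0_D0_apply, cubic_mul_D0_apply]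
  rw [D0_D0_D0_cubic_apply, D0_D0_cubic_apply, D0_cubic_apply]
  simp only [D0_D0_D0_apply, D0_D0_D1_apply, D1_D0_D0_apply, D0_D1_D1_apply, D1_D1_D0_apply]
  simp only [D0_D0_apply, D0_D1_apply, D1_D0_apply, D1_D1_apply]
  simp only [D0_apply, D1_apply, D2_apply]
  rw [ddx_ddx_f2, ddx_f2, ddx_f1, f1_eq, f2_eq, f3_eq]
  ext x
  simp only [coe_add, coe_sub, coe_neg, coe_mul, coe_pow, coe_ofNat, coe_natCast, coe_zero, coe_one,
    coe_idX, coe_invEta, coe_smul, coe_const, coe_f0]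
  generalize (2 * x ^ 2 + 1)⁻¹ = e
  generalize (nab (nab (nab (nab (nab (nab f)))))).1 x = u6
  generalize (nab (nab (nab (nab (nab f))))).1 x = u5
  generalize (nab (nab (nab (nab f)))).1 x = u4
  generalize (nab (nab (nab f))).1 x = u3
  generalize (nab (nab f)).1 x = u2
  generalize (nab f).1 x = u1
  generalize f.1 x = u0
  ring

/-! ### Differential operators -/

theorem ddx_mul_mulOp (a : SmoothFun) : ddx * mulOp a = mulOp (ddx a) + mulOp a * ddx := by
  ext1 f
  simp

theorem IsDiffOp.mono {m k : ℕ} {D : Module.End ℝ SmoothFun} (h : IsDiffOp m D) (hmk : m ≤ k) :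
    IsDiffOp k D := by
  obtain ⟨a, rfl⟩ := h
  refine ⟨fun j => if j ∈ Finset.range (m + 1) then a j else 0, ?_⟩
  have h0 : mulOp 0 = 0 := by ext1; simp
  simp only [apply_ite mulOp, h0, ite_mul, zero_mul]
  rw [← Finset.sum_filter]
  congr 1
  ext j
  simp
  omega

theorem isDiffOp_zero (m : ℕ) : IsDiffOp m 0 := ⟨0, by
  have h0 : mulOp 0 = 0 := by ext1; simp
  simp [h0]⟩

theorem IsDiffOp.add {m : ℕ} {D E : Module.End ℝ SmoothFun} (hD : IsDiffOp m D)
    (hE : IsDiffOp m E) : IsDiffOp m (D + E) := by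
  obtain ⟨a, rfl⟩ := hD
  obtain ⟨b, rfl⟩ := hE
  refine ⟨a + b, ?_⟩
  rw [← Finset.sum_add_distrib]
  refine Finset.sum_congr rfl fun j _ => ?_
  rw [← add_mul]
  congr 1
  ext1 f
  simp [add_mul]

theorem IsDiffOp.sum {ι : Type*} {m : ℕ} (s : Finset ι) {D : ι → Module.End ℝ SmoothFun}
    (h : ∀ i ∈ s, IsDiffOp m (D i)) : IsDiffOp m (∑ i ∈ s, D i) :=
  Finset.sum_induction D (IsDiffOp m) (fun _ _ => IsDiffOp.add) (isDiffOp_zero m) h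

theorem isDiffOp_mulOp_mul_ddx_pow (a : SmoothFun) (j : ℕ) : IsDiffOp j (mulOp a * ddx ^ j) := by
  refine ⟨fun i => if i = j then a else 0, ?_⟩
  have h0 : mulOp 0 = 0 := by ext1; simp
  simp only [apply_ite mulOp, h0, ite_mul, zero_mul]
  simp

theorem isDiffOp_mulOp (a : SmoothFun) : IsDiffOp 0 (mulOp a) := by
  simpa using isDiffOp_mulOp_mul_ddx_pow a 0

theorem isDiffOp_one : IsDiffOp 0 1 := by
  have h : mulOp 1 = 1 := by ext1; simp
  exact h ▸ isDiffOp_mulOp 1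

theorem IsDiffOp.mulOp_mul {m : ℕ} (a : SmoothFun) {D : Module.End ℝ SmoothFun}
    (h : IsDiffOp m D) : IsDiffOp m (mulOp a * D) := by
  obtain ⟨b, rfl⟩ := h
  refine ⟨fun j => a * b j, ?_⟩
  rw [Finset.mul_sum]
  refine Finset.sum_congr rfl fun j _ => ?_
  ext1 f
  simp [mul_assoc]

theorem IsDiffOp.ddx_mul {m : ℕ} {D : Module.End ℝ SmoothFun} (h : IsDiffOp m D) :
    IsDiffOp (m + 1) (ddx * D) := by
  obtain ⟨b, rfl⟩ := h
  rw [Finset.mul_sum]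
  refine IsDiffOp.sum _ fun j hj => ?_
  rw [Finset.mem_range] at hj
  rw [← mul_assoc, ddx_mul_mulOp, add_mul, mul_assoc, ← pow_succ']
  exact ((isDiffOp_mulOp_mul_ddx_pow _ j).mono (by omega)).add
    ((isDiffOp_mulOp_mul_ddx_pow _ (j + 1)).mono (by omega))

theorem IsDiffOp.mul {m k : ℕ} {D E : Module.End ℝ SmoothFun} (hD : IsDiffOp m D)
    (hE : IsDiffOp k E) : IsDiffOp (m + k) (D * E) := by
  obtain ⟨a, rfl⟩ := hD
  rw [Finset.sum_mul]
  refine IsDiffOp.sum _ fun j hj => ?_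
  rw [Finset.mem_range] at hj
  rw [mul_assoc]
  have h : ∀ j, IsDiffOp (k + j) (ddx ^ j * E) := fun j => by
    induction j with
    | zero => simpa using hE
    | succ j ih => rw [pow_succ', mul_assoc]; exact ih.ddx_mul
  exact ((h j).mulOp_mul (a j)).mono (by omega)

theorem IsDiffOp.pow {m : ℕ} {D : Module.End ℝ SmoothFun} (hD : IsDiffOp m D) (j : ℕ) :
    IsDiffOp (j * m) (D ^ j) := by
  induction j with
  | zero => simpa using isDiffOp_one
  | succ j ih =>
    rw [pow_succ, Nat.succ_mul]
    exact ih.mul hD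

theorem isDiffOp_ddx : IsDiffOp 1 ddx := by
  have h : mulOp 1 = 1 := by ext1; simp
  simpa [h] using isDiffOp_mulOp_mul_ddx_pow 1 1

theorem IsDiffOp.neg {m : ℕ} {D : Module.End ℝ SmoothFun} (hD : IsDiffOp m D) :
    IsDiffOp m (-D) := by
  have h : -D = mulOp (-1) * D := by ext1 f; exact (neg_one_mul (D f)).symm
  exact h ▸ hD.mulOp_mul _

theorem IsDiffOp.sub {m : ℕ} {D E : Module.End ℝ SmoothFun} (hD : IsDiffOp m D)
    (hE : IsDiffOp m E) : IsDiffOp m (D - E) :=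
  sub_eq_add_neg D E ▸ hD.add hE.neg

theorem isDiffOp_D0 : IsDiffOp 2 D0 :=
  (isDiffOp_ddx.pow 2).sub ((isDiffOp_ddx.mulOp_mul _).mono one_le_two)

theorem isDiffOp_D1 : IsDiffOp 2 D1 :=
  ((isDiffOp_ddx.pow 2).mulOp_mul _).sub ((isDiffOp_ddx.mulOp_mul _).mono one_le_two)

theorem isDiffOp_D2 : IsDiffOp 2 D2 :=
  (((isDiffOp_ddx.pow 2).mulOp_mul _).add ((isDiffOp_ddx.mulOp_mul _).mono one_le_two)).add
    (isDiffOp_one.mono (Nat.zero_le 2))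

theorem isDiffOp_D3 : IsDiffOp 0 D3 := isDiffOp_mulOp _

theorem isDiffOp_Y (i : Fin 14) : IsDiffOp 6 (Y i) := by
  have h00 := isDiffOp_D0.pow 2
  have h000 := isDiffOp_D0.pow 3
  have h11 := isDiffOp_D1.pow 2
  have anti : ∀ {m k : ℕ} {D E : Module.End ℝ SmoothFun}, IsDiffOp m D → IsDiffOp k E →
      m + k ≤ 6 → IsDiffOp 6 (D * E + E * D) := fun hD hE h =>
    ((hD.mul hE).mono h).add ((hE.mul hD).mono (by omega))
  fin_cases i
  · exact isDiffOp_one.mono (by omega)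
  · exact isDiffOp_D0.mono (by omega)
  · exact isDiffOp_D1.mono (by omega)
  · exact isDiffOp_D2.mono (by omega)
  · exact isDiffOp_D3.mono (by omega)
  · exact h00.mono (by omega)
  · exact h000.mono (by omega)
  · exact h11.mono (by omega)
  · exact anti isDiffOp_D3 isDiffOp_D0 (by omega)
  · exact anti isDiffOp_D3 h00 (by omega)
  · exact anti isDiffOp_D0 isDiffOp_D1 (by omega)
  · exact anti isDiffOp_D3 h000 (by omega)
  · exact anti h00 isDiffOp_D1 (by omega)
  · exact anti isDiffOp_D0 h11 (by omega)

/-! ### The exact order of the commuting operator -/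

/-- The power `(x - c)^k`. -/
noncomputable def shiftPow (c : ℝ) (k : ℕ) : SmoothFun := (idX - const c) ^ k

theorem ddx_shiftPow (c : ℝ) (k : ℕ) :
    ddx (shiftPow c k) = (k : ℝ) • shiftPow c (k - 1) := by
  ext x
  simp [shiftPow]

theorem ddx_pow_shiftPow_eval (c : ℝ) (j k : ℕ) (h : j < k) :
    ((ddx ^ j) (shiftPow c k)).1 c = 0 := by
  induction j generalizing k with
  | zero => simp [shiftPow, (Nat.pos_iff_ne_zero.1 h)]
  | succ j ih =>
    rw [pow_succ, Module.End.mul_apply, ddx_shiftPow, map_smul, coe_smul, ih _ (by omega), mul_zero]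

/-- An operator of order at most `m` kills `(x - c)^k`, `m < k`, at the point `c`. -/
theorem IsDiffOp.shiftPow_eval {m k : ℕ} {D : Module.End ℝ SmoothFun} (hD : IsDiffOp m D)
    (h : m < k) (c : ℝ) : (D (shiftPow c k)).1 c = 0 := by
  obtain ⟨a, rfl⟩ := hD
  rw [LinearMap.sum_apply, coe_sum]
  refine Finset.sum_eq_zero fun j hj => ?_
  rw [Finset.mem_range] at hj
  rw [Module.End.mul_apply, mulOp_apply, coe_mul, ddx_pow_shiftPow_eval c j k (by omega), mul_zero]

theorem isDiffOp_nab : IsDiffOp 1 nab := isDiffOp_ddx.add ((isDiffOp_mulOp _).mono zero_le_one)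

theorem nab_shiftPow (c : ℝ) (k : ℕ) :
    nab (shiftPow c k) = (k : ℝ) • shiftPow c (k - 1) + logDerivSqrtW * shiftPow c k := by
  rw [nab_apply, ddx_shiftPow]

/-- Applied to `(x - c)^6`, the operator takes the value `6! (c - Ω)³` at `c`, here for `c = Ω + 1`;
an operator of order at most five would give zero. -/
theorem not_isDiffOp_symForm (N Ω : ℝ) : ¬ IsDiffOp 5 (symForm N Ω) := by
  intro h
  have h1 := h.shiftPow_eval (k := 6) (by omega) (Ω + 1)
  rw [symForm_apply_eq_sum] at h1
  have e : ∀ j k, j < k → ((nab ^ j) (shiftPow (Ω + 1) k)).1 (Ω + 1) = 0 := fun j k hjk =>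
    (isDiffOp_nab.pow j).shiftPow_eval (by omega) _
  have e1 := e 1 6 (by omega)
  have e2 := e 2 6 (by omega)
  have e3 := e 3 6 (by omega)
  have e4 := e 4 6 (by omega)
  have e5 := e 5 6 (by omega)
  have e0 := e 0 6 (by omega)
  have e6 : ∀ k, ((nab ^ k) (shiftPow (Ω + 1) k)).1 (Ω + 1) = k.factorial := fun k => by
    induction k with
    | zero => simp [shiftPow]
    | succ k ih =>
      have h3 : ((nab ^ k * mulOp logDerivSqrtW) (shiftPow (Ω + 1) (k + 1))).1 (Ω + 1) = 0 :=
        ((isDiffOp_nab.pow k).mul (isDiffOp_mulOp _)).shiftPow_eval (by omega) _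
      rw [Module.End.mul_apply, mulOp_apply] at h3
      rw [pow_succ, Module.End.mul_apply, nab_shiftPow, map_add, coe_add, h3, map_smul, coe_smul,
        Nat.add_sub_cancel, ih, Nat.factorial_succ, add_zero, Nat.cast_mul]
  have e6 := e6 6
  simp only [pow_succ, pow_zero, one_mul, Module.End.mul_apply, Module.End.one_apply] at e0 e1 e2 e3
  simp only [pow_succ, pow_zero, one_mul, Module.End.mul_apply] at e4 e5 e6
  simp only [coe_add, coe_mul _ (nab _), coe_mul _ (shiftPow _ _), e0, e1, e2, e3, e4, e5, e6] at h1
  simp [f3_eq, Nat.factorial] at h1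

/-! ### Hermite polynomials and the exceptional polynomials -/

theorem hermiteH_zero : hermiteH 0 = 1 := by
  ext x
  simp [hermiteH, ← Real.exp_add]

theorem contDiff_gauss : ContDiff ℝ ∞ (fun t : ℝ => Real.exp (-t ^ 2)) := by fun_prop

theorem hermiteH_succ (n : ℕ) : hermiteH (n + 1) = 2 * idX * hermiteH n - ddx (hermiteH n) := by
  have h : ddx (hermiteH n) = 2 * idX * hermiteH n - hermiteH (n + 1) := by
    refine ddx_eq fun x => ?_
    have h1 : HasDerivAt (iteratedDeriv n fun t : ℝ => Real.exp (-t ^ 2))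
        (iteratedDeriv (n + 1) (fun t : ℝ => Real.exp (-t ^ 2)) x) x := by
      rw [iteratedDeriv_succ]
      exact ((contDiff_gauss.of_le (m := (n + 1 : ℕ))
        (by exact_mod_cast le_top)).differentiable_iteratedDeriv n
          (by exact_mod_cast Nat.lt_succ_self n) x).hasDerivAt
    have h2 : HasDerivAt (fun x : ℝ => (-1) ^ n * Real.exp (x ^ 2))
        ((-1) ^ n * (2 * x * Real.exp (x ^ 2))) x := by
      refine ((hasDerivAt_pow 2 x).exp.const_mul ((-1) ^ n)).congr_deriv ?_
      simp only [Nat.cast_ofNat, Nat.add_one_sub_one, pow_one]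
      ring
    refine (h2.mul h1).congr_deriv ?_
    simp only [hermiteH, coe_sub, coe_mul, coe_ofNat, coe_idX]
    ring
  rw [h]
  ring

theorem ddx_hermiteH_succ (n : ℕ) :
    ddx (hermiteH (n + 1)) = 2 * ((n : SmoothFun) + 1) * hermiteH n := by
  induction n with
  | zero => rw [hermiteH_succ, hermiteH_zero]; simp
  | succ n ih =>
    rw [hermiteH_succ (n + 1), map_sub, ih]
    simp only [ddx_mul, ddx_ofNat, ddx_idX, ih, map_add, ddx_natCast, ddx_one]
    push_cast
    linear_combination (-2 * ((n : SmoothFun) + 1)) * hermiteH_succ n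

/-- The Hermite differential equation. -/
theorem ddx_ddx_hermiteH (n : ℕ) : ddx (ddx (hermiteH n)) =
    2 * idX * ddx (hermiteH n) - 2 * (n : SmoothFun) * hermiteH n := by
  have h := ddx_hermiteH_succ n
  rw [hermiteH_succ, map_sub] at h
  simp only [ddx_mul, ddx_ofNat, ddx_idX] at h
  linear_combination -h

/-- The polynomials `(n-1)(n-2) (H_n + 4n H_{n-2} + 4n(n-3) H_{n-4})`, written in terms of `H_n` and
`H_n'`. In this form all relations between them follow from the Hermite equation alone. -/
noncomputable def excP (n : ℕ) : SmoothFun :=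
  (2 - n - 2 * n * idX ^ 2) * hermiteH n + (2 * idX ^ 3 - idX) * ddx (hermiteH n)

/-- The quotient `excP' / η`. -/
noncomputable def excQ (n : ℕ) : SmoothFun :=
  (2 * idX ^ 2 - n + 1) * ddx (hermiteH n) - 2 * n * idX * hermiteH n

theorem ddx_excP (n : ℕ) : ddx (excP n) = (2 * idX ^ 2 + 1) * excQ n := by
  simp only [excP, excQ, map_add, map_sub, ddx_mul, ddx_pow, ddx_idX, ddx_ofNat, ddx_natCast,
    ddx_ddx_hermiteH]
  push_cast
  ring

theorem ddx_excQ (n : ℕ) : ddx (excQ n) =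
    (4 * idX ^ 3 + (6 - 4 * n) * idX) * ddx (hermiteH n) +
      (-4 * n * idX ^ 2 + 2 * n ^ 2 - 4 * n) * hermiteH n := by
  simp only [excQ, map_add, map_sub, ddx_mul, ddx_pow, ddx_idX, ddx_ofNat, ddx_natCast, ddx_one,
    ddx_ddx_hermiteH]
  push_cast
  ring

/- The neighbours of `excP n` in terms of `H_n` and `H_n'`. Those below `n` carry the factors `2 n`,
`4 n (n - 1)` and `8 n (n - 1) (n - 2)`, which vanish where `n - k` is truncated. -/

theorem excP_succ (n : ℕ) : excP (n + 1) = (1 - n - 2 * (n + 1) * idX ^ 2) *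
    (2 * idX * hermiteH n - ddx (hermiteH n)) +
    (2 * idX ^ 3 - idX) * (2 * ((n : SmoothFun) + 1) * hermiteH n) := by
  rw [excP, ddx_hermiteH_succ, hermiteH_succ]
  push_cast
  ring

theorem mul_excP_pred (n : ℕ) : 2 * (n : SmoothFun) * excP (n - 1) =
    (3 - n - 2 * (n - 1) * idX ^ 2) * ddx (hermiteH n) +
    (2 * idX ^ 3 - idX) * (2 * idX * ddx (hermiteH n) - 2 * (n : SmoothFun) * hermiteH n) := by
  rw [← ddx_ddx_hermiteH]
  rcases n with _ | n
  · simp [hermiteH_zero]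
  · rw [ddx_hermiteH_succ, excP]
    simp only [Nat.add_sub_cancel, ddx_mul, map_add, ddx_ofNat, ddx_natCast, ddx_one]
    push_cast
    ring

theorem excP_add_two (n : ℕ) : excP (n + 2) = (-n - 2 * (n + 2) * idX ^ 2) *
    (2 * idX * (2 * idX * hermiteH n - ddx (hermiteH n)) - 2 * ((n : SmoothFun) + 1) * hermiteH n) +
    (2 * idX ^ 3 - idX) *
      (2 * ((n : SmoothFun) + 2) * (2 * idX * hermiteH n - ddx (hermiteH n))) := by
  rw [excP, ddx_hermiteH_succ, hermiteH_succ (n + 1), ddx_hermiteH_succ, hermiteH_succ]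
  push_cast
  ring

theorem excP_add_three (n : ℕ) : excP (n + 3) = (-n - 1 - 2 * (n + 3) * idX ^ 2) *
    (2 * idX * (2 * idX * (2 * idX * hermiteH n - ddx (hermiteH n)) -
      2 * ((n : SmoothFun) + 1) * hermiteH n) -
      2 * ((n : SmoothFun) + 2) * (2 * idX * hermiteH n - ddx (hermiteH n))) +
    (2 * idX ^ 3 - idX) * (2 * ((n : SmoothFun) + 3) *
      (2 * idX * (2 * idX * hermiteH n - ddx (hermiteH n)) -
        2 * ((n : SmoothFun) + 1) * hermiteH n)) := by
  rw [excP, ddx_hermiteH_succ, hermiteH_succ (n + 2), ddx_hermiteH_succ, hermiteH_succ (n + 1),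
    ddx_hermiteH_succ, hermiteH_succ]
  push_cast
  ring

theorem mul_excP_sub_two (n : ℕ) : 4 * (n : SmoothFun) * (n - 1) * excP (n - 2) =
    (4 - n - 2 * (n - 2) * idX ^ 2) * ddx (ddx (hermiteH n)) +
    (2 * idX ^ 3 - idX) * ddx (ddx (ddx (hermiteH n))) := by
  rcases n with _ | _ | n
  · simp [hermiteH_zero]
  · rw [ddx_hermiteH_succ, hermiteH_zero]; simp
  · rw [ddx_hermiteH_succ]
    simp only [ddx_mul, map_add, ddx_ofNat, ddx_natCast, ddx_one, ddx_hermiteH_succ, add_zero,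
      zero_mul, mul_zero, zero_add, excP]
    push_cast
    ring

theorem mul_excP_sub_three (n : ℕ) : 8 * (n : SmoothFun) * (n - 1) * (n - 2) * excP (n - 3) =
    (5 - n - 2 * (n - 3) * idX ^ 2) * ddx (ddx (ddx (hermiteH n))) +
    (2 * idX ^ 3 - idX) * ddx (ddx (ddx (ddx (hermiteH n)))) := by
  rcases n with _ | _ | _ | n
  · simp [hermiteH_zero]
  · rw [ddx_hermiteH_succ, hermiteH_zero]; simp
  · rw [ddx_hermiteH_succ]
    simp [ddx_hermiteH_succ, hermiteH_zero]
  · rw [ddx_hermiteH_succ]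
    simp only [ddx_mul, map_add, ddx_ofNat, ddx_natCast, ddx_one, ddx_hermiteH_succ, add_zero,
      zero_mul, mul_zero, zero_add, excP]
    push_cast
    ring

/- On a function whose derivative is divisible by `η` the operators `D_j` act with polynomial
coefficients, because the poles of their coefficients cancel. -/

theorem ddx_ddx_of_ddx {f g : SmoothFun} (h : ddx f = (2 * idX ^ 2 + 1) * g) :
    ddx (ddx f) = (2 * idX ^ 2 + 1) * ddx g + 4 * idX * g := by
  rw [h]
  simp only [ddx_mul, map_add, ddx_pow, ddx_ofNat, ddx_idX, ddx_one]
  push_cast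
  ring

theorem D0_apply_of_ddx {f g : SmoothFun} (h : ddx f = (2 * idX ^ 2 + 1) * g) :
    D0 f = (2 * idX ^ 2 + 1) * ddx g - (4 * idX ^ 3 + 6 * idX) * g := by
  ext x
  have e1 := congrArg (fun u : SmoothFun => u.1 x) h
  have e2 := congrArg (fun u : SmoothFun => u.1 x) (ddx_ddx_of_ddx h)
  simp [D0, pow_two] at e1 e2 ⊢
  rw [e1, e2]
  field_simp
  ring

theorem D1_apply_of_ddx {f g : SmoothFun} (h : ddx f = (2 * idX ^ 2 + 1) * g) :
    D1 f = idX * (2 * idX ^ 2 + 1) * ddx g - (4 * idX ^ 4 + 4 * idX ^ 2 - 1) * g := by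
  ext x
  have e1 := congrArg (fun u : SmoothFun => u.1 x) h
  have e2 := congrArg (fun u : SmoothFun => u.1 x) (ddx_ddx_of_ddx h)
  simp [D1, pow_two] at e1 e2 ⊢
  rw [e1, e2]
  field_simp
  ring

theorem D2_apply_of_ddx {f g : SmoothFun} (h : ddx f = (2 * idX ^ 2 + 1) * g) :
    112 * D2 f = (17 - 2 * idX ^ 2) * (2 * idX ^ 2 + 1) * ddx g +
      (8 * idX ^ 5 - 64 * idX ^ 3 - 106 * idX) * g + 112 * f := by
  ext x
  have e1 := congrArg (fun u : SmoothFun => u.1 x) h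
  have e2 := congrArg (fun u : SmoothFun => u.1 x) (ddx_ddx_of_ddx h)
  simp [D2, pow_two] at e1 e2 ⊢
  rw [e1, e2]
  field_simp
  ring

theorem D0_excP (n : ℕ) : D0 (excP n) = -(2 * (n : SmoothFun) * excP n) := by
  rw [D0_apply_of_ddx (ddx_excP n), ddx_excQ, excP, excQ]
  ring

theorem D1_excP (n : ℕ) : D1 (excP n) =
    -((n - 2) * excP (n + 1)) - (n - 1) * (2 * (n : SmoothFun) * excP (n - 1)) := by
  rw [D1_apply_of_ddx (ddx_excP n), ddx_excQ, excQ, excP_succ, mul_excP_pred]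
  ring

theorem D2_excP (n : ℕ) : ((n : SmoothFun) + 1) * (112 * D2 (excP n)) =
    (n - 1) * (n - 2) * excP (n + 2) + 4 * (n + 1) * (n - 4) * (n - 7) * excP n +
      (n + 1) * (n - 2) * (4 * (n : SmoothFun) * (n - 1) * excP (n - 2)) := by
  rw [D2_apply_of_ddx (ddx_excP n), ddx_excQ, excQ, excP_add_two, mul_excP_sub_two, excP]
  simp only [ddx_ddx_hermiteH, map_sub, ddx_mul, ddx_idX, ddx_ofNat, ddx_natCast]
  ring

theorem D3_excP (n : ℕ) : 6 * ((n : SmoothFun) + 1) * (n + 2) * D3 (excP n) =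
    (n - 1) * (n - 2) * excP (n + 3) + 6 * (n + 1) * (n + 2) * ((n - 2) * excP (n + 1) +
      (n - 1) * (2 * (n : SmoothFun) * excP (n - 1))) +
      (n + 1) * (n + 2) * (8 * (n : SmoothFun) * (n - 1) * (n - 2) * excP (n - 3)) := by
  have h3 : 6 * D3 (excP n) = (8 * idX ^ 3 + 12 * idX) * excP n := by
    rw [D3_apply]; ext x; simp; ring
  rw [show 6 * ((n : SmoothFun) + 1) * (n + 2) * D3 (excP n) =
    (n + 1) * (n + 2) * (6 * D3 (excP n)) by ring, h3, excP_add_three, excP_succ, mul_excP_pred,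
    mul_excP_sub_three, excP]
  simp only [ddx_ddx_hermiteH, map_add, map_sub, ddx_mul, ddx_idX, ddx_ofNat, ddx_natCast, ddx_one,
    map_zero]
  ring

/-! ### Normalization and the difference operators -/

/-- The polynomials `H_n + 4n H_{n-2} + 4n(n-3) H_{n-4}`. -/
noncomputable def excRaw (n : ℕ) : SmoothFun :=
  hermiteH n + (4 * (n : ℝ)) • hermiteH (n - 2) + (4 * (n : ℝ) * ((n : ℝ) - 3)) • hermiteH (n - 4)

/-- The factor `√((n-1)(n-2))` of the normalization. -/
noncomputable def excNorm (n : ℕ) : ℝ := √(((n : ℝ) - 1) * ((n : ℝ) - 2))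

/-- The norm `π^{1/4} √(2^n n!)` of `H_n`. -/
noncomputable def hermNorm (n : ℕ) : ℝ := Real.pi ^ (1 / 4 : ℝ) * √(2 ^ n * (n.factorial : ℝ))

theorem q_eq (n : ℕ) : q n = (excNorm n / hermNorm n) • excRaw n := rfl

theorem hermNorm_pos (n : ℕ) : 0 < hermNorm n := by unfold hermNorm; positivity

theorem not_mem_excDegrees {n : ℕ} : n ∉ excDegrees ↔ n = 0 ∨ 3 ≤ n := by
  simp [excDegrees]; omega

theorem excNorm_radicand_nonneg (n : ℕ) : 0 ≤ ((n : ℝ) - 1) * ((n : ℝ) - 2) := by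
  rcases n with _ | _ | n
  · norm_num
  · norm_num
  · push_cast
    have : (0 : ℝ) ≤ n := n.cast_nonneg
    nlinarith

theorem excNorm_sq (n : ℕ) : excNorm n ^ 2 = ((n : ℝ) - 1) * ((n : ℝ) - 2) :=
  Real.sq_sqrt (excNorm_radicand_nonneg n)

theorem excNorm_eq_zero {n : ℕ} (h : n ∈ excDegrees) : excNorm n = 0 := by
  rcases h with rfl | rfl <;> norm_num [excNorm]

theorem excNorm_pos {n : ℕ} (h : n ∉ excDegrees) : 0 < excNorm n := by
  refine Real.sqrt_pos.2 ?_
  rcases not_mem_excDegrees.1 h with rfl | h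
  · norm_num
  · have : (3 : ℝ) ≤ n := by exact_mod_cast h
    nlinarith

theorem q_eq_zero {n : ℕ} (h : n ∈ excDegrees) : q n = 0 := by
  rw [q_eq, excNorm_eq_zero h]; simp

theorem mul_hermiteH_sub_two (n : ℕ) :
    4 * (n : SmoothFun) * (n - 1) * hermiteH (n - 2) = ddx (ddx (hermiteH n)) := by
  rcases n with _ | _ | n
  · simp [hermiteH_zero]
  · rw [ddx_hermiteH_succ, hermiteH_zero]; simp
  · rw [ddx_hermiteH_succ]
    simp only [ddx_mul, map_add, ddx_ofNat, ddx_natCast, ddx_one, ddx_hermiteH_succ, add_zero,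
      zero_mul, mul_zero, zero_add]
    push_cast
    ring

theorem mul_hermiteH_sub_four (n : ℕ) :
    16 * (n : SmoothFun) * (n - 1) * (n - 2) * (n - 3) * hermiteH (n - 4) =
      ddx (ddx (ddx (ddx (hermiteH n)))) := by
  have h := mul_hermiteH_sub_two (n - 2)
  rw [← mul_hermiteH_sub_two n]
  simp only [ddx_mul, map_sub, ddx_ofNat, ddx_natCast, ddx_one, add_zero, sub_zero, zero_mul,
    mul_zero, zero_add]
  rw [← h]
  rcases n with _ | _ | n
  · simp
  · simp
  · rw [show n + 1 + 1 - 4 = n + 1 + 1 - 2 - 2 by omega]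
    push_cast [Nat.add_sub_cancel]
    ring

theorem excP_eq (n : ℕ) : excP n = (excNorm n ^ 2) • excRaw n := by
  have h2 := mul_hermiteH_sub_two n
  have h4 := mul_hermiteH_sub_four n
  simp only [ddx_ddx_hermiteH, ddx_mul, map_sub, map_add, ddx_ofNat, ddx_natCast, ddx_idX,
    ddx_one, map_zero] at h2 h4
  rw [excNorm_sq, excP]
  ext x
  replace h2 := congrArg (fun u : SmoothFun => u.1 x) h2
  replace h4 := congrArg (fun u : SmoothFun => u.1 x) h4
  simp [excRaw] at h2 h4 ⊢
  linear_combination (2 - (n : ℝ)) * h2 - h4 / 4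

theorem smul_q (n : ℕ) : (excNorm n * hermNorm n) • q n = excP n := by
  rw [q_eq, excP_eq, smul_smul]
  congr 1
  have := (hermNorm_pos n).ne'
  field_simp

theorem excP_eq_zero {n : ℕ} (h : n ∈ excDegrees) : excP n = 0 := by
  rw [← smul_q, q_eq_zero h, smul_zero]

/-- Transport of one term of `(L q)_n` to the polynomials `excP`. Where `m` is exceptional the two
sides vanish whatever the coefficients. -/
theorem smul_smul_q {n m : ℕ} {l r : ℝ}
    (h : m ∈ excDegrees ∨ excNorm n * hermNorm n * l = r * (excNorm m * hermNorm m)) :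
    (excNorm n * hermNorm n) • (l • q m) = r • excP m := by
  rcases h with h | h
  · rw [q_eq_zero h, excP_eq_zero h]; simp
  · rw [smul_smul, h, mul_smul, smul_q]

theorem hermNorm_add_one (n : ℕ) : hermNorm (n + 1) = hermNorm n * √(2 * ((n : ℝ) + 1)) := by
  rw [hermNorm, hermNorm, mul_assoc, ← Real.sqrt_mul (by positivity), Nat.factorial_succ]
  push_cast
  ring_nf

theorem hermNorm_sq_succ (n : ℕ) : hermNorm (n + 1) ^ 2 = hermNorm n ^ 2 * (2 * ((n : ℝ) + 1)) := by
  rw [hermNorm_add_one, mul_pow, Real.sq_sqrt (by positivity)]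

theorem sqrt_mul_sqrt_eq {A B C D k : ℝ} (hA : 0 ≤ A) (hC : 0 ≤ C) (hk : 0 ≤ k)
    (h : A * B = k ^ 2 * (C * D)) : √A * √B = k * (√C * √D) := by
  rw [← Real.sqrt_mul hA, ← Real.sqrt_mul hC, h, Real.sqrt_mul (sq_nonneg k), Real.sqrt_sq hk]

theorem hermNorm_add_two (n : ℕ) :
    hermNorm (n + 2) = hermNorm n * √(4 * (((n : ℝ) + 1) * (n + 2))) := by
  rw [hermNorm_add_one, hermNorm_add_one, mul_assoc, ← Real.sqrt_mul (by positivity)]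
  push_cast
  ring_nf

theorem hermNorm_add_three (n : ℕ) :
    hermNorm (n + 3) = hermNorm n * √(8 * (((n : ℝ) + 1) * (n + 2) * (n + 3))) := by
  rw [hermNorm_add_one, hermNorm_add_two, mul_assoc, ← Real.sqrt_mul (by positivity)]
  push_cast
  ring_nf

theorem isSymm_L0 : L0.IsSymm := by
  ext n m
  simp only [L0, Matrix.transpose_apply]
  split_ifs <;> first | rfl | omega | simp_all

theorem isSymm_L1 : L1.IsSymm := by
  ext n m
  simp only [L1, Matrix.transpose_apply]
  split_ifs with h1 h2 h3 h4 h5 h6 <;> first | rfl | omega | skip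
  · subst h1
    push_cast
    rw [show (n : ℝ) + 1 - 1 = n by ring, show (n : ℝ) + 1 - 3 = n - 2 by ring]
    ring
  · subst h4
    push_cast
    rw [show (m : ℝ) + 1 - 1 = m by ring, show (m : ℝ) + 1 - 3 = m - 2 by ring]
    ring

theorem isSymm_L2 : L2.IsSymm := by
  ext n m
  simp only [L2, Matrix.transpose_apply]
  split_ifs <;> first | rfl | omega | skip
  all_goals subst_vars; push_cast; first | rfl | (congr 2; ring)

theorem isSymm_L3 : L3.IsSymm := by
  ext n m
  simp only [L3, Matrix.transpose_apply]
  split_ifs <;> first | rfl | omega | skip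
  all_goals subst_vars; push_cast; ring_nf

theorem isDiffceOp_L0 : IsDiffceOp 0 L0 := fun n m h => if_neg (by omega)

theorem isDiffceOp_L1 : IsDiffceOp 1 L1 := fun n m h => by
  rw [L1, if_neg (by omega), if_neg (by omega)]

theorem isDiffceOp_L2 : IsDiffceOp 2 L2 := fun n m h => by
  rw [L2, if_neg (by omega), if_neg (by omega), if_neg (by omega)]

theorem isDiffceOp_L3 : IsDiffceOp 3 L3 := fun n m h => by
  rw [L3, if_neg (by omega), if_neg (by omega), if_neg (by omega), if_neg (by omega)]

theorem three_le_cast {n : ℕ} (h : 3 ≤ n) : (3 : ℝ) ≤ n := by exact_mod_cast h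

/- The entries above the diagonal, transported from the orthonormal polynomials `q n` to the
polynomials `excP n = excNorm n * hermNorm n • q n`, are rational functions of `n`. -/

theorem L1_up {n : ℕ} (hn : 3 ≤ n) : excNorm n * hermNorm n * L1 n (n + 1) =
    (-((n : ℝ) - 2)) * (excNorm (n + 1) * hermNorm (n + 1)) := by
  have h3 := three_le_cast hn
  rw [hermNorm_add_one, L1, if_neg (by omega), if_pos rfl, ← Real.sqrt_mul (by norm_num),
    ← Real.sqrt_mul (by positivity), ← Real.sqrt_mul (by nlinarith), excNorm, excNorm]
  linear_combination (-hermNorm n) * sqrt_mul_sqrt_eq (A := ((n : ℝ) - 1) * (n - 2))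
    (B := 2 * (n + 1) * (n - 2) * n) (C := (((n + 1 : ℕ) : ℝ) - 1) * (((n + 1 : ℕ) : ℝ) - 2))
    (D := 2 * (n + 1)) (k := n - 2) (excNorm_radicand_nonneg n) (excNorm_radicand_nonneg (n + 1))
    (by linarith) (by push_cast; ring)

theorem L2_up {n : ℕ} (hn : 3 ≤ n) : excNorm n * hermNorm n * L2 n (n + 2) =
    (((n : ℝ) - 1) * (n - 2) / (2 * (n + 1)) / 56) * (excNorm (n + 2) * hermNorm (n + 2)) := by
  have h3 := three_le_cast hn
  rw [hermNorm_add_two, L2, if_neg (by omega), if_neg (by omega), if_pos rfl, excNorm, excNorm]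
  linear_combination (hermNorm n / 56) * sqrt_mul_sqrt_eq (A := ((n : ℝ) - 1) * (n - 2))
    (B := (n + 2) * (n - 1) * (n - 2) * n)
    (C := (((n + 2 : ℕ) : ℝ) - 1) * (((n + 2 : ℕ) : ℝ) - 2))
    (D := 4 * ((n + 1) * (n + 2))) (k := ((n : ℝ) - 1) * (n - 2) / (2 * (n + 1)))
    (excNorm_radicand_nonneg n) (excNorm_radicand_nonneg (n + 2))
    (div_nonneg (excNorm_radicand_nonneg n) (by positivity)) (by push_cast; field_simp; ring)

theorem L3_up_one {n : ℕ} (hn : 3 ≤ n) : excNorm n * hermNorm n * L3 n (n + 1) =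
    ((n : ℝ) - 2) * (excNorm (n + 1) * hermNorm (n + 1)) := by
  have h3 := three_le_cast hn
  rw [hermNorm_add_one, L3, if_neg (by omega), if_neg (by omega), if_pos rfl, excNorm, excNorm]
  linear_combination (hermNorm n) * sqrt_mul_sqrt_eq (A := ((n : ℝ) - 1) * (n - 2))
    (B := 2 * (n + 1) * n * (n - 2)) (C := (((n + 1 : ℕ) : ℝ) - 1) * (((n + 1 : ℕ) : ℝ) - 2))
    (D := 2 * (n + 1)) (k := n - 2) (excNorm_radicand_nonneg n) (excNorm_radicand_nonneg (n + 1))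
    (by linarith) (by push_cast; ring)

theorem L3_up_three (n : ℕ) : excNorm n * hermNorm n * L3 n (n + 3) =
    (((n : ℝ) - 1) * (n - 2) / (2 * (n + 1) * (n + 2)) / 3) *
      (excNorm (n + 3) * hermNorm (n + 3)) := by
  rw [hermNorm_add_three, L3, if_neg (by omega), if_neg (by omega), if_neg (by omega), if_pos rfl,
    excNorm, excNorm]
  have h : √2 * √(((n : ℝ) + 3) * (n - 1) * (n - 2)) = √(2 * ((n + 3) * (n - 1) * (n - 2))) :=
    (Real.sqrt_mul (by norm_num) _).symm
  linear_combination (hermNorm n * √(((n : ℝ) - 1) * (n - 2)) / 3) * h +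
    (hermNorm n / 3) * sqrt_mul_sqrt_eq (A := ((n : ℝ) - 1) * (n - 2))
    (B := 2 * ((n + 3) * (n - 1) * (n - 2)))
    (C := (((n + 3 : ℕ) : ℝ) - 1) * (((n + 3 : ℕ) : ℝ) - 2))
    (D := 8 * ((n + 1) * (n + 2) * (n + 3)))
    (k := ((n : ℝ) - 1) * (n - 2) / (2 * (n + 1) * (n + 2)))
    (excNorm_radicand_nonneg n) (excNorm_radicand_nonneg (n + 3))
    (div_nonneg (excNorm_radicand_nonneg n) (by positivity)) (by push_cast; field_simp; ring)

/-- Passing from an entry above the diagonal to the symmetric entry below it. -/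
theorem lower_of_upper {L : Matrix ℕ ℕ ℝ} (hL : L.IsSymm) {m n : ℕ} {r r' : ℝ}
    (hm : m ∉ excDegrees)
    (h : excNorm m * hermNorm m * L m n = r * (excNorm n * hermNorm n))
    (hr : r * (excNorm n * hermNorm n) ^ 2 = r' * (excNorm m * hermNorm m) ^ 2) :
    excNorm n * hermNorm n * L n m = r' * (excNorm m * hermNorm m) := by
  have h0 : excNorm m * hermNorm m ≠ 0 := (mul_pos (excNorm_pos hm) (hermNorm_pos m)).ne'
  have hs : L n m = L m n := hL.apply m n
  refine mul_right_cancel₀ h0 ?_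
  rw [hs]
  linear_combination (excNorm n * hermNorm n) * h + hr

/-! ### The intertwining relations -/

theorem diffceApply_mono {k K : ℕ} {L : Matrix ℕ ℕ ℝ} (hL : IsDiffceOp k L) (hk : k ≤ K)
    (h : ℕ → SmoothFun) (n : ℕ) : diffceApply K L h n = diffceApply k L h n := by
  refine (Finset.sum_subset (fun m hm => ?_) fun m _ hm' => ?_).symm
  · rw [Finset.mem_Icc] at hm ⊢; omega
  · rw [Finset.mem_Icc] at hm'
    rw [hL n m (by omega), zero_smul]

theorem IsDiffceOp.mono {k K : ℕ} {L : Matrix ℕ ℕ ℝ} (hL : IsDiffceOp k L) (hk : k ≤ K) :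
    IsDiffceOp K L := fun n m h => hL n m (by omega)

/-- The action of an operator of order at most `6`, with all terms written out. -/
theorem diffceApply_three (L : Matrix ℕ ℕ ℝ) (h : ℕ → SmoothFun) (j : ℕ) :
    diffceApply 3 L h (j + 3) = L (j + 3) j • h j + L (j + 3) (j + 1) • h (j + 1) +
      L (j + 3) (j + 2) • h (j + 2) + L (j + 3) (j + 3) • h (j + 3) +
      L (j + 3) (j + 4) • h (j + 4) + L (j + 3) (j + 5) • h (j + 5) +
      L (j + 3) (j + 6) • h (j + 6) := by
  rw [diffceApply, show Finset.Icc (j + 3 - 3) (j + 3 + 3) = Finset.Ico j (j + 7) by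
    ext; simp only [Finset.mem_Icc, Finset.mem_Ico]; omega, Finset.sum_Ico_eq_sum_range]
  simp [Finset.sum_range_succ]

theorem diffceApply_three_zero (L : Matrix ℕ ℕ ℝ) (h : ℕ → SmoothFun) :
    diffceApply 3 L h 0 = L 0 0 • h 0 + L 0 1 • h 1 + L 0 2 • h 2 + L 0 3 • h 3 := by
  rw [diffceApply, show Finset.Icc (0 - 3) (0 + 3) = Finset.range 4 by
    ext; simp only [Finset.mem_Icc, Finset.mem_range]; omega]
  simp [Finset.sum_range_succ]

/-- The rows `n = 1, 2` of `L` do not see the other degrees. -/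
def RespectsExc (L : Matrix ℕ ℕ ℝ) : Prop :=
  ∀ n m, n ∈ excDegrees → m ∉ excDegrees → L n m = 0

theorem respectsExc_L1 : RespectsExc L1 := by
  rintro n m (rfl | rfl) hm <;> rw [not_mem_excDegrees] at hm
  · simp [L1]; omega
  · simp only [L1]; split_ifs <;> first | rfl | omega | norm_num

theorem respectsExc_L2 : RespectsExc L2 := by
  rintro n m (rfl | rfl) hm <;> rw [not_mem_excDegrees] at hm
  · simp only [L2]; split_ifs <;> first | rfl | omega | norm_num
  · simp only [L2]; split_ifs <;> first | rfl | omega | norm_num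

theorem respectsExc_L3 : RespectsExc L3 := by
  rintro n m (rfl | rfl) hm <;> rw [not_mem_excDegrees] at hm
  · simp only [L3]; split_ifs <;> first | rfl | omega | norm_num
  · simp only [L3]; split_ifs <;> first | rfl | omega | norm_num

theorem eq_diffceApply_of_mem {L : Matrix ℕ ℕ ℝ} (hL : RespectsExc L) (k : ℕ)
    (D : Module.End ℝ SmoothFun) {n : ℕ} (hn : n ∈ excDegrees) :
    D (q n) = diffceApply k L q n := by
  rw [q_eq_zero hn, map_zero]
  refine (Finset.sum_eq_zero fun m _ => ?_).symm
  by_cases hm : m ∈ excDegrees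
  · rw [q_eq_zero hm, smul_zero]
  · rw [hL n m hn hm, zero_smul]

theorem eq_of_smul_eq {n : ℕ} (hn : n ∉ excDegrees) {u v : SmoothFun}
    (h : (excNorm n * hermNorm n) • u = (excNorm n * hermNorm n) • v) : u = v :=
  smul_right_injective SmoothFun (mul_pos (excNorm_pos hn) (hermNorm_pos n)).ne' h

theorem D0_q (n : ℕ) : D0 (q n) = (-2 * (n : ℝ)) • q n := by
  by_cases hn : n ∈ excDegrees
  · rw [q_eq_zero hn]; simp
  · refine eq_of_smul_eq hn ?_
    rw [← map_smul, smul_comm, smul_q, D0_excP]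
    ext x
    simp

theorem L1_down {n : ℕ} (hn : 3 ≤ n) : excNorm (n + 1) * hermNorm (n + 1) * L1 (n + 1) n =
    (-(2 * ((n : ℝ) + 1) * n)) * (excNorm n * hermNorm n) := by
  refine lower_of_upper isSymm_L1 (by rw [not_mem_excDegrees]; omega) (L1_up hn) ?_
  rw [mul_pow, mul_pow, excNorm_sq, excNorm_sq, hermNorm_sq_succ]
  push_cast
  ring

theorem L2_down {n : ℕ} (hn : 3 ≤ n) : excNorm (n + 2) * hermNorm (n + 2) * L2 (n + 2) n =
    (((n : ℝ) + 2) * (n + 1) * n / 28) * (excNorm n * hermNorm n) := by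
  refine lower_of_upper isSymm_L2 (by rw [not_mem_excDegrees]; omega) (L2_up hn) ?_
  rw [mul_pow, mul_pow, excNorm_sq, excNorm_sq, hermNorm_sq_succ, hermNorm_sq_succ]
  push_cast
  field_simp
  ring

theorem L3_down_one {n : ℕ} (hn : 3 ≤ n) : excNorm (n + 1) * hermNorm (n + 1) * L3 (n + 1) n =
    (2 * ((n : ℝ) + 1) * n) * (excNorm n * hermNorm n) := by
  refine lower_of_upper isSymm_L3 (by rw [not_mem_excDegrees]; omega) (L3_up_one hn) ?_
  rw [mul_pow, mul_pow, excNorm_sq, excNorm_sq, hermNorm_sq_succ]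
  push_cast
  ring

theorem L3_down_three {n : ℕ} (hn : n ∉ excDegrees) :
    excNorm (n + 3) * hermNorm (n + 3) * L3 (n + 3) n =
    (4 / 3 * ((n : ℝ) + 3) * (n + 2) * (n + 1)) * (excNorm n * hermNorm n) := by
  refine lower_of_upper isSymm_L3 hn (L3_up_three n) ?_
  rw [mul_pow, mul_pow, excNorm_sq, excNorm_sq, hermNorm_sq_succ, hermNorm_sq_succ,
    hermNorm_sq_succ]
  push_cast
  field_simp
  ring

theorem L0_intertwines (n : ℕ) : D0 (q n) = diffceApply 0 L0 q n := by
  simp [diffceApply, D0_q, L0]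

theorem D_excP_zero : D1 (excP 0) = 2 * excP 1 ∧ 112 * D2 (excP 0) = 112 * excP 0 + 2 * excP 2 := by
  have h1 := D1_excP 0
  have h2 := D2_excP 0
  simp only [Nat.cast_zero] at h1 h2
  constructor
  · linear_combination h1
  · linear_combination h2

theorem L1_intertwines_three (n : ℕ) : D1 (q n) = diffceApply 3 L1 q n := by
  by_cases hn : n ∈ excDegrees
  · exact eq_diffceApply_of_mem respectsExc_L1 3 D1 hn
  refine eq_of_smul_eq hn ?_
  rw [← map_smul, smul_q]
  rcases not_mem_excDegrees.1 hn with rfl | h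
  · rw [diffceApply_three_zero, D_excP_zero.1, q_eq_zero (n := 1) (by simp [excDegrees]),
      q_eq_zero (n := 2) (by simp [excDegrees]), excP_eq_zero (n := 1) (by simp [excDegrees])]
    simp [L1]
  · obtain ⟨j, rfl⟩ := Nat.exists_eq_add_of_le' h
    rw [diffceApply_three, D1_excP]
    have e0 : L1 (j + 3) j = 0 := isDiffceOp_L1 _ _ (by omega)
    have e1 : L1 (j + 3) (j + 1) = 0 := isDiffceOp_L1 _ _ (by omega)
    have e3 : L1 (j + 3) (j + 3) = 0 := by simp [L1]
    have e5 : L1 (j + 3) (j + 5) = 0 := isDiffceOp_L1 _ _ (by omega)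
    have e6 : L1 (j + 3) (j + 6) = 0 := isDiffceOp_L1 _ _ (by omega)
    have h4 := smul_smul_q (.inr (L1_up h))
    have h2 := smul_smul_q (n := j + 3) (m := j + 2) (l := L1 (j + 3) (j + 2))
      (r := -(2 * ((j : ℝ) + 2 + 1) * (j + 2))) <| by
        rcases Nat.eq_zero_or_pos j with rfl | hj
        · exact .inl (by simp [excDegrees])
        · exact .inr (by simpa using L1_down (n := j + 2) (by omega))
    simp only [e0, e1, e3, e5, e6, zero_smul, add_zero, zero_add, smul_add, h2]
    rw [show j + 4 = j + 3 + 1 from rfl, h4, show j + 3 - 1 = j + 2 from rfl]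
    ext x
    simp
    ring

theorem L2_intertwines_three (n : ℕ) : D2 (q n) = diffceApply 3 L2 q n := by
  by_cases hn : n ∈ excDegrees
  · exact eq_diffceApply_of_mem respectsExc_L2 3 D2 hn
  refine eq_of_smul_eq hn ?_
  rw [← map_smul, smul_q]
  have h5 := fun h => smul_smul_q (.inr (L2_up (n := n) h))
  have hP := D2_excP n
  rcases not_mem_excDegrees.1 hn with rfl | h
  · have h := D_excP_zero.2
    rw [excP_eq_zero (n := 2) (by simp [excDegrees])] at h
    rw [diffceApply_three_zero, q_eq_zero (n := 1) (by simp [excDegrees]),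
      q_eq_zero (n := 2) (by simp [excDegrees])]
    have e0 : L2 0 0 = 1 := by norm_num [L2]
    have e3 : L2 0 3 = 0 := isDiffceOp_L2 _ _ (by omega)
    simp only [e0, e3, one_smul, zero_smul, smul_zero, add_zero, smul_q]
    ext x
    replace h := congrArg (fun u : SmoothFun => u.1 x) h
    simpa using h
  · replace h5 := h5 h
    obtain ⟨j, rfl⟩ := Nat.exists_eq_add_of_le' h
    rw [diffceApply_three]
    have e0 : L2 (j + 3) j = 0 := isDiffceOp_L2 _ _ (by omega)
    have e2 : L2 (j + 3) (j + 2) = 0 := by simp [L2]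
    have e4 : L2 (j + 3) (j + 4) = 0 := by simp [L2]
    have e6 : L2 (j + 3) (j + 6) = 0 := isDiffceOp_L2 _ _ (by omega)
    have e3 : L2 (j + 3) (j + 3) = ((j : ℝ) + 3 - 4) * (j + 3 - 7) / 28 := by simp [L2]
    have h1 := smul_smul_q (n := j + 3) (m := j + 1) (l := L2 (j + 3) (j + 1))
      (r := ((j : ℝ) + 1 + 2) * (j + 1 + 1) * (j + 1) / 28) <| by
        rcases Nat.lt_or_ge j 2 with hj | hj
        · exact .inl (by simp [excDegrees]; omega)
        · exact .inr (by simpa using L2_down (n := j + 1) (by omega))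
    simp only [e0, e2, e4, e6, zero_smul, add_zero, zero_add, smul_add, h1]
    rw [show j + 5 = j + 3 + 2 from rfl, h5, smul_comm _ (L2 (j + 3) (j + 3)), smul_q, e3]
    ext x
    replace hP := congrArg (fun u : SmoothFun => u.1 x) hP
    simp at hP ⊢
    field_simp
    linear_combination 28 * hP

theorem L3_intertwines (n : ℕ) : D3 (q n) = diffceApply 3 L3 q n := by
  by_cases hn : n ∈ excDegrees
  · exact eq_diffceApply_of_mem respectsExc_L3 3 D3 hn
  refine eq_of_smul_eq hn ?_
  rw [← map_smul, smul_q]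
  have hP := D3_excP n
  have h6 := smul_smul_q (.inr (L3_up_three n))
  rcases not_mem_excDegrees.1 hn with rfl | h
  · rw [diffceApply_three_zero, q_eq_zero (n := 1) (by simp [excDegrees]),
      q_eq_zero (n := 2) (by simp [excDegrees])]
    have e0 : L3 0 0 = 0 := by norm_num [L3]
    rw [excP_eq_zero (n := 0 + 1) (by simp [excDegrees])] at hP
    rw [zero_add] at h6
    simp only [e0, zero_smul, smul_zero, add_zero, zero_add, h6]
    ext x
    replace hP := congrArg (fun u : SmoothFun => u.1 x) hP
    simp at hP ⊢
    linear_combination hP / 12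
  · have h4 := smul_smul_q (.inr (L3_up_one h))
    obtain ⟨j, rfl⟩ := Nat.exists_eq_add_of_le' h
    rw [diffceApply_three]
    have e1 : L3 (j + 3) (j + 1) = 0 := by simp [L3]
    have e3 : L3 (j + 3) (j + 3) = 0 := by simp [L3]
    have e5 : L3 (j + 3) (j + 5) = 0 := by simp [L3]
    have h2 := smul_smul_q (n := j + 3) (m := j + 2) (l := L3 (j + 3) (j + 2))
      (r := 2 * ((j : ℝ) + 2 + 1) * (j + 2)) <| by
        rcases Nat.eq_zero_or_pos j with rfl | hj
        · exact .inl (by simp [excDegrees])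
        · exact .inr (by simpa using L3_down_one (n := j + 2) (by omega))
    have h0 := smul_smul_q (n := j + 3) (m := j) (l := L3 (j + 3) j)
      (r := 4 / 3 * ((j : ℝ) + 3) * (j + 2) * (j + 1)) <| by
        by_cases hj : j ∈ excDegrees
        · exact .inl hj
        · exact .inr (L3_down_three hj)
    simp only [e1, e3, e5, zero_smul, add_zero, smul_add, h2, h0]
    rw [show j + 6 = j + 3 + 3 from rfl, show j + 4 = j + 3 + 1 from rfl, h6, h4]
    rw [show j + 3 - 1 = j + 2 from rfl, Nat.add_sub_cancel] at hP
    ext x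
    replace hP := congrArg (fun u : SmoothFun => u.1 x) hP
    simp at hP ⊢
    field_simp
    linear_combination hP

theorem L1_intertwines (n : ℕ) : D1 (q n) = diffceApply 1 L1 q n := by
  rw [L1_intertwines_three, diffceApply_mono isDiffceOp_L1 (by omega)]

theorem L2_intertwines (n : ℕ) : D2 (q n) = diffceApply 2 L2 q n := by
  rw [L2_intertwines_three, diffceApply_mono isDiffceOp_L2 (by omega)]

/-! ### The difference operators of the fourteen operators and of `T` -/

/-- The operator `D` corresponds to the symmetric difference operator `L` of order at most `6`. -/
def Intertwines (D : Module.End ℝ SmoothFun) (L : Matrix ℕ ℕ ℝ) : Prop :=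
  L.IsSymm ∧ IsDiffceOp 3 L ∧ ∀ n, D (q n) = diffceApply 3 L q n

/-- The eigenvalue of `D₀` on `q_n`. -/
def eig (n : ℕ) : ℝ := -2 * (n : ℝ)

/-- The difference operator of `D₀^j`. -/
def diagMat (j : ℕ) : Matrix ℕ ℕ ℝ := Matrix.diagonal fun n => eig n ^ j

/-- The difference operator of `D₀^j E + E D₀^j`, where `L` is that of `E`. -/
def antiMat (L : Matrix ℕ ℕ ℝ) (j : ℕ) : Matrix ℕ ℕ ℝ := fun n m => L n m * (eig n ^ j + eig m ^ j)

/-- The difference operator of `D₁²`. -/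
noncomputable def L11 : Matrix ℕ ℕ ℝ := fun n m => ∑ l ∈ Finset.range (n + m + 2), L1 n l * L1 l m

theorem D0_pow_q (j n : ℕ) : (D0 ^ j) (q n) = eig n ^ j • q n := by
  induction j with
  | zero => simp
  | succ j ih =>
    rw [pow_succ, Module.End.mul_apply, D0_q, map_smul, ih, smul_smul, pow_succ']
    rfl

theorem intertwines_diagMat (j : ℕ) : Intertwines (D0 ^ j) (diagMat j) := by
  refine ⟨Matrix.isSymm_diagonal _, fun n m h => Matrix.diagonal_apply_ne _ (by omega),
    fun n => ?_⟩
  have hb : IsDiffceOp 0 (diagMat j) := fun n m h => Matrix.diagonal_apply_ne _ (by omega)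
  rw [diffceApply_mono hb (Nat.zero_le 3), D0_pow_q]
  simp [diffceApply, diagMat]

theorem Intertwines.anti {D : Module.End ℝ SmoothFun} {L : Matrix ℕ ℕ ℝ} (h : Intertwines D L)
    (j : ℕ) : Intertwines (D0 ^ j * D + D * D0 ^ j) (antiMat L j) := by
  obtain ⟨h1, h2, h3⟩ := h
  refine ⟨?_, fun n m hnm => ?_, fun n => ?_⟩
  · ext n m
    simp only [antiMat, Matrix.transpose_apply]
    rw [h1.apply n m, add_comm]
  · rw [antiMat, h2 n m hnm, zero_mul]
  · rw [LinearMap.add_apply, Module.End.mul_apply, Module.End.mul_apply, D0_pow_q, map_smul, h3,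
      diffceApply, map_sum, Finset.smul_sum, ← Finset.sum_add_distrib]
    refine Finset.sum_congr rfl fun m _ => ?_
    rw [map_smul, D0_pow_q, smul_smul, smul_smul, ← add_smul, antiMat]
    congr 1
    ring

theorem Intertwines.congr {D E : Module.End ℝ SmoothFun} {L : Matrix ℕ ℕ ℝ}
    (h : Intertwines D L) (hE : E = D) : Intertwines E L := hE ▸ h

theorem isDiffceOp_L11 : IsDiffceOp 2 L11 := fun n m h => by
  refine Finset.sum_eq_zero fun l _ => ?_
  by_cases hl : n + 1 < l ∨ l + 1 < n
  · rw [isDiffceOp_L1 n l hl, zero_mul]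
  · rw [isDiffceOp_L1 l m (by omega), mul_zero]

theorem intertwines_L11 : Intertwines (D1 ^ 2) L11 := by
  refine ⟨?_, isDiffceOp_L11.mono (by omega), fun n => ?_⟩
  · ext n m
    simp only [L11, Matrix.transpose_apply]
    rw [add_comm n m]
    refine Finset.sum_congr rfl fun l _ => ?_
    rw [isSymm_L1.apply l m, isSymm_L1.apply n l, mul_comm]
  · rw [pow_two, Module.End.mul_apply, L1_intertwines, diffceApply, map_sum,
      diffceApply_mono isDiffceOp_L11 (by omega), diffceApply]
    have h1 : ∀ l ∈ Finset.Icc (n - 1) (n + 1), D1 (L1 n l • q l) =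
        ∑ m ∈ Finset.Icc (n - 2) (n + 2), (L1 n l * L1 l m) • q m := fun l hl => by
      rw [map_smul, L1_intertwines, diffceApply, Finset.smul_sum]
      simp only [smul_smul]
      rw [Finset.mem_Icc] at hl
      refine Finset.sum_subset (fun m hm => ?_) fun m _ hm' => ?_
      · rw [Finset.mem_Icc] at hm ⊢; omega
      · rw [Finset.mem_Icc] at hm'
        rw [isDiffceOp_L1 l m (by omega), mul_zero, zero_smul]
    rw [Finset.sum_congr rfl h1, Finset.sum_comm]
    refine Finset.sum_congr rfl fun m _ => ?_
    rw [← Finset.sum_smul, L11]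
    congr 1
    refine Finset.sum_subset_zero_on_sdiff (fun l hl => ?_) (fun l hl => ?_) fun l _ => rfl
    · rw [Finset.mem_Icc] at hl; rw [Finset.mem_range]; omega
    · rw [Finset.mem_sdiff, Finset.mem_Icc] at hl
      rw [isDiffceOp_L1 n l (by omega), zero_mul]

/-- The difference operators of the fourteen operators `Y`. -/
noncomputable def Ymat : Fin 14 → Matrix ℕ ℕ ℝ :=
  ![diagMat 0, diagMat 1, L1, L2, L3, diagMat 2, diagMat 3, L11, antiMat L3 1, antiMat L3 2,
    antiMat L1 1, antiMat L3 3, antiMat L1 2, antiMat L11 1]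

theorem intertwines_Y (i : Fin 14) : Intertwines (Y i) (Ymat i) := by
  have h1 : Intertwines D1 L1 :=
    ⟨isSymm_L1, isDiffceOp_L1.mono (by omega), L1_intertwines_three⟩
  have h2 : Intertwines D2 L2 :=
    ⟨isSymm_L2, isDiffceOp_L2.mono (by omega), L2_intertwines_three⟩
  have h3 : Intertwines D3 L3 := ⟨isSymm_L3, isDiffceOp_L3, L3_intertwines⟩
  fin_cases i
  · exact (intertwines_diagMat 0).congr (pow_zero D0).symm
  · exact (intertwines_diagMat 1).congr (pow_one D0).symm
  · exact h1
  · exact h2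
  · exact h3
  · exact intertwines_diagMat 2
  · exact intertwines_diagMat 3
  · exact intertwines_L11
  · exact (h3.anti 1).congr (by rw [pow_one, add_comm]; rfl)
  · exact (h3.anti 2).congr (by rw [add_comm]; rfl)
  · exact (h1.anti 1).congr (by rw [pow_one]; rfl)
  · exact (h3.anti 3).congr (by rw [add_comm]; rfl)
  · exact h1.anti 2
  · exact (intertwines_L11.anti 1).congr (by rw [pow_one]; rfl)

theorem Y_mem_fourierSym (i : Fin 14) : Y i ∈ fourierSym q 3 3 :=
  ⟨isDiffOp_Y i, Ymat i, intertwines_Y i⟩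

/-- The coefficients of `T` with respect to the fourteen operators `Y`. -/
noncomputable def tCoef (N Ω : ℝ) : Fin 14 → ℝ :=
  ![0, -(2 * Ω * (54 * N ^ 2 + 4 * Ω ^ 2 + 48 * N - 3)),
    3 * (6 * N * Ω ^ 2 - 4 * N ^ 2 + 2 * Ω ^ 2 - 17 * N - 7), 672 * (N + 1) * N * Ω,
    3 / 2 * (2 * N ^ 2 + 2 * N - 15) * (2 * N + 1), -(3 * (2 * Ω ^ 2 - 1) * Ω), -Ω ^ 3,
    -(6 * (2 * N + 1) * Ω), 3 / 2 * (3 * N ^ 2 + 3 * N - 7), 9 / 8 * (2 * N + 1),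
    3 * (N * Ω ^ 2 + 2 * Ω ^ 2 - 3 / 2 * N - 4), 3 / 8, 3 / 4 * (2 * Ω ^ 2 - 1), -(3 / 2 * Ω)]

theorem T_eq_sum (N Ω : ℝ) : T N Ω = ∑ i, tCoef N Ω i • Y i := by
  simp only [Fin.sum_univ_succ, tCoef, Y, T]
  simp [Fin.succ]
  module

theorem T_mem_fourierSym (N Ω : ℝ) : T N Ω ∈ fourierSym q 3 3 := by
  rw [T_eq_sum]
  exact Submodule.sum_mem _ fun i _ => Submodule.smul_mem _ _ (Y_mem_fourierSym i)

/-- The difference operator of `T`. -/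
noncomputable def Tmat (N Ω : ℝ) : Matrix ℕ ℕ ℝ := fun n m => ∑ i, tCoef N Ω i * Ymat i n m

theorem T_q (N Ω : ℝ) (n : ℕ) : T N Ω (q n) = diffceApply 3 (Tmat N Ω) q n := by
  rw [T_eq_sum, LinearMap.sum_apply]
  simp only [LinearMap.smul_apply, (intertwines_Y _).2.2, diffceApply, Finset.smul_sum, smul_smul]
  rw [Finset.sum_comm]
  refine Finset.sum_congr rfl fun m _ => ?_
  rw [← Finset.sum_smul, Tmat]

theorem isSymm_Tmat (N Ω : ℝ) : (Tmat N Ω).IsSymm := by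
  ext n m
  simp only [Tmat, Matrix.transpose_apply]
  exact Finset.sum_congr rfl fun i _ => by rw [(intertwines_Y i).1.apply n m]

theorem sum_Ymat_of_ne (c : Fin 14 → ℝ) {n m : ℕ} (h : n ≠ m) : ∑ i, c i * Ymat i n m =
    (c 2 + c 10 * (eig n + eig m) + c 12 * (eig n ^ 2 + eig m ^ 2)) * L1 n m + c 3 * L2 n m +
    (c 4 + c 8 * (eig n + eig m) + c 9 * (eig n ^ 2 + eig m ^ 2) +
      c 11 * (eig n ^ 3 + eig m ^ 3)) * L3 n m +
    (c 7 + c 13 * (eig n + eig m)) * L11 n m := by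
  have hd : ∀ j, diagMat j n m = 0 := fun j => Matrix.diagonal_apply_ne _ h
  have e : ∑ i, c i * Ymat i n m = c 0 * diagMat 0 n m + c 1 * diagMat 1 n m +
      c 2 * L1 n m + c 3 * L2 n m + c 4 * L3 n m +
      c 5 * diagMat 2 n m + c 6 * diagMat 3 n m + c 7 * L11 n m +
      c 8 * antiMat L3 1 n m + c 9 * antiMat L3 2 n m +
      c 10 * antiMat L1 1 n m + c 11 * antiMat L3 3 n m +
      c 12 * antiMat L1 2 n m + c 13 * antiMat L11 1 n m := by
    simp only [Fin.sum_univ_succ, Fin.sum_univ_zero, add_zero, ← add_assoc]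
    rfl
  rw [e, hd, hd, hd, hd]
  simp only [antiMat]
  ring

/-- Two places above the diagonal `D₁²` and `D₂` have proportional entries. -/
theorem L11_up {n : ℕ} (hn : 3 ≤ n) : L11 n (n + 2) = 112 * (n + 1) * L2 n (n + 2) := by
  have h3 := three_le_cast hn
  have e : L11 n (n + 2) = L1 n (n + 1) * L1 (n + 1) (n + 2) := by
    refine Finset.sum_eq_single_of_mem (n + 1) (Finset.mem_range.2 (by omega)) fun l _ hl => ?_
    by_cases h : n + 1 < l ∨ l + 1 < n
    · rw [isDiffceOp_L1 n l h, zero_mul]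
    · rcases (by omega : l = n ∨ l + 1 = n) with rfl | h'
      · rw [isDiffceOp_L1 l (l + 2) (by omega), mul_zero]
      · rw [isDiffceOp_L1 l (n + 2) (by omega), mul_zero]
  rw [e, L1, L1, L2, if_neg (by omega), if_pos rfl, if_neg (by omega), if_pos (by omega),
    if_neg (by omega), if_neg (by omega), if_pos rfl]
  push_cast
  rw [show (n : ℝ) + 1 + 1 = n + 2 by ring, show (n : ℝ) + 1 - 2 = n - 1 by ring,
    Real.sqrt_mul (mul_nonneg (mul_nonneg (by positivity) (by linarith)) (by linarith)),
    Real.sqrt_mul (mul_nonneg (by positivity) (by linarith)), Real.sqrt_mul (by positivity)]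
  have h2 : √(2 : ℝ) * √2 = 2 := Real.mul_self_sqrt (by norm_num)
  have h1 : √((n : ℝ) + 1) * √((n : ℝ) + 1) = n + 1 := Real.mul_self_sqrt (by positivity)
  linear_combination (√((n : ℝ) + 2) * √((n : ℝ) - 1) * √((n : ℝ) - 2) * √(n : ℝ)) *
    (√((n : ℝ) + 1) * √((n : ℝ) + 1) * h2 + 2 * h1)

/-- One place above the diagonal `D₁` and `D₃` have opposite entries. -/
theorem L1_eq_neg_L3 {n : ℕ} (hn : 3 ≤ n) : L1 n (n + 1) = -L3 n (n + 1) := by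
  have h3 := three_le_cast hn
  rw [L1, L3, if_neg (by omega), if_pos rfl, if_neg (by omega), if_neg (by omega), if_pos rfl,
    Real.sqrt_mul (by positivity), Real.sqrt_mul (by positivity), Real.sqrt_mul (by positivity)]
  ring

theorem sum_Ymat_add_one (c : Fin 14 → ℝ) {n : ℕ} (hn : 3 ≤ n) : ∑ i, c i * Ymat i n (n + 1) =
    (c 4 + c 8 * (eig n + eig (n + 1)) + c 9 * (eig n ^ 2 + eig (n + 1) ^ 2) +
      c 11 * (eig n ^ 3 + eig (n + 1) ^ 3) - (c 2 + c 10 * (eig n + eig (n + 1)) +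
      c 12 * (eig n ^ 2 + eig (n + 1) ^ 2))) * L3 n (n + 1) := by
  have e2 : L2 n (n + 1) = 0 := by
    rw [L2, if_neg (by omega), if_neg (by omega), if_neg (by omega)]
  have e11 : L11 n (n + 1) = 0 := by
    refine Finset.sum_eq_zero fun l _ => ?_
    by_cases h : l = n
    · rw [h]; simp [L1]
    · by_cases h' : l = n + 1
      · rw [h']; simp [L1]
      · by_cases h : n + 1 < l ∨ l + 1 < n
        · rw [isDiffceOp_L1 n l h, zero_mul]
        · rw [isDiffceOp_L1 l (n + 1) (by omega), mul_zero]
  rw [sum_Ymat_of_ne _ (by omega), e2, e11, L1_eq_neg_L3 hn]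
  ring

theorem sum_Ymat_add_two (c : Fin 14 → ℝ) {n : ℕ} (hn : 3 ≤ n) : ∑ i, c i * Ymat i n (n + 2) =
    (c 3 + 112 * (n + 1) * (c 7 + c 13 * (eig n + eig (n + 2)))) * L2 n (n + 2) := by
  have e1 : L1 n (n + 2) = 0 := isDiffceOp_L1 _ _ (by omega)
  have e3 : L3 n (n + 2) = 0 := by
    rw [L3, if_neg (by omega), if_neg (by omega), if_neg (by omega), if_neg (by omega)]
  rw [sum_Ymat_of_ne _ (by omega), e1, e3, L11_up hn]
  ring

theorem sum_Ymat_add_three (c : Fin 14 → ℝ) (n : ℕ) : ∑ i, c i * Ymat i n (n + 3) =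
    (c 4 + c 8 * (eig n + eig (n + 3)) + c 9 * (eig n ^ 2 + eig (n + 3) ^ 2) +
      c 11 * (eig n ^ 3 + eig (n + 3) ^ 3)) * L3 n (n + 3) := by
  have e1 : L1 n (n + 3) = 0 := isDiffceOp_L1 _ _ (by omega)
  have e2 : L2 n (n + 3) = 0 := isDiffceOp_L2 _ _ (by omega)
  have e11 : L11 n (n + 3) = 0 := isDiffceOp_L11 _ _ (by omega)
  rw [sum_Ymat_of_ne _ (by omega), e1, e2, e11]
  ring

/-- The difference operator of `T` decouples the degrees `≤ N` from the degrees `> N`. -/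
theorem Tmat_eq_zero {N : ℕ} (Ω : ℝ) {n m : ℕ} (hn : n ∉ excDegrees) (hm : m ∉ excDegrees)
    (hnN : n ≤ N) (hNm : N < m) : Tmat N Ω n m = 0 := by
  rw [not_mem_excDegrees] at hn hm
  by_cases h3 : n + 3 < m
  · exact Finset.sum_eq_zero fun i _ => by rw [(intertwines_Y i).2.1 n m (.inl h3), mul_zero]
  rw [Tmat]
  rcases (by omega : m = n + 1 ∨ m = n + 2 ∨ m = n + 3) with rfl | rfl | rfl
  · obtain rfl : N = n := by omega
    rw [sum_Ymat_add_one _ (by omega)]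
    simp only [tCoef, eig, Matrix.cons_val]
    push_cast
    ring
  · rw [sum_Ymat_add_two _ (by omega)]
    simp only [tCoef, eig, Matrix.cons_val]
    rcases (by omega : N = n ∨ N = n + 1) with rfl | rfl <;> push_cast <;> ring
  · rw [sum_Ymat_add_three]
    simp only [tCoef, eig, Matrix.cons_val]
    rcases (by omega : N = n ∨ N = n + 1 ∨ N = n + 2) with rfl | rfl | rfl <;> push_cast <;> ring

/-- `T` maps the span of `q_0, …, q_N` to itself, with a symmetric matrix. -/
theorem exists_T_q_eq_sum (N : ℕ) (Ω : ℝ) : ∃ M : Matrix ℕ ℕ ℝ, M.IsSymm ∧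
    ∀ n ≤ N, T N Ω (q n) = ∑ m ∈ Finset.range (N + 1), M n m • q m := by
  classical
  -- the entries in the exceptional rows and columns are irrelevant and set to zero
  refine ⟨Matrix.of fun n m => if n ∈ excDegrees ∨ m ∈ excDegrees then 0 else Tmat N Ω n m,
    Matrix.IsSymm.ext fun n m => ?_, fun n h => ?_⟩
  · simp only [Matrix.of_apply, (isSymm_Tmat N Ω).apply n m, or_comm]
  simp only [Matrix.of_apply]
  by_cases hn : n ∈ excDegrees
  · simp [hn, q_eq_zero hn]
  rw [T_q, diffceApply]
  have h0 : ∀ m, (if n ∈ excDegrees ∨ m ∈ excDegrees then 0 else Tmat N Ω n m) • q m =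
      Tmat N Ω n m • q m := fun m => by
    by_cases hm : m ∈ excDegrees
    · rw [q_eq_zero hm, smul_zero, smul_zero]
    · rw [if_neg (by tauto)]
  have h1 : ∀ m, m ∉ Finset.Icc (n - 3) (n + 3) → Tmat N Ω n m • q m = 0 := fun m hm => by
    rw [Finset.mem_Icc] at hm
    have : Tmat N Ω n m = 0 := Finset.sum_eq_zero fun i _ => by
      rw [(intertwines_Y i).2.1 n m (by omega), mul_zero]
    rw [this, zero_smul]
  have h2 : ∀ m, m ∉ Finset.range (N + 1) → Tmat N Ω n m • q m = 0 := fun m hm => by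
    rw [Finset.mem_range] at hm
    by_cases hm' : m ∈ excDegrees
    · rw [q_eq_zero hm', smul_zero]
    · rw [Tmat_eq_zero Ω hn hm' h (by omega), zero_smul]
  simp only [h0]
  exact (Finset.sum_subset (Finset.subset_union_left (s₂ := Finset.range (N + 1)))
    fun m _ => h1 m).trans (Finset.sum_subset Finset.subset_union_right fun m _ => h2 m).symm

/-! ### Families of functions of uniformly temperate growth -/

/-- The derivatives of order at most `n` of the functions `u i` are bounded by polynomials,
uniformly in `i`. -/
def TempBound {ι : Type*} (n : ℕ) (u : ι → SmoothFun) : Prop :=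
  ∀ j ≤ n, ∃ (C : ℝ) (k : ℕ), 0 ≤ C ∧ ∀ i x, |((ddx ^ j) (u i)).1 x| ≤ C * (1 + |x|) ^ k

/-- A family of smooth functions all of whose derivatives are bounded by polynomials, uniformly in
the index. -/
def Tempered {ι : Type*} (u : ι → SmoothFun) : Prop := ∀ n, TempBound n u

section
variable {ι : Type*} {u v : ι → SmoothFun} {n : ℕ}

theorem tempBound_zero : TempBound 0 u ↔
    ∃ (C : ℝ) (k : ℕ), 0 ≤ C ∧ ∀ i x, |(u i).1 x| ≤ C * (1 + |x|) ^ k := by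
  simp [TempBound]

theorem tempBound_succ : TempBound (n + 1) u ↔ TempBound 0 u ∧ TempBound n fun i => ddx (u i) := by
  constructor
  · intro h
    refine ⟨fun j hj => h j (by omega), fun j hj => ?_⟩
    obtain ⟨C, k, hC, h⟩ := h (j + 1) (by omega)
    exact ⟨C, k, hC, fun i x => by simpa [pow_succ] using h i x⟩
  · rintro ⟨h0, h⟩ j hj
    rcases j with _ | j
    · exact h0 0 le_rfl
    · obtain ⟨C, k, hC, h⟩ := h j (by omega)
      exact ⟨C, k, hC, fun i x => by simpa [pow_succ] using h i x⟩

theorem TempBound.mono {m : ℕ} (h : TempBound n u) (hm : m ≤ n) : TempBound m u :=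
  fun j hj => h j (hj.trans hm)

theorem TempBound.add (hu : TempBound n u) (hv : TempBound n v) :
    TempBound n fun i => u i + v i := fun j hj => by
  obtain ⟨C, k, hC, h⟩ := hu j hj
  obtain ⟨C', k', hC', h'⟩ := hv j hj
  refine ⟨C + C', k + k', by positivity, fun i x => ?_⟩
  rw [map_add, coe_add, add_mul]
  have h1 : (1 : ℝ) ≤ 1 + |x| := by linarith [abs_nonneg x]
  refine (abs_add_le _ _).trans (add_le_add ((h i x).trans ?_) ((h' i x).trans ?_))
  · exact mul_le_mul_of_nonneg_left (pow_le_pow_right₀ h1 (by omega)) hC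
  · exact mul_le_mul_of_nonneg_left (pow_le_pow_right₀ h1 (by omega)) hC'

theorem TempBound.mul (hu : TempBound n u) (hv : TempBound n v) :
    TempBound n fun i => u i * v i := by
  have h0 : ∀ {u v : ι → SmoothFun}, TempBound 0 u → TempBound 0 v →
      TempBound 0 fun i => u i * v i := fun hu hv => by
    rw [tempBound_zero] at *
    obtain ⟨C, k, hC, h⟩ := hu
    obtain ⟨C', k', hC', h'⟩ := hv
    refine ⟨C * C', k + k', by positivity, fun i x => ?_⟩
    rw [coe_mul, abs_mul, pow_add, mul_mul_mul_comm]
    exact mul_le_mul (h i x) (h' i x) (abs_nonneg _) (by positivity)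
  induction n generalizing u v with
  | zero => exact h0 hu hv
  | succ n ih =>
    have hu' := tempBound_succ.1 hu
    have hv' := tempBound_succ.1 hv
    refine tempBound_succ.2 ⟨h0 hu'.1 hv'.1, ?_⟩
    simp only [ddx_mul]
    exact (ih hu'.2 (hv.mono n.le_succ)).add (ih (hu.mono n.le_succ) hv'.2)

theorem Tempered.add (hu : Tempered u) (hv : Tempered v) : Tempered fun i => u i + v i :=
  fun n => (hu n).add (hv n)

theorem Tempered.mul (hu : Tempered u) (hv : Tempered v) : Tempered fun i => u i * v i :=
  fun n => (hu n).mul (hv n)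

theorem Tempered.ddx (hu : Tempered u) : Tempered fun i => ddx (u i) :=
  fun n => (tempBound_succ.1 (hu (n + 1))).2

theorem tempered_of_ddx (h0 : TempBound 0 u) (h : Tempered fun i => ExcHermite.ddx (u i)) :
    Tempered u := fun n => by
  rcases n with _ | n
  · exact h0
  · exact tempBound_succ.2 ⟨h0, h n⟩

theorem tempered_zero : Tempered fun _ : ι => (0 : SmoothFun) :=
  fun _ _ _ => ⟨0, 0, le_rfl, fun _ _ => by simp⟩

theorem tempered_const (c : ℝ) : Tempered fun _ : ι => const c := by
  refine tempered_of_ddx (tempBound_zero.2 ⟨|c|, 0, abs_nonneg c, fun i x => by simp⟩) ?_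
  simp only [ddx_const]
  exact tempered_zero

theorem Tempered.smul (hu : Tempered u) (c : ℝ) : Tempered fun i => c • u i := by
  convert (tempered_const c).mul hu using 2
  exact Algebra.smul_def _ _

theorem Tempered.neg (hu : Tempered u) : Tempered fun i => -u i := by
  convert hu.smul (-1) using 2
  rw [neg_one_smul]

theorem Tempered.sub (hu : Tempered u) (hv : Tempered v) : Tempered fun i => u i - v i := by
  simp only [sub_eq_add_neg]
  exact hu.add hv.neg

theorem Tempered.pow (hu : Tempered u) (k : ℕ) : Tempered fun i => u i ^ k := by
  induction k with
  | zero => simp only [pow_zero]; exact tempered_const 1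
  | succ k ih => simp only [pow_succ]; exact ih.mul hu

theorem tempered_natCast (k : ℕ) : Tempered fun _ : ι => (k : SmoothFun) := tempered_const (k : ℝ)

theorem tempered_ofNat (k : ℕ) [k.AtLeastTwo] : Tempered fun _ : ι => (ofNat(k) : SmoothFun) :=
  tempered_natCast k

theorem tempered_idX : Tempered fun _ : ι => idX := by
  refine tempered_of_ddx (tempBound_zero.2 ⟨1, 1, zero_le_one, fun i x => by simp⟩) ?_
  simp only [ddx_idX]
  exact tempered_const 1

theorem tempered_invEta : Tempered fun _ : ι => invEta := by
  have h0 : TempBound 0 fun _ : ι => invEta := tempBound_zero.2 ⟨1, 0, zero_le_one, fun i x => by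
    rw [coe_invEta, pow_zero, mul_one, abs_of_nonneg (by positivity)]
    exact inv_le_one_of_one_le₀ (by nlinarith [sq_nonneg x])⟩
  intro n
  induction n with
  | zero => exact h0
  | succ n ih =>
    -- `η⁻¹' = -4 x η⁻¹ η⁻¹` bounds the derivatives recursively
    refine tempBound_succ.2 ⟨h0, ?_⟩
    have e : (fun _ : ι => ExcHermite.ddx invEta) =
        fun _ => const (-4) * idX * (invEta * invEta) := by
      funext i
      rw [ddx_invEta]
      ext x
      simp only [coe_neg, coe_mul, coe_pow, coe_ofNat, coe_const, coe_idX, coe_invEta]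
      ring
    rw [e]
    exact (((tempered_const (-4)) n).mul (tempered_idX n)).mul (ih.mul ih)

theorem tempered_logDerivSqrtW : Tempered fun _ : ι => logDerivSqrtW :=
  tempered_idX.neg.sub (((tempered_ofNat 4).mul tempered_idX).mul tempered_invEta)

theorem Tempered.nab (hu : Tempered u) : Tempered fun i => nab (u i) :=
  hu.ddx.add (tempered_logDerivSqrtW.mul hu)

end

/-- Operators that map uniformly tempered families to uniformly tempered families. -/
def PreservesTempered (D : Module.End ℝ SmoothFun) : Prop :=
  ∀ u : ℕ → SmoothFun, Tempered u → Tempered fun i => D (u i)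

theorem PreservesTempered.mul {D E : Module.End ℝ SmoothFun} (hD : PreservesTempered D)
    (hE : PreservesTempered E) : PreservesTempered (D * E) := fun _ hu => hD _ (hE _ hu)

theorem PreservesTempered.add {D E : Module.End ℝ SmoothFun} (hD : PreservesTempered D)
    (hE : PreservesTempered E) : PreservesTempered (D + E) := fun _ hu => (hD _ hu).add (hE _ hu)

theorem PreservesTempered.smul {D : Module.End ℝ SmoothFun} (hD : PreservesTempered D) (c : ℝ) :
    PreservesTempered (c • D) := fun _ hu => (hD _ hu).smul c

theorem PreservesTempered.pow {D : Module.End ℝ SmoothFun} (hD : PreservesTempered D) (k : ℕ) :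
    PreservesTempered (D ^ k) := by
  induction k with
  | zero => exact fun _ hu => hu
  | succ k ih => rw [pow_succ]; exact ih.mul hD

theorem preservesTempered_D0 : PreservesTempered D0 := fun u hu => by
  simp only [D0_apply]
  exact hu.nab.nab.sub (((((tempered_idX.pow 2).add (tempered_ofNat 3)).add
    ((tempered_ofNat 8).mul tempered_invEta)).sub
      ((tempered_ofNat 16).mul (tempered_invEta.pow 2))).mul hu)

theorem preservesTempered_D1 : PreservesTempered D1 := fun u hu => by
  simp only [D1_apply]
  exact ((tempered_idX.mul hu.nab.nab).add hu.nab).sub (((((tempered_idX.pow 3).add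
    ((tempered_ofNat 2).mul tempered_idX)).add
    (((tempered_ofNat 4).mul tempered_idX).mul tempered_invEta)).sub
      (((tempered_ofNat 16).mul tempered_idX).mul (tempered_invEta.pow 2))).mul hu)

theorem preservesTempered_D2 : PreservesTempered D2 := fun u hu => by
  simp only [D2_apply]
  exact (((((tempered_ofNat 17).sub ((tempered_ofNat 2).mul (tempered_idX.pow 2))).mul
    hu.nab.nab).sub (((tempered_ofNat 4).mul tempered_idX).mul hu.nab)).add
    (((((((tempered_ofNat 2).mul (tempered_idX.pow 4)).sub
      ((tempered_ofNat 15).mul (tempered_idX.pow 2))).add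
      ((tempered_ofNat 288).mul (tempered_invEta.pow 2))).sub
      ((tempered_ofNat 152).mul tempered_invEta)).add (tempered_ofNat 61)).mul hu)).smul _

theorem preservesTempered_D3 : PreservesTempered D3 := fun u hu => by
  simp only [D3_apply]
  exact ((((tempered_ofNat 4).mul (tempered_idX.pow 3)).add
    ((tempered_ofNat 6).mul tempered_idX)).mul hu).smul _

theorem preservesTempered_Y (i : Fin 14) : PreservesTempered (Y i) := by
  have h0 := preservesTempered_D0
  have h1 := preservesTempered_D1
  have h2 := preservesTempered_D2
  have h3 := preservesTempered_D3
  have anti : ∀ {D E : Module.End ℝ SmoothFun}, PreservesTempered D → PreservesTempered E →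
      PreservesTempered (D * E + E * D) := fun hD hE => (hD.mul hE).add (hE.mul hD)
  fin_cases i
  · exact fun _ hu => hu
  · exact h0
  · exact h1
  · exact h2
  · exact h3
  · exact h0.pow 2
  · exact h0.pow 3
  · exact h1.pow 2
  · exact anti h3 h0
  · exact anti h3 (h0.pow 2)
  · exact anti h0 h1
  · exact anti h3 (h0.pow 3)
  · exact anti (h0.pow 2) h1
  · exact anti h0 (h1.pow 2)

theorem preservesTempered_T (N Ω : ℝ) : PreservesTempered (T N Ω) := by
  rw [T_eq_sum]
  exact Finset.sum_induction _ _ (fun _ _ => PreservesTempered.add)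
    (fun _ _ => tempered_zero) fun i _ => (preservesTempered_Y i).smul _

/-- A smooth function of temperate growth: a constant family that is uniformly tempered. -/
def Temp (f : SmoothFun) : Prop := Tempered fun _ : ℕ => f

theorem coe_ddx_pow (j : ℕ) (f : SmoothFun) : ((ddx ^ j) f).1 = iteratedDeriv j f.1 := by
  induction j with
  | zero => rfl
  | succ j ih =>
    rw [pow_succ', iteratedDeriv_succ, ← ih]
    rfl

theorem temp_of_hasTemperateGrowth {f : SmoothFun} (hf : Function.HasTemperateGrowth f.1) :
    Temp f := fun n j _ => by
  obtain ⟨k, C, h⟩ := hf.2 j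
  have e := coe_ddx_pow j f
  refine ⟨|C|, k, abs_nonneg C, fun _ x => ?_⟩
  have h' := h x
  rw [norm_iteratedFDeriv_eq_norm_iteratedDeriv, ← e] at h'
  exact h'.trans (mul_le_mul_of_nonneg_right (le_abs_self C) (by positivity))

theorem temp_hermiteH (n : ℕ) : Temp (hermiteH n) := by
  induction n with
  | zero => rw [hermiteH_zero]; exact tempered_const 1
  | succ n ih =>
    rw [hermiteH_succ]
    exact (((tempered_ofNat 2).mul tempered_idX).mul ih).sub ih.ddx

theorem temp_q (n : ℕ) : Temp (q n) :=
  Tempered.smul (((temp_hermiteH n).add ((temp_hermiteH (n - 2)).smul _)).add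
    ((temp_hermiteH (n - 4)).smul _)) _

/-! ### Locality -/

theorem ddx_congr_nhds {f g : SmoothFun} {x : ℝ} (h : f.1 =ᶠ[nhds x] g.1) :
    (ddx f).1 =ᶠ[nhds x] (ddx g).1 := h.deriv

theorem nab_congr_nhds {f g : SmoothFun} {x : ℝ} (h : f.1 =ᶠ[nhds x] g.1) :
    (nab f).1 =ᶠ[nhds x] (nab g).1 := by
  filter_upwards [h, ddx_congr_nhds h] with y h1 h2
  simp only [nab_apply, coe_add, coe_mul, h1, h2]

/-- Differential operators are local. -/
theorem IsDiffOp.congr_nhds {m : ℕ} {D : Module.End ℝ SmoothFun} (hD : IsDiffOp m D)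
    {f g : SmoothFun} {x : ℝ} (h : f.1 =ᶠ[nhds x] g.1) : (D f).1 x = (D g).1 x := by
  obtain ⟨a, rfl⟩ := hD
  simp only [LinearMap.sum_apply, Module.End.mul_apply, mulOp_apply, coe_sum, coe_mul]
  refine Finset.sum_congr rfl fun j _ => ?_
  have h' : ((ddx ^ j) f).1 =ᶠ[nhds x] ((ddx ^ j) g).1 := by
    clear * - h
    induction j with
    | zero => exact h
    | succ j ih => rw [pow_succ']; exact ddx_congr_nhds ih
  rw [h'.self_of_nhds]

/-! ### Integrals against the weight -/

open Filter Topology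

theorem continuous_coe (f : SmoothFun) : Continuous f.1 := (differentiable_coe f).continuous

theorem continuous_w : Continuous w :=
  continuous_iff_continuousAt.2 fun x => (hasDerivAt_w x).continuousAt

theorem toReal_w (x : ℝ) : (ENNReal.ofReal (w x)).toReal = w x := ENNReal.toReal_ofReal (w_pos x).le

theorem integrableOn_wMeasure {s : Set ℝ} (hs : MeasurableSet s) (f : ℝ → ℝ) :
    IntegrableOn f s wMeasure ↔ IntegrableOn (fun x => f x * w x) s := by
  rw [IntegrableOn, wMeasure, restrict_withDensity hs, integrable_withDensity_iff_integrable_smul'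
    continuous_w.measurable.ennreal_ofReal (ae_of_all _ fun _ => ENNReal.ofReal_lt_top)]
  simp only [toReal_w, smul_eq_mul, mul_comm (w _)]
  rfl

theorem setIntegral_wMeasure {s : Set ℝ} (hs : MeasurableSet s) (f : ℝ → ℝ) :
    ∫ x in s, f x ∂wMeasure = ∫ x in s, f x * w x := by
  rw [wMeasure, restrict_withDensity hs, integral_withDensity_eq_integral_toReal_smul
    continuous_w.measurable.ennreal_ofReal (ae_of_all _ fun _ => ENNReal.ofReal_lt_top)]
  simp only [toReal_w, smul_eq_mul, mul_comm (w _)]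

theorem w_le_exp (x : ℝ) : w x ≤ Real.exp (-x ^ 2) :=
  div_le_self (Real.exp_pos _).le (one_le_pow₀ (by nlinarith [sq_nonneg x]))

theorem integrable_pow_mul_exp (k : ℕ) :
    Integrable fun x : ℝ => (1 + |x|) ^ k * Real.exp (-x ^ 2) := by
  have h := (integrable_exp_neg_mul_sq (b := 1 / 2) (by norm_num)).const_mul
    (k.factorial * Real.exp (3 / 2))
  refine h.mono' (Continuous.aestronglyMeasurable (by fun_prop)) (ae_of_all _ fun x => ?_)
  rw [Real.norm_of_nonneg (by positivity)]
  -- `(1 + |x|)^k ≤ k! e^{1 + |x|}` and `|x| ≤ 1/2 + x²/2`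
  have h1 : (1 + |x|) ^ k ≤ k.factorial * Real.exp (1 + |x|) := by
    have := Real.pow_div_factorial_le_exp (1 + |x|) (by positivity) k
    rwa [div_le_iff₀ (by positivity), mul_comm] at this
  refine (mul_le_mul_of_nonneg_right h1 (Real.exp_pos _).le).trans ?_
  rw [mul_assoc, mul_assoc, ← Real.exp_add, ← Real.exp_add]
  refine mul_le_mul_of_nonneg_left (Real.exp_le_exp.2 ?_) (by positivity)
  nlinarith [sq_nonneg (|x| - 1), sq_abs x]

theorem memLp_pow (k : ℕ) : MemLp (fun x : ℝ => (1 + |x|) ^ k) 2 wMeasure := by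
  have hc : Continuous fun x : ℝ => (1 + |x|) ^ k := by fun_prop
  rw [memLp_two_iff_integrable_sq hc.aestronglyMeasurable, ← integrableOn_univ,
    integrableOn_wMeasure MeasurableSet.univ, integrableOn_univ]
  refine (integrable_pow_mul_exp (k * 2)).mono'
    ((Continuous.mul (by fun_prop) continuous_w).aestronglyMeasurable) (ae_of_all _ fun x => ?_)
  rw [Real.norm_of_nonneg (mul_nonneg (by positivity) (w_pos x).le), ← pow_mul]
  exact mul_le_mul_of_nonneg_left (w_le_exp x) (by positivity)

theorem Temp.memLp {f : SmoothFun} (hf : Temp f) : MemLp f.1 2 wMeasure := by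
  obtain ⟨C, k, hC, h⟩ := hf 0 0 le_rfl
  refine ((memLp_pow k).const_mul C).mono (continuous_coe f).aestronglyMeasurable
    (ae_of_all _ fun x => ?_)
  exact (h 0 x).trans (le_abs_self _)

/-! ### The bilinear concomitant -/

/-- The operator `c ↦ c' + (w' / w) c`, so that `(w c)' = w (wDeriv c)`. -/
noncomputable def wDeriv : Module.End ℝ SmoothFun := ddx + mulOp (2 * logDerivSqrtW)

/-- The conjugated derivative `∇` is antisymmetric up to boundary terms. -/
theorem wDeriv_mul (a b : SmoothFun) : wDeriv (a * b) = nab a * b + a * nab b := by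
  simp only [wDeriv, LinearMap.add_apply, mulOp_apply, nab_apply, ddx_mul]
  ring

theorem hasDerivAt_mul_w (c : SmoothFun) (x : ℝ) :
    HasDerivAt (fun x => c.1 x * w x) ((wDeriv c).1 x * w x) x := by
  refine ((hasDerivAt_coe c x).mul (hasDerivAt_w x)).congr_deriv ?_
  change _ = ((ddx c).1 x + 2 * logDerivSqrtW.1 x * c.1 x) * w x
  ring

/-- Half of the bilinear concomitant of the symmetric operator `symForm`: the boundary terms of the
integrations by parts that move `nab` from the first argument to the second. -/
noncomputable def halfConcomitant (N Ω : ℝ) (f g : SmoothFun) : SmoothFun :=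
  g * (f1 N Ω * nab f) +
  (g * nab (f2 N Ω * nab (nab f)) - nab g * (f2 N Ω * nab (nab f))) +
  (g * nab (nab (f3 N Ω * nab (nab (nab f)))) - nab g * nab (f3 N Ω * nab (nab (nab f))) +
    nab (nab g) * (f3 N Ω * nab (nab (nab f))))

/-- Lagrange's identity for `symForm`. -/
theorem wDeriv_concomitant (N Ω : ℝ) (f g : SmoothFun) :
    wDeriv (halfConcomitant N Ω f g - halfConcomitant N Ω g f) =
      symForm N Ω f * g - f * symForm N Ω g := by
  simp only [halfConcomitant, map_sub, map_add, wDeriv_mul, symForm_apply]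
  ring

theorem exists_nab_pow_mul (Ω : ℝ) (k : ℕ) (h : SmoothFun) :
    ∃ h', nab ((idX - const Ω) ^ (k + 1) * h) = (idX - const Ω) ^ k * h' := by
  refine ⟨(k + 1 : ℕ) * h + (idX - const Ω) * nab h, ?_⟩
  rw [nab_mul, ddx_pow, map_sub, ddx_idX, ddx_const, Nat.add_sub_cancel]
  ring

theorem exists_f1_eq (N Ω : ℝ) : ∃ h, f1 N Ω = (idX - const Ω) ^ 1 * h := by
  refine ⟨⟨_, contDiff_div_pow 4 (p := fun x => 3 *
      (16 * Ω ^ 2 * x ^ 12 - 32 * Ω * x ^ 13 + 16 * x ^ 14 + 64 * N * Ω * x ^ 11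
        - 64 * N * x ^ 12 + 64 * N ^ 2 * x ^ 10 + 64 * Ω ^ 2 * x ^ 10 - 160 * Ω * x ^ 11
        + 96 * x ^ 12 + 192 * N * Ω * x ^ 9 - 256 * N * x ^ 10 + 160 * N ^ 2 * x ^ 8
        + 168 * Ω ^ 2 * x ^ 8 - 272 * Ω * x ^ 9 + 72 * x ^ 10 + 416 * N * Ω * x ^ 7
        - 448 * N * x ^ 8 + 160 * N ^ 2 * x ^ 6 + 152 * Ω ^ 2 * x ^ 6 - 192 * Ω * x ^ 7
        - 120 * x ^ 8 + 160 * N * Ω * x ^ 5 - 128 * N * x ^ 6 + 80 * N ^ 2 * x ^ 4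
        - 279 * Ω ^ 2 * x ^ 4 + 334 * Ω * x ^ 5 - 359 * x ^ 6 - 76 * N * Ω * x ^ 3
        + 92 * N * x ^ 4 + 20 * N ^ 2 * x ^ 2 + 1210 * Ω ^ 2 * x ^ 2 - 1662 * Ω * x ^ 3
        + 324 * x ^ 4 - 36 * N * Ω * x + 32 * N * x ^ 2 + 2 * N ^ 2 - 83 * Ω ^ 2
        + 610 * Ω * x - 497 * x ^ 2 - 2 * N + 18)) (by fun_prop)⟩, SmoothFun.ext' fun x => ?_⟩
  rw [coe_mul, coe_pow, coe_sub, coe_idX, coe_const, pow_one, f1, ← mul_div_assoc, ← mul_assoc]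
  ring

theorem exists_f2_eq (N Ω : ℝ) : ∃ h, f2 N Ω = (idX - const Ω) ^ 2 * h := by
  refine ⟨⟨_, contDiff_div_pow 2 (p := fun x => 3 *
      (4 * Ω * x ^ 6 - 4 * x ^ 7 + 8 * N * x ^ 5 + 8 * Ω * x ^ 4 - 12 * x ^ 5
        + 8 * N * x ^ 3 + 21 * Ω * x ^ 2 - 17 * x ^ 3 + 2 * N * x - 7 * Ω + 10 * x))
        (by fun_prop)⟩, SmoothFun.ext' fun x => ?_⟩
  rw [coe_mul, coe_pow, coe_sub, coe_idX, coe_const, f2, ← mul_div_assoc, ← mul_assoc]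
  ring

/-- The coefficient `f_k` vanishes to order `k` at `Ω`, so no boundary condition is needed there. -/
theorem halfConcomitant_apply_self (N Ω : ℝ) (f g : SmoothFun) :
    (halfConcomitant N Ω f g).1 Ω = 0 := by
  obtain ⟨h1, e1⟩ := exists_f1_eq N Ω
  obtain ⟨h2, e2⟩ := exists_f2_eq N Ω
  obtain ⟨h2', e2'⟩ := exists_nab_pow_mul Ω 1 (h2 * nab (nab f))
  obtain ⟨h3, e3⟩ := exists_nab_pow_mul Ω 2 (nab (nab (nab f)))
  obtain ⟨h3', e3'⟩ := exists_nab_pow_mul Ω 1 h3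
  have hz : (idX - const Ω).1 Ω = 0 := sub_self Ω
  simp only [halfConcomitant, e1, e2, f3_eq, mul_assoc, e2', e3, e3', coe_add, coe_sub, coe_mul,
    coe_pow, hz]
  simp

theorem halfConcomitant_eq_zero {N Ω x : ℝ} {f g : SmoothFun} (h : g.1 =ᶠ[𝓝 x] 0) :
    (halfConcomitant N Ω f g).1 x = 0 ∧ (halfConcomitant N Ω g f).1 x = 0 := by
  have step : ∀ {u : SmoothFun}, u.1 =ᶠ[𝓝 x] 0 → (nab u).1 =ᶠ[𝓝 x] 0 := fun {u} hu => by
    have := nab_congr_nhds (f := u) (g := 0) hu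
    rwa [map_zero] at this
  have smul : ∀ {u : SmoothFun} (a : SmoothFun), u.1 =ᶠ[𝓝 x] 0 → (a * u).1 =ᶠ[𝓝 x] 0 :=
    fun {u} a hu => by
      filter_upwards [hu] with y hy
      rw [coe_mul, hy, Pi.zero_apply, mul_zero]
  constructor
  · simp only [halfConcomitant, coe_add, coe_sub, coe_mul, h.self_of_nhds,
      (step h).self_of_nhds, (step (step h)).self_of_nhds, Pi.zero_apply]
    ring
  · have a1 := step h
    have a2 := step a1
    have a3 := step a2
    have b2 := smul (f2 N Ω) a2
    have b3 := smul (f3 N Ω) a3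
    simp only [halfConcomitant, coe_add, coe_sub, coe_mul f, coe_mul (nab f),
      coe_mul (nab (nab f)), (smul (f1 N Ω) a1).self_of_nhds, b2.self_of_nhds,
      (step b2).self_of_nhds, b3.self_of_nhds, (step b3).self_of_nhds,
      (step (step b3)).self_of_nhds, Pi.zero_apply]
    ring

/-! ### Cutoff functions -/

/-- A smooth function that is `0` on `(-∞, -R - 1]` and `1` on `[-R, ∞)`. -/
noncomputable def cutoff (R : ℕ) : SmoothFun :=
  ⟨fun x => Real.smoothTransition (x + (R + 1)), by
    change ContDiff ℝ ∞ _
    exact Real.smoothTransition.contDiff.comp (by fun_prop)⟩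

theorem cutoff_eventuallyEq_zero {R : ℕ} {x : ℝ} (hx : x < -R - 1) :
    (cutoff R).1 =ᶠ[𝓝 x] 0 := by
  filter_upwards [eventually_lt_nhds hx] with y hy
  exact Real.smoothTransition.zero_of_nonpos (by linarith)

theorem cutoff_eventuallyEq_one {R : ℕ} {x : ℝ} (hx : -R < x) : (cutoff R).1 =ᶠ[𝓝 x] 1 := by
  filter_upwards [eventually_gt_nhds hx] with y hy
  exact Real.smoothTransition.one_of_one_le (by linarith)

theorem hasCompactSupport_deriv_smoothTransition :
    HasCompactSupport (deriv Real.smoothTransition) := by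
  refine HasCompactSupport.intro (isCompact_Icc (a := 0) (b := 1)) fun x hx => ?_
  rcases lt_or_ge x 0 with h | h
  · have : Real.smoothTransition =ᶠ[𝓝 x] fun _ => 0 := by
      filter_upwards [eventually_lt_nhds h] with y hy
      exact Real.smoothTransition.zero_of_nonpos hy.le
    rw [this.deriv_eq, deriv_const]
  · have h' : 1 < x := by
      by_contra! h'
      exact hx ⟨h, h'⟩
    have : Real.smoothTransition =ᶠ[𝓝 x] fun _ => 1 := by
      filter_upwards [eventually_gt_nhds h'] with y hy
      exact Real.smoothTransition.one_of_one_le hy.le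
    rw [this.deriv_eq, deriv_const]

theorem hasCompactSupport_iteratedDeriv_smoothTransition (j : ℕ) :
    HasCompactSupport (iteratedDeriv (j + 1) Real.smoothTransition) := by
  induction j with
  | zero => rw [zero_add, iteratedDeriv_one]; exact hasCompactSupport_deriv_smoothTransition
  | succ j ih => rw [iteratedDeriv_succ]; exact ih.deriv

/-- The cutoffs are translates of one function, so their derivatives are bounded uniformly. -/
theorem tempered_cutoff : Tempered cutoff := fun n j _ => by
  have e : ∀ (R : ℕ) (x : ℝ), ((ddx ^ j) (cutoff R)).1 x =
      iteratedDeriv j Real.smoothTransition (x + (R + 1)) := fun R x => by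
    rw [coe_ddx_pow, cutoff, iteratedDeriv_comp_add_const]
  obtain ⟨C, hC⟩ : ∃ C, ∀ x, |iteratedDeriv j Real.smoothTransition x| ≤ C := by
    rcases j with _ | j
    · refine ⟨1, fun x => ?_⟩
      rw [iteratedDeriv_zero, abs_of_nonneg (Real.smoothTransition.nonneg x)]
      exact Real.smoothTransition.le_one x
    · exact Continuous.bounded_above_of_compact_support
        ((Real.smoothTransition.contDiff (n := ⊤)).continuous_iteratedDeriv _
          (by exact_mod_cast le_top)) (hasCompactSupport_iteratedDeriv_smoothTransition j)
  refine ⟨C, 0, (abs_nonneg _).trans (hC 0), fun R x => ?_⟩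
  rw [e, pow_zero, mul_one]
  exact hC _

/-! ### The symmetry of `T` on the half line -/

open Filter Topology

theorem isDiffOp_T (N : ℕ) (Ω : ℝ) : IsDiffOp 6 (T N Ω) := (T_mem_fourierSym N Ω).1

theorem Temp.T {g : SmoothFun} (hg : Temp g) (N Ω : ℝ) : Temp (ExcHermite.T N Ω g) :=
  preservesTempered_T N Ω _ hg

section
variable {N : ℕ} {Ω : ℝ} {f g : SmoothFun}

/-- Integration by parts on `(-∞, Ω)` when the second function vanishes near `-∞`. -/
theorem setIntegral_T_mul_of_eventually_zero
    (hf : MemLp f.1 2 (wMeasure.restrict (Iio Ω)))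
    (hTf : MemLp (T N Ω f).1 2 (wMeasure.restrict (Iio Ω))) (hg : Temp g)
    (h0 : ∀ᶠ x in atBot, g.1 =ᶠ[𝓝 x] 0) :
    ∫ x in Iio Ω, (T N Ω f).1 x * g.1 x ∂wMeasure =
      ∫ x in Iio Ω, f.1 x * (T N Ω g).1 x ∂wMeasure := by
  have i1 : IntegrableOn (fun x => (T N Ω f).1 x * g.1 x) (Iio Ω) wMeasure :=
    hTf.integrable_mul (hg.memLp.restrict _)
  have i2 : IntegrableOn (fun x => f.1 x * (T N Ω g).1 x) (Iio Ω) wMeasure :=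
    hf.integrable_mul ((hg.T N Ω).memLp.restrict _)
  rw [← sub_eq_zero, ← integral_sub i1 i2, setIntegral_wMeasure measurableSet_Iio,
    ← integral_Iic_eq_integral_Iio]
  have i3 := (integrableOn_wMeasure measurableSet_Iio _).1 (i1.sub i2)
  rw [← integrableOn_Iic_iff_integrableOn_Iio] at i3
  simp only [Pi.sub_apply] at i3
  set c := halfConcomitant N Ω f g - halfConcomitant N Ω g f with hc
  have hd : ∀ x, (wDeriv c).1 x = (T N Ω f).1 x * g.1 x - f.1 x * (T N Ω g).1 x := fun x => by
    rw [hc, wDeriv_concomitant, T_eq_symForm]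
    rfl
  rw [integral_Iic_of_hasDerivAt_of_tendsto' (f := fun x => c.1 x * w x) (m := 0)
    (fun x _ => (hasDerivAt_mul_w c x).congr_deriv (by rw [hd])) i3]
  · rw [hc, coe_sub, halfConcomitant_apply_self, halfConcomitant_apply_self]
    simp
  · refine tendsto_const_nhds.congr' ?_
    filter_upwards [h0] with x hx
    rw [hc, coe_sub, (halfConcomitant_eq_zero hx).1, (halfConcomitant_eq_zero hx).2]
    simp

/-- The operator `T` is symmetric on `(-∞, Ω)` as soon as one of the two functions is of temperate
growth and the other one, with its image, is square integrable. -/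
theorem setIntegral_T_mul (hf : MemLp f.1 2 (wMeasure.restrict (Iio Ω)))
    (hTf : MemLp (T N Ω f).1 2 (wMeasure.restrict (Iio Ω))) (hg : Temp g) :
    ∫ x in Iio Ω, (T N Ω f).1 x * g.1 x ∂wMeasure =
      ∫ x in Iio Ω, f.1 x * (T N Ω g).1 x ∂wMeasure := by
  -- dominated convergence along the cut-off functions `cutoff R * g`, which agree with `g` near any
  -- given point once `R` is large
  have key : ∀ {a : SmoothFun} {u : ℕ → SmoothFun} {v : SmoothFun},
      MemLp a.1 2 (wMeasure.restrict (Iio Ω)) → Tempered u →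
      (∀ x, ∀ᶠ R in atTop, (u R).1 x = v.1 x) →
      Tendsto (fun R => ∫ x in Iio Ω, a.1 x * (u R).1 x ∂wMeasure) atTop
        (𝓝 (∫ x in Iio Ω, a.1 x * v.1 x ∂wMeasure)) := by
    intro a u v ha hu huv
    obtain ⟨C, k, hC, h⟩ := hu 0 0 le_rfl
    refine tendsto_integral_of_dominated_convergence (fun x => |a.1 x| * (C * (1 + |x|) ^ k))
      (fun R => ((continuous_coe a).mul (continuous_coe (u R))).aestronglyMeasurable)
      (ha.abs.integrable_mul (((memLp_pow k).const_mul C).restrict _))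
      (fun R => ae_of_all _ fun x => ?_) (ae_of_all _ fun x => ?_)
    · rw [Real.norm_eq_abs, abs_mul]
      exact mul_le_mul_of_nonneg_left (h R x) (abs_nonneg _)
    · refine tendsto_const_nhds.congr' ?_
      filter_upwards [huv x] with R hR
      rw [hR]
  have hu : Tempered fun R => cutoff R * g := tempered_cutoff.mul hg
  have hloc : ∀ x, ∀ᶠ R : ℕ in atTop, (cutoff R * g).1 =ᶠ[𝓝 x] g.1 := fun x => by
    filter_upwards [eventually_gt_atTop ⌈-x⌉₊] with R hR
    have hR' : -x < R := (Nat.le_ceil _).trans_lt (by exact_mod_cast hR)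
    filter_upwards [cutoff_eventuallyEq_one (R := R) (x := x) (by linarith)] with y hy
    rw [coe_mul, hy, Pi.one_apply, one_mul]
  have l1 := key hTf hu fun x => (hloc x).mono fun R hR => hR.self_of_nhds
  have l2 := key hf (preservesTempered_T N Ω _ hu)
    fun x => (hloc x).mono fun R hR => (isDiffOp_T N Ω).congr_nhds hR
  refine tendsto_nhds_unique l1 (l2.congr fun R => ?_)
  refine (setIntegral_T_mul_of_eventually_zero hf hTf
    (fun n => ?_) ?_).symm
  · intro j hj
    obtain ⟨C, k, hC, h⟩ := hu n j hj
    exact ⟨C, k, hC, fun _ x => h R x⟩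
  · filter_upwards [eventually_lt_atBot (-(R : ℝ) - 1)] with x hx
    filter_upwards [cutoff_eventuallyEq_zero hx] with y hy
    rw [coe_mul, hy, Pi.zero_apply, zero_mul]

end

theorem isSymmOn_T (N : ℕ) (Ω : ℝ) : IsSymmOn Ω (T N Ω) := by
  intro f g hf hg
  have hf' := temp_of_hasTemperateGrowth hf
  have hg' := temp_of_hasTemperateGrowth hg
  have h1 : IntegrableOn (fun x => (T N Ω f).1 x * g.1 x) (Iio Ω) wMeasure :=
    ((hf'.T N Ω).memLp.restrict _).integrable_mul (hg'.memLp.restrict _)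
  have h2 := setIntegral_T_mul (hf'.memLp.restrict _) ((hf'.T N Ω).memLp.restrict _) hg'
  rw [integrableOn_wMeasure measurableSet_Iio] at h1
  rw [setIntegral_wMeasure measurableSet_Iio, setIntegral_wMeasure measurableSet_Iio] at h2
  simp only [mul_right_comm _ _ (w _)] at h1 h2
  exact ⟨h1, h2⟩

/-! ### The commutation of `T` and `S` -/

/-- The coefficient of `f` along `q n` in `L²((-∞, Ω), w(x) dx)`. -/
noncomputable def coef (Ω : ℝ) (f : SmoothFun) (n : ℕ) : ℝ :=
  ∫ x in Iio Ω, f.1 x * (q n).1 x ∂wMeasure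

theorem S_eq_sum {N : ℕ} {Ω : ℝ} {f : SmoothFun} (hf : MemLp f.1 2 (wMeasure.restrict (Iio Ω))) :
    (∑ n ∈ Finset.range (N + 1), coef Ω f n • q n).1 = S N Ω f.1 := by
  funext x
  have hi : ∀ n, IntegrableOn (fun y => f.1 y * (q n).1 y) (Iio Ω) wMeasure := fun n =>
    hf.integrable_mul ((temp_q n).memLp.restrict _)
  have e : ∀ y, f.1 y * w y * kernel N x y =
      (∑ n ∈ Finset.range (N + 1), (q n).1 x * (f.1 y * (q n).1 y)) * w y := fun y => by
    rw [kernel, Finset.mul_sum, Finset.sum_mul]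
    exact Finset.sum_congr rfl fun n _ => by ring
  simp only [S, e]
  rw [← setIntegral_wMeasure measurableSet_Iio (fun y => ∑ n ∈ Finset.range (N + 1),
    (q n).1 x * (f.1 y * (q n).1 y)), integral_finsetSum _ fun n _ => (hi n).const_mul _, coe_sum]
  refine Finset.sum_congr rfl fun n _ => ?_
  rw [integral_const_mul, coe_smul, mul_comm, coef]

/-- The image of `S` lies in the span of `q 0, …, q N`, which `T` maps to itself with a symmetric
matrix `M`. The coefficients of `T f` are those of `f` transformed by `M`, because `T` is symmetric
on the half line. -/
theorem commutesWithS_T (N : ℕ) (Ω : ℝ) : CommutesWithS N Ω (T N Ω) := by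
  intro f hf hTf
  refine ⟨_, S_eq_sum hf, ?_⟩
  rw [← S_eq_sum hTf]
  congr 1
  obtain ⟨M, hM, hT⟩ := exists_T_q_eq_sum N Ω
  have hi : ∀ n, IntegrableOn (fun y => f.1 y * (q n).1 y) (Iio Ω) wMeasure := fun n =>
    hf.integrable_mul ((temp_q n).memLp.restrict _)
  have hc : ∀ m ∈ Finset.range (N + 1), coef Ω (T N Ω f) m =
      ∑ n ∈ Finset.range (N + 1), M m n * coef Ω f n := fun m hm => by
    rw [coef, setIntegral_T_mul hf hTf (temp_q m), hT m (by simpa [Nat.lt_succ_iff] using hm)]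
    simp only [coe_sum, coe_smul, Finset.mul_sum, coef, mul_left_comm (f.1 _)]
    rw [integral_finsetSum _ fun n _ => (hi n).const_mul _]
    exact Finset.sum_congr rfl fun n _ => integral_const_mul _ _
  have hR : ∑ m ∈ Finset.range (N + 1), coef Ω (T N Ω f) m • q m =
      ∑ m ∈ Finset.range (N + 1), ∑ n ∈ Finset.range (N + 1), (M m n * coef Ω f n) • q m :=
    Finset.sum_congr rfl fun m hm => by rw [hc m hm, Finset.sum_smul]
  rw [map_sum, hR, Finset.sum_comm]
  refine Finset.sum_congr rfl fun n hn => ?_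
  rw [map_smul, hT n (by simpa [Nat.lt_succ_iff] using hn), Finset.smul_sum]
  exact Finset.sum_congr rfl fun m _ => by rw [smul_smul, hM.apply, mul_comm]

/-! ### Polynomial functions and degrees -/

theorem coe_aeval (p : ℝ[X]) (x : ℝ) : (aeval idX p).1 x = p.eval x := by
  induction p using Polynomial.induction_on' with
  | add p r hp hr => rw [map_add, coe_add, hp, hr, eval_add]
  | monomial n a =>
    rw [aeval_monomial, coe_mul, coe_pow, coe_idX, eval_monomial]
    rfl

theorem aeval_idX_injective : Function.Injective (aeval (R := ℝ) idX) := fun p r h =>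
  Polynomial.funext fun x => by rw [← coe_aeval, h, coe_aeval]

theorem ddx_aeval (p : ℝ[X]) : ddx (aeval idX p) = aeval idX (derivative p) :=
  ddx_eq fun x => by
    have e : (aeval idX p).1 = fun x => p.eval x := funext (coe_aeval p)
    rw [coe_aeval, e]
    exact p.hasDerivAt x

theorem temp_aeval (p : ℝ[X]) : Temp (aeval idX p) := by
  induction p using Polynomial.induction_on' with
  | add p r hp hr => rw [map_add]; exact Tempered.add hp hr
  | monomial n a =>
    rw [aeval_monomial]
    exact (tempered_const a).mul (tempered_idX.pow n)

/-- The Hermite polynomials as formal polynomials. -/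
noncomputable def hermP : ℕ → ℝ[X]
  | 0 => 1
  | n + 1 => C 2 * X * hermP n - derivative (hermP n)

theorem hermiteH_eq_aeval (n : ℕ) : hermiteH n = aeval idX (hermP n) := by
  induction n with
  | zero => rw [hermiteH_zero, hermP, map_one]
  | succ n ih =>
    rw [hermiteH_succ, ih, hermP, map_sub, map_mul, map_mul, aeval_X, ddx_aeval, aeval_C]
    rfl

theorem degree_hermP (n : ℕ) : (hermP n).degree = (n : WithBot ℕ) := by
  induction n with
  | zero => exact degree_one
  | succ n ih =>
    have h : (C 2 * X * hermP n).degree = ((n + 1 : ℕ) : WithBot ℕ) := by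
      rw [degree_mul, ih, degree_C_mul_X (by norm_num)]
      push_cast
      exact add_comm _ _
    rw [hermP, degree_sub_eq_left_of_degree_lt, h]
    rw [h]
    refine (degree_derivative_le).trans_lt ?_
    rw [ih]
    exact_mod_cast Nat.lt_succ_self n

/-- The exceptional Hermite polynomials as formal polynomials. -/
noncomputable def qP (n : ℕ) : ℝ[X] :=
  C (excNorm n / hermNorm n) * (hermP n + C (4 * (n : ℝ)) * hermP (n - 2) +
    C (4 * (n : ℝ) * ((n : ℝ) - 3)) * hermP (n - 4))

theorem q_eq_aeval (n : ℕ) : q n = aeval idX (qP n) := by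
  simp only [q_eq, excRaw, qP, hermiteH_eq_aeval, map_add, map_mul, aeval_C, Algebra.smul_def]

theorem aeval_C_mul_qP (c : ℝ) (n : ℕ) : aeval idX (C c * qP n) = c • q n := by
  rw [q_eq_aeval, map_mul, aeval_C, Algebra.smul_def]

theorem degree_qP {n : ℕ} (hn : n ∉ excDegrees) : (qP n).degree = (n : WithBot ℕ) := by
  have low : ∀ (c : ℝ) (k : ℕ), 0 < k →
      (C ((n : ℝ) * c) * hermP (n - k)).degree < (n : WithBot ℕ) := by
    intro c k hk
    rcases Nat.eq_zero_or_pos n with rfl | h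
    · simp
    · refine ((degree_mul_le _ _).trans (add_le_add_left degree_C_le _)).trans_lt ?_
      rw [degree_hermP, zero_add]
      exact_mod_cast Nat.sub_lt h hk
  rw [qP, degree_C_mul (div_pos (excNorm_pos hn) (hermNorm_pos n)).ne',
    show 4 * (n : ℝ) * ((n : ℝ) - 3) = n * (4 * ((n : ℝ) - 3)) by ring, mul_comm 4 (n : ℝ),
    degree_add_eq_left_of_degree_lt, degree_add_eq_left_of_degree_lt, degree_hermP]
  · rw [degree_hermP]
    exact low _ 2 two_pos
  · rw [degree_add_eq_left_of_degree_lt, degree_hermP]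
    · exact low _ 4 four_pos
    · rw [degree_hermP]
      exact low _ 2 two_pos

theorem qP_ne_zero {n : ℕ} (hn : n ∉ excDegrees) : qP n ≠ 0 := fun h => by
  have := degree_qP hn
  simp [h] at this

theorem qP_eq_zero {n : ℕ} (hn : n ∈ excDegrees) : qP n = 0 := by
  rw [qP, excNorm_eq_zero hn, zero_div, C_0, zero_mul]

theorem natDegree_qP_le (n : ℕ) : (qP n).natDegree ≤ n := by
  by_cases hn : n ∈ excDegrees
  · simp [qP_eq_zero hn]
  · exact (natDegree_eq_of_degree_eq_some (degree_qP hn)).le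

theorem q_eq_zero_iff (n : ℕ) : q n = 0 ↔ n ∈ excDegrees := by
  refine ⟨fun h => ?_, q_eq_zero⟩
  by_contra hn
  rw [q_eq_aeval, ← map_zero (aeval (R := ℝ) idX)] at h
  exact qP_ne_zero hn (aeval_idX_injective h)

theorem exists_T_q_eq_eval (N : ℕ) (Ω : ℝ) {n : ℕ} (hn : n ≤ N) :
    ∃ p : ℝ[X], p.natDegree ≤ N ∧ ∀ x : ℝ, (T N Ω (q n)).1 x = p.eval x := by
  obtain ⟨M, -, hM⟩ := exists_T_q_eq_sum N Ω
  refine ⟨∑ m ∈ Finset.range (N + 1), M n m • qP m, ?_, fun x => ?_⟩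
  · refine natDegree_sum_le_of_forall_le _ _ fun m hm => (natDegree_smul_le _ _).trans ?_
    exact (natDegree_qP_le m).trans (Nat.lt_succ_iff.1 (Finset.mem_range.1 hm))
  · rw [hM n hn, ← coe_aeval, map_sum]
    simp only [map_smul, q_eq_aeval]

/-! ### The span of the exceptional polynomials -/

/-- The polynomial `η = 2 x ^ 2 + 1`. -/
noncomputable def etaP : ℝ[X] := C 2 * X ^ 2 + 1

theorem etaP_dvd_derivative_qP (n : ℕ) : etaP ∣ derivative (qP n) := by
  by_cases hn : n ∈ excDegrees
  · simp [qP_eq_zero hn]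
  have hs : excNorm n * hermNorm n ≠ 0 := (mul_pos (excNorm_pos hn) (hermNorm_pos n)).ne'
  have h : C (excNorm n * hermNorm n) * derivative (qP n) = etaP *
      ((C 2 * X ^ 2 - C (n : ℝ) + 1) * derivative (hermP n) - C 2 * C (n : ℝ) * X * hermP n) := by
    apply aeval_idX_injective
    have h1 := ddx_excP n
    rw [← smul_q, map_smul, q_eq_aeval, excQ, hermiteH_eq_aeval, ddx_aeval, ddx_aeval] at h1
    simp only [etaP, map_mul, map_add, map_sub, map_pow, aeval_X, aeval_C, map_one]
    rw [Algebra.smul_def] at h1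
    exact h1
  refine ⟨C (excNorm n * hermNorm n)⁻¹ * ((C 2 * X ^ 2 - C (n : ℝ) + 1) * derivative (hermP n) -
    C 2 * C (n : ℝ) * X * hermP n), ?_⟩
  rw [mul_left_comm, ← h, ← mul_assoc, ← C_mul, inv_mul_cancel₀ hs, C_1, one_mul]

theorem degree_etaP : etaP.degree = 2 := by
  rw [etaP]
  compute_degree!

/-- The exceptional polynomials span the space of all polynomials `p` such that `η` divides `p'`:
there is one of each degree that occurs in this space. -/
theorem aeval_mem_span_q {p : ℝ[X]} (hp : etaP ∣ derivative p) :
    aeval idX p ∈ Submodule.span ℝ (range q) := by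
  induction hd : p.natDegree using Nat.strong_induction_on generalizing p with
  | _ d ih =>
  by_cases h0 : p = 0
  · rw [h0, map_zero]
    exact Submodule.zero_mem _
  -- degree one or two is impossible: `p'` would be a nonzero multiple of `η` of degree at most one
  have hdX : d ∉ excDegrees := by
    rw [not_mem_excDegrees]
    by_contra! h
    have h1 : derivative p ≠ 0 := fun h' => h.1 (hd.symm.trans (derivative_eq_zero.1 h'))
    have h2 := degree_le_of_dvd hp h1
    rw [degree_etaP] at h2
    have h3 := natDegree_derivative_lt (p := p) (by omega)
    have h4 : 2 ≤ (derivative p).natDegree := by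
      rw [degree_eq_natDegree h1] at h2
      exact_mod_cast h2
    omega
  set c := p.leadingCoeff / (qP d).leadingCoeff
  have hl : (qP d).leadingCoeff ≠ 0 := leadingCoeff_ne_zero.2 (qP_ne_zero hdX)
  have hc : c ≠ 0 := div_ne_zero (leadingCoeff_ne_zero.2 h0) hl
  have hdeg : p.degree = (C c * qP d).degree := by
    rw [degree_C_mul hc, degree_qP hdX, degree_eq_natDegree h0, hd]
  have hlt : (p - C c * qP d).degree < p.degree := by
    refine degree_sub_lt_left hdeg h0 ?_
    rw [leadingCoeff_mul, leadingCoeff_C, div_mul_cancel₀ _ hl]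
  have hr : aeval idX (p - C c * qP d) ∈ Submodule.span ℝ (range q) := by
    by_cases hz : p - C c * qP d = 0
    · rw [hz, map_zero]
      exact Submodule.zero_mem _
    · refine ih _ ((natDegree_lt_natDegree hz hlt).trans_eq hd) ?_ rfl
      rw [derivative_sub, derivative_C_mul]
      exact dvd_sub hp ((etaP_dvd_derivative_qP d).mul_left _)
  have e : aeval idX p = aeval idX (p - C c * qP d) + c • q d := by
    rw [← aeval_C_mul_qP, ← map_add, sub_add_cancel]
  rw [e]
  exact Submodule.add_mem _ hr
    (Submodule.smul_mem _ c (Submodule.subset_span (mem_range_self d)))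

theorem etaP_sq_mul_mem_span_q (p : ℝ[X]) :
    aeval idX (etaP ^ 2 * p) ∈ Submodule.span ℝ (range q) := by
  refine aeval_mem_span_q ⟨2 * derivative etaP * p + etaP * derivative p, ?_⟩
  rw [derivative_mul, sq, derivative_mul]
  ring

/-! ### Orthonormality -/

/-- The inner product of `L²(ℝ, w(x) dx)` on smooth functions. -/
noncomputable def ip (f g : SmoothFun) : ℝ := ∫ x, f.1 x * g.1 x ∂wMeasure

theorem ip_comm (f g : SmoothFun) : ip f g = ip g f := by
  simp only [ip, mul_comm]

theorem ip_smul_left (c : ℝ) (f g : SmoothFun) : ip (c • f) g = c * ip f g := by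
  simp only [ip, coe_smul, mul_assoc, integral_const_mul]

theorem Temp.integrable_mul {f g : SmoothFun} (hf : Temp f) (hg : Temp g) :
    Integrable (fun x => f.1 x * g.1 x) wMeasure := hf.memLp.integrable_mul hg.memLp

theorem integrable_wMeasure (f : ℝ → ℝ) :
    Integrable f wMeasure ↔ Integrable fun x => f x * w x := by
  rw [← integrableOn_univ, integrableOn_wMeasure MeasurableSet.univ, integrableOn_univ]

theorem integral_wMeasure (f : ℝ → ℝ) : ∫ x, f x ∂wMeasure = ∫ x, f x * w x := by
  rw [← setIntegral_univ, setIntegral_wMeasure MeasurableSet.univ, setIntegral_univ]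

theorem Temp.integrable {f : SmoothFun} (hf : Temp f) : Integrable f.1 wMeasure := by
  simpa using hf.integrable_mul (tempered_const 1)

theorem Temp.integral_wDeriv {c : SmoothFun} (hc : Temp c) : ∫ x, (wDeriv c).1 x ∂wMeasure = 0 := by
  have h : Temp (wDeriv c) :=
    Tempered.add (Tempered.ddx hc) (((tempered_ofNat 2).mul tempered_logDerivSqrtW).mul hc)
  rw [integral_wMeasure]
  exact integral_eq_zero_of_hasDerivAt_of_integrable (hasDerivAt_mul_w c)
    ((integrable_wMeasure _).1 h.integrable) ((integrable_wMeasure _).1 hc.integrable)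

/-- An operator that is symmetric in `L²(ℝ, w(x) dx)` on functions of temperate growth. -/
def SymmTemp (D : Module.End ℝ SmoothFun) : Prop :=
  ∀ f g : SmoothFun, Temp f → Temp g → ip (D f) g = ip f (D g)

theorem symmTemp_of_wDeriv {D : Module.End ℝ SmoothFun} (hD : PreservesTempered D)
    (c : SmoothFun → SmoothFun → SmoothFun) (hc : ∀ f g, Temp f → Temp g → Temp (c f g))
    (h : ∀ f g, wDeriv (c f g) = D f * g - f * D g) : SymmTemp D := by
  intro f g hf hg
  have h0 := (hc f g hf hg).integral_wDeriv
  rw [h] at h0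
  simp only [coe_sub, coe_mul] at h0
  rwa [integral_sub (Temp.integrable_mul (hD _ hf) hg) (Temp.integrable_mul hf (hD _ hg)),
    sub_eq_zero] at h0

theorem symmTemp_D0 : SymmTemp D0 := by
  refine symmTemp_of_wDeriv preservesTempered_D0 (fun f g => nab f * g - f * nab g)
    (fun f g hf hg => (Tempered.mul (Tempered.nab hf) hg).sub (Tempered.mul hf (Tempered.nab hg)))
    fun f g => ?_
  simp only [map_sub, wDeriv_mul, D0_apply]
  ring

theorem symmTemp_D1 : SymmTemp D1 := by
  refine symmTemp_of_wDeriv preservesTempered_D1 (fun f g => (idX * nab f) * g - f * (idX * nab g))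
    (fun f g hf hg => ((tempered_idX.mul (Tempered.nab hf)).mul hg).sub
      (Tempered.mul hf (tempered_idX.mul (Tempered.nab hg))))
    fun f g => ?_
  simp only [map_sub, wDeriv_mul, nab_mul, ddx_idX, D1_apply]
  ring

theorem symmTemp_D3 : SymmTemp D3 := by
  intro f g _ _
  simp only [D3_apply, ip, coe_smul, coe_mul]
  congr 1
  funext x
  ring

/-- Eigenfunctions of `D0` for distinct eigenvalues are orthogonal. -/
theorem ip_q_of_ne {n m : ℕ} (h : n ≠ m) : ip (q n) (q m) = 0 := by
  have h1 := symmTemp_D0 _ _ (temp_q n) (temp_q m)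
  rw [D0_q, D0_q, ip_smul_left, ip_comm _ (_ • _), ip_smul_left, ip_comm (q m)] at h1
  have h2 : ((m : ℝ) - n) * ip (q n) (q m) = 0 := by linarith
  rcases mul_eq_zero.1 h2 with h3 | h3
  · exact absurd (by exact_mod_cast (sub_eq_zero.1 h3).symm) h
  · exact h3

theorem ip_sum_q (s : Finset ℕ) (c : ℕ → ℝ) (m : ℕ) (hm : m ∉ s → c m = 0) :
    ip (∑ k ∈ s, c k • q k) (q m) = c m * ip (q m) (q m) := by
  have e : ip (∑ k ∈ s, c k • q k) (q m) = ∑ k ∈ s, c k * ip (q k) (q m) := by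
    simp only [ip, coe_sum, coe_smul, Finset.sum_mul, mul_assoc]
    rw [integral_finsetSum _ fun k _ => ((temp_q k).integrable_mul (temp_q m)).const_mul _]
    simp only [integral_const_mul]
  rw [e, Finset.sum_eq_single m]
  · exact fun k _ hk => by rw [ip_q_of_ne hk, mul_zero]
  · exact fun h => by rw [hm h, zero_mul]

/-- The matrix entries of an operator that intertwines. -/
theorem Intertwines.ip_eq {D : Module.End ℝ SmoothFun} {L : Matrix ℕ ℕ ℝ} (h : Intertwines D L)
    (n m : ℕ) : ip (D (q n)) (q m) = L n m * ip (q m) (q m) := by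
  rw [h.2.2 n, diffceApply, ip_sum_q _ _ _ fun hm => h.2.1 n m ?_]
  simp only [Finset.mem_Icc] at hm
  omega

/-- A nonzero matrix entry of a symmetric operator forces equality of the two norms. -/
theorem Intertwines.ip_self_eq {D : Module.End ℝ SmoothFun} {L : Matrix ℕ ℕ ℝ}
    (h : Intertwines D L) (hD : SymmTemp D) {n m : ℕ} (hL : L n m ≠ 0) :
    ip (q n) (q n) = ip (q m) (q m) := by
  have h1 := hD _ _ (temp_q n) (temp_q m)
  rw [h.ip_eq, ip_comm (q n), h.ip_eq, h.1.apply] at h1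
  exact (mul_left_cancel₀ ((h.1.apply n m).trans_ne hL) h1).symm

theorem ip_q_zero : ip (q 0) (q 0) = 1 := by
  have hη : Temp ((2 * idX ^ 2 + 1 : SmoothFun) ^ 2) :=
    (((tempered_ofNat 2).mul (tempered_idX.pow 2)).add (tempered_const 1)).pow 2
  -- the antiderivative `x e^{-x²} / η` of `2 w - e^{-x²}`
  have h1 : wDeriv (idX * (2 * idX ^ 2 + 1)) = 2 - (2 * idX ^ 2 + 1) ^ 2 := by
    ext x
    simp only [wDeriv, logDerivSqrtW, LinearMap.add_apply, mulOp_apply, ddx_mul, ddx_idX, ddx_pow,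
      map_add, ddx_ofNat, ddx_one, coe_add, coe_mul, coe_sub, coe_neg, coe_ofNat, coe_idX,
      coe_invEta, coe_pow, coe_one, coe_natCast, coe_zero]
    have : (2 * x ^ 2 + 1 : ℝ) ≠ 0 := by positivity
    field_simp
    push_cast
    ring
  have h2 := Temp.integral_wDeriv (c := idX * (2 * idX ^ 2 + 1))
    (tempered_idX.mul (((tempered_ofNat 2).mul (tempered_idX.pow 2)).add (tempered_const 1)))
  rw [h1] at h2
  have h3 : ∫ x, ((2 * idX ^ 2 + 1 : SmoothFun) ^ 2).1 x ∂wMeasure = √Real.pi := by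
    have h4 := integral_gaussian 1
    rw [div_one] at h4
    rw [← h4, integral_wMeasure]
    congr 1
    funext x
    simp only [coe_pow, coe_add, coe_mul, coe_ofNat, coe_idX, coe_one, w]
    rw [add_comm (2 * x ^ 2), mul_div_cancel₀ _ (by positivity), neg_one_mul]
  have h5 : ∫ x, (2 - (2 * idX ^ 2 + 1) ^ 2 : SmoothFun).1 x ∂wMeasure =
      2 * ∫ x, (1 : ℝ) ∂wMeasure - √Real.pi := by
    rw [← h3, ← integral_const_mul, ← integral_sub _ hη.integrable]
    · simp only [coe_sub, coe_ofNat, mul_one]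
    · exact (Temp.integrable (f := 1) (tempered_const 1)).const_mul 2
  rw [h5] at h2
  have h6 : q 0 = const (√2 / Real.pi ^ (1 / 4 : ℝ)) := by
    ext x
    simp [q_eq, excRaw, excNorm, hermNorm, hermiteH_zero]
  have h7 : (Real.pi ^ (1 / 4 : ℝ)) ^ 2 = √Real.pi := by
    rw [Real.sqrt_eq_rpow, ← Real.rpow_natCast, ← Real.rpow_mul Real.pi_pos.le]
    norm_num
  simp only [ip, h6, coe_const]
  rw [integral_wMeasure] at h2 ⊢
  rw [integral_const_mul, ← sq, div_pow, Real.sq_sqrt zero_le_two, h7]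
  simp only [one_mul] at h2
  have h8 : √Real.pi ≠ 0 := (Real.sqrt_pos.2 Real.pi_pos).ne'
  field_simp
  linarith

/-- The entries of `L₁` link the norms of all `q n`, `n ≥ 3`, and the entry `(0, 3)` of `L₃` links
them to that of the constant `q 0`. -/
theorem ip_q_self {n : ℕ} (hn : n ∉ excDegrees) : ip (q n) (q n) = 1 := by
  rcases not_mem_excDegrees.1 hn with rfl | h3
  · exact ip_q_zero
  clear hn
  induction n, h3 using Nat.le_induction with
  | base =>
    rw [← ip_q_zero]
    refine (Intertwines.ip_self_eq (intertwines_Y 4) symmTemp_D3 ?_).symm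
    change L3 0 3 ≠ 0
    norm_num [L3]
  | succ n hn ih =>
    rw [← ih]
    refine (Intertwines.ip_self_eq (intertwines_Y 2) symmTemp_D1 ?_).symm
    change L1 n (n + 1) ≠ 0
    have h3 : (3 : ℝ) ≤ n := by exact_mod_cast hn
    have a1 : 0 < √((n : ℝ) + 1) := Real.sqrt_pos.2 (by linarith)
    have a2 : 0 < √((n : ℝ) - 2) := Real.sqrt_pos.2 (by linarith)
    have a3 : 0 < √(n : ℝ) := Real.sqrt_pos.2 (by linarith)
    simp only [L1, show ¬ n + 1 + 1 = n by omega, if_false, if_true]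
    exact (neg_neg_of_pos (by positivity)).ne

/-! ### Completeness -/

open ProbabilityTheory

/-- A finite measure on the line with exponential moments of all orders is determined by its
moments: the moments are the Taylor coefficients of its entire moment generating function. -/
theorem ext_of_moments {μ ν : Measure ℝ} [IsFiniteMeasure μ] [IsFiniteMeasure ν]
    (hμ : ∀ t, Integrable (fun x => Real.exp (t * x)) μ)
    (hν : ∀ t, Integrable (fun x => Real.exp (t * x)) ν)
    (h : ∀ n : ℕ, ∫ x, x ^ n ∂μ = ∫ x, x ^ n ∂ν) : μ = ν := by
  have hμ' : integrableExpSet id μ = univ := eq_univ_of_forall hμ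
  have hν' : integrableExpSet id ν = univ := eq_univ_of_forall hν
  have aμ : AnalyticOnNhd ℝ (mgf id μ) univ := by
    simpa [hμ'] using analyticOnNhd_mgf (X := id) (μ := μ)
  have aν : AnalyticOnNhd ℝ (mgf id ν) univ := by
    simpa [hν'] using analyticOnNhd_mgf (X := id) (μ := ν)
  have p1 := hasFPowerSeriesAt_mgf (X := id) (μ := μ) (v := 0) (by simp [hμ'])
  have p2 := hasFPowerSeriesAt_mgf (X := id) (μ := ν) (v := 0) (by simp [hν'])
  simp only [id, zero_mul, Real.exp_zero, mul_one, h] at p1 p2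
  have hmgf : mgf id μ = mgf id ν := by
    refine aμ.eq_of_eventuallyEq aν (z₀ := 0) ?_
    have p3 := p1.sub p2
    rw [sub_self] at p3
    filter_upwards [p3.eventually_eq_zero] with z hz
    exact sub_eq_zero.1 hz
  refine Measure.ext_of_complexMGF_id_eq (funext fun z => ?_)
  refine eqOn_complexMGF_of_mgf' hmgf ?_ (by simp [hμ'])
  have e : μ.real univ = ν.real univ := by simpa using h 0
  rw [measureReal_def, measureReal_def,
    ENNReal.toReal_eq_toReal_iff' (measure_ne_top _ _) (measure_ne_top _ _)] at e
  rw [← Measure.measure_univ_eq_zero, e, Measure.measure_univ_eq_zero]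

/-- If `h` is integrable against all exponentials and all its moments vanish, then `h` vanishes
almost everywhere. -/
theorem ae_eq_zero_of_moments {μ : Measure ℝ} {h : ℝ → ℝ}
    (hexp : ∀ t, Integrable (fun x => Real.exp (t * x) * h x) μ)
    (hpow : ∀ n : ℕ, Integrable (fun x => x ^ n * h x) μ)
    (h0 : ∀ n : ℕ, ∫ x, x ^ n * h x ∂μ = 0) : h =ᵐ[μ] 0 := by
  have hi : Integrable h μ := by simpa using hpow 0
  have key : ∀ {u : ℝ → ℝ}, Integrable u μ →
      IsFiniteMeasure (μ.withDensity fun x => ENNReal.ofReal (u x)) := fun hu =>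
    isFiniteMeasure_withDensity_ofReal hu.2
  have := key hi
  have := key hi.neg
  have hm : AEMeasurable (fun x => ENNReal.ofReal (h x)) μ := hi.aemeasurable.ennreal_ofReal
  have cv : ∀ {u : ℝ → ℝ}, Integrable u μ → ∀ g : ℝ → ℝ, Continuous g →
      Integrable (fun x => g x * u x) μ →
      Integrable g (μ.withDensity fun x => ENNReal.ofReal (u x)) ∧
      ∫ x, g x ∂(μ.withDensity fun x => ENNReal.ofReal (u x)) = ∫ x, g x * max (u x) 0 ∂μ := by
    intro u hu g hg hgu
    have hm := hu.aemeasurable.ennreal_ofReal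
    have hfin : ∀ᵐ x ∂μ, ENNReal.ofReal (u x) < ⊤ := ae_of_all _ fun _ => ENNReal.ofReal_lt_top
    constructor
    · rw [integrable_withDensity_iff_integrable_smul₀' hm hfin]
      refine hgu.mono (hm.ennreal_toReal.aestronglyMeasurable.smul hg.aestronglyMeasurable)
        (ae_of_all _ fun x => ?_)
      rw [ENNReal.toReal_ofReal', smul_eq_mul, norm_mul, norm_mul, mul_comm]
      refine mul_le_mul_of_nonneg_left ?_ (norm_nonneg _)
      rw [Real.norm_of_nonneg (le_max_right _ _)]
      exact max_le (le_abs_self _) (abs_nonneg _)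
    · rw [integral_withDensity_eq_integral_toReal_smul₀ hm hfin]
      simp only [ENNReal.toReal_ofReal', smul_eq_mul, mul_comm (g _)]
  have hneg : ∀ {g : ℝ → ℝ}, Integrable (fun x => g x * h x) μ →
      Integrable (fun x => g x * (-h) x) μ := fun hg => by
    refine hg.neg.congr (ae_of_all _ fun x => ?_)
    simp only [Pi.neg_apply, mul_neg]
  -- the positive and the negative part of `h` define measures with the same moments
  have e : (μ.withDensity fun x => ENNReal.ofReal (h x)) =
      μ.withDensity fun x => ENNReal.ofReal ((-h) x) := by
    refine ext_of_moments
      (fun t => (cv hi _ (by fun_prop) (hexp t)).1)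
      (fun t => (cv hi.neg _ (by fun_prop) (hneg (hexp t))).1) fun n => ?_
    rw [(cv hi (fun x => x ^ n) (by fun_prop) (hpow n)).2,
      (cv hi.neg (fun x => x ^ n) (by fun_prop) (hneg (hpow n))).2, ← sub_eq_zero]
    have i1 : Integrable (fun x => x ^ n * max (h x) 0) μ := by
      refine (hpow n).mono ((Continuous.aestronglyMeasurable (by fun_prop)).mul
        (hi.aestronglyMeasurable.sup aestronglyMeasurable_const)) (ae_of_all _ fun x => ?_)
      rw [norm_mul, norm_mul, Real.norm_of_nonneg (le_max_right _ _)]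
      exact mul_le_mul_of_nonneg_left (max_le (le_abs_self _) (abs_nonneg _)) (norm_nonneg _)
    have i2 : Integrable (fun x => x ^ n * max ((-h) x) 0) μ := by
      refine (hpow n).mono ((Continuous.aestronglyMeasurable (by fun_prop)).mul
        (hi.neg.aestronglyMeasurable.sup aestronglyMeasurable_const)) (ae_of_all _ fun x => ?_)
      rw [norm_mul, norm_mul, Real.norm_of_nonneg (le_max_right _ _)]
      exact mul_le_mul_of_nonneg_left (max_le (neg_le_abs _) (abs_nonneg _)) (norm_nonneg _)
    rw [← integral_sub i1 i2]
    refine Eq.trans ?_ (h0 n)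
    congr 1
    funext x
    rw [← mul_sub, Pi.neg_apply]
    congr 1
    rcases le_total 0 (h x) with hx | hx
    · rw [max_eq_left hx, max_eq_right (by linarith), sub_zero]
    · rw [max_eq_right hx, max_eq_left (by linarith), zero_sub, neg_neg]
  rw [withDensity_eq_iff hm hi.neg.aemeasurable.ennreal_ofReal] at e
  · filter_upwards [e] with x hx
    have h1 := congrArg ENNReal.toReal hx
    rw [ENNReal.toReal_ofReal', ENNReal.toReal_ofReal', Pi.neg_apply] at h1
    rcases lt_trichotomy (h x) 0 with h2 | h2 | h2
    · rw [max_eq_right h2.le, max_eq_left (by linarith)] at h1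
      linarith
    · exact h2
    · rw [max_eq_left h2.le, max_eq_right (by linarith)] at h1
      linarith
  · exact (hi.lintegral_lt_top).ne

theorem memLp_exp_mul_eta_sq (t : ℝ) :
    MemLp (fun x : ℝ => Real.exp (t * x) * (2 * x ^ 2 + 1) ^ 2) 2 wMeasure := by
  have hc : Continuous fun x : ℝ => Real.exp (t * x) * (2 * x ^ 2 + 1) ^ 2 := by fun_prop
  rw [memLp_two_iff_integrable_sq hc.aestronglyMeasurable, integrable_wMeasure]
  refine ((integrable_exp_neg_mul_sq (b := 3 / 8) (by norm_num)).const_mul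
    (512 * Real.exp (1 / 16 + 2 * t ^ 2))).mono'
    ((hc.pow 2).mul continuous_w).aestronglyMeasurable (ae_of_all _ fun x => ?_)
  rw [Real.norm_of_nonneg (mul_nonneg (by positivity) (w_pos x).le)]
  have e : (Real.exp (t * x) * (2 * x ^ 2 + 1) ^ 2) ^ 2 * w x =
      (2 * x ^ 2 + 1) ^ 2 * Real.exp (2 * (t * x) + -x ^ 2) := by
    have : (1 + 2 * x ^ 2 : ℝ) ≠ 0 := by positivity
    rw [w, Real.exp_add, two_mul (t * x), Real.exp_add]
    field_simp
    ring
  have h1 : (2 * x ^ 2 + 1) ^ 2 ≤ 512 * Real.exp ((2 * x ^ 2 + 1) / 16) := by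
    have := Real.pow_div_factorial_le_exp ((2 * x ^ 2 + 1) / 16) (by positivity) 2
    norm_num at this
    linarith
  -- the exponents: `1/16 + x²/8 + 2 t x - x² ≤ 1/16 + 2 t² - 3/8 x²`
  rw [e]
  refine (mul_le_mul_of_nonneg_right h1 (Real.exp_pos _).le).trans ?_
  rw [mul_assoc, mul_assoc, ← Real.exp_add, ← Real.exp_add]
  refine mul_le_mul_of_nonneg_left (Real.exp_le_exp.2 ?_) (by norm_num)
  nlinarith [sq_nonneg (x - 2 * t)]

/-- A square integrable function orthogonal to all exceptional polynomials is orthogonal to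
`η² x^n` for all `n`, so all moments of `f η²` vanish. -/
theorem ae_eq_zero_of_orthogonal {f : ℝ → ℝ} (hf : MemLp f 2 wMeasure)
    (h : ∀ n, ∫ x, (q n).1 x * f x ∂wMeasure = 0) : f =ᵐ[wMeasure] 0 := by
  have hspan : ∀ u ∈ Submodule.span ℝ (range q), Temp u ∧ ∫ x, u.1 x * f x ∂wMeasure = 0 := by
    intro u hu
    induction hu using Submodule.span_induction with
    | mem u hu =>
      obtain ⟨n, rfl⟩ := hu
      exact ⟨temp_q n, h n⟩
    | zero => exact ⟨tempered_zero, by simp⟩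
    | add u v _ _ hu hv =>
      refine ⟨Tempered.add hu.1 hv.1, ?_⟩
      simp only [coe_add, add_mul]
      have i1 : Integrable (fun x => u.1 x * f x) wMeasure := hu.1.memLp.integrable_mul hf
      have i2 : Integrable (fun x => v.1 x * f x) wMeasure := hv.1.memLp.integrable_mul hf
      rw [integral_add i1 i2, hu.2, hv.2, add_zero]
    | smul c u _ hu =>
      refine ⟨Tempered.smul hu.1 c, ?_⟩
      simp only [coe_smul, mul_assoc]
      rw [integral_const_mul, hu.2, mul_zero]
  have hη : ∀ n x, x ^ n * ((2 * x ^ 2 + 1) ^ 2 * f x) =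
      (aeval idX (etaP ^ 2 * X ^ n)).1 x * f x := fun n x => by
    rw [coe_aeval]
    simp only [etaP, eval_mul, eval_pow, eval_add, eval_C, eval_X, eval_one]
    ring
  have h0 : (fun x => (2 * x ^ 2 + 1) ^ 2 * f x) =ᵐ[wMeasure] 0 := by
    refine ae_eq_zero_of_moments (fun t => ?_) (fun n => ?_) fun n => ?_
    · simp only [← mul_assoc]
      exact (memLp_exp_mul_eta_sq t).integrable_mul hf
    · simp only [hη]
      exact (temp_aeval _).memLp.integrable_mul hf
    · simp only [hη]
      exact (hspan _ (etaP_sq_mul_mem_span_q _)).2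
  filter_upwards [h0] with x hx
  exact (mul_eq_zero.1 hx).resolve_left (by positivity)

/-- The exceptional polynomial of degree `n` as an element of `L²(ℝ, w(x) dx)`. -/
noncomputable def qLp (n : {n : ℕ // n ∉ excDegrees}) : Lp ℝ 2 wMeasure :=
  (temp_q (n : ℕ)).memLp.toLp

theorem coeFn_qLp (n : {n : ℕ // n ∉ excDegrees}) : qLp n =ᵐ[wMeasure] (q (n : ℕ)).1 :=
  MemLp.coeFn_toLp _

theorem orthonormal_qLp : Orthonormal ℝ qLp := by
  classical
  rw [orthonormal_iff_ite]
  intro n m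
  have e : inner ℝ (qLp n) (qLp m) = ip (q n) (q m) := by
    rw [L2.inner_def]
    refine integral_congr_ae ?_
    filter_upwards [coeFn_qLp n, coeFn_qLp m] with x hn hm
    rw [hn, hm, RCLike.inner_apply, conj_trivial, mul_comm]
  rw [e]
  split_ifs with h
  · rw [h, ip_q_self m.2]
  · exact ip_q_of_ne fun h' => h (Subtype.ext h')

theorem orthogonal_span_qLp : (Submodule.span ℝ (range qLp))ᗮ = ⊥ := by
  rw [eq_bot_iff]
  intro f hf
  rw [Submodule.mem_orthogonal] at hf
  rw [Submodule.mem_bot, Lp.eq_zero_iff_ae_eq_zero]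
  refine ae_eq_zero_of_orthogonal (Lp.memLp f) fun n => ?_
  by_cases hn : n ∈ excDegrees
  · simp [q_eq_zero hn]
  · have h := hf _ (Submodule.subset_span (mem_range_self ⟨n, hn⟩))
    rw [L2.inner_def] at h
    rw [← h]
    refine integral_congr_ae ?_
    filter_upwards [coeFn_qLp ⟨n, hn⟩] with x hx
    rw [hx, RCLike.inner_apply, conj_trivial, mul_comm]

/-! ### Linear independence of the fourteen operators -/

/-- The difference operators of the fourteen operators are linearly independent, even when only the
rows and columns of nonzero polynomials are considered. -/
theorem eq_zero_of_sum_Ymat {c : Fin 14 → ℝ}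
    (hent : ∀ n m, m ∉ excDegrees → ∑ i, c i * Ymat i n m = 0) : c = 0 := by
  have hX : ∀ n, 3 ≤ n → n ∉ excDegrees := fun n hn => not_mem_excDegrees.2 (.inr hn)
  -- the entries three places above the diagonal
  have u3 : ∀ n : ℕ, 3 ≤ n → c 4 + c 8 * (eig n + eig (n + 3)) +
      c 9 * (eig n ^ 2 + eig (n + 3) ^ 2) + c 11 * (eig n ^ 3 + eig (n + 3) ^ 3) = 0 := by
    intro n hn
    have h := hent n (n + 3) (hX _ (by omega))
    rw [sum_Ymat_add_three] at h
    refine (mul_eq_zero.1 h).resolve_right (ne_of_gt ?_)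
    have := three_le_cast hn
    rw [L3, if_neg (by omega), if_neg (by omega), if_neg (by omega), if_pos rfl]
    exact mul_pos (by positivity) (Real.sqrt_pos.2
      (mul_pos (mul_pos (by linarith) (by linarith)) (by linarith)))
  have a3 := u3 3 (by norm_num)
  have a4 := u3 4 (by norm_num)
  have a5 := u3 5 (by norm_num)
  have a6 := u3 6 (by norm_num)
  norm_num [eig] at a3 a4 a5 a6
  have z4 : c 4 = 0 := by linarith
  have z8 : c 8 = 0 := by linarith
  have z9 : c 9 = 0 := by linarith
  have z11 : c 11 = 0 := by linarith
  -- the entries two places above the diagonal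
  have u2 : ∀ n : ℕ, 3 ≤ n →
      c 3 + 112 * (n + 1) * (c 7 + c 13 * (eig n + eig (n + 2))) = 0 := fun n hn => by
    have h := hent n (n + 2) (hX _ (by omega))
    rw [sum_Ymat_add_two _ hn] at h
    refine (mul_eq_zero.1 h).resolve_right (ne_of_gt ?_)
    have := three_le_cast hn
    rw [L2, if_neg (by omega), if_neg (by omega), if_pos rfl]
    exact div_pos (Real.sqrt_pos.2 (mul_pos (mul_pos (mul_pos (by linarith) (by linarith))
      (by linarith)) (by linarith))) (by norm_num)
  have b3 := u2 3 (by norm_num)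
  have b4 := u2 4 (by norm_num)
  have b5 := u2 5 (by norm_num)
  norm_num [eig] at b3 b4 b5
  have z3 : c 3 = 0 := by linarith
  have z7 : c 7 = 0 := by linarith
  have z13 : c 13 = 0 := by linarith
  -- the entries next to the diagonal
  have u1 : ∀ n : ℕ, 3 ≤ n → c 2 + c 10 * (eig n + eig (n + 1)) +
      c 12 * (eig n ^ 2 + eig (n + 1) ^ 2) = 0 := fun n hn => by
    have h := hent n (n + 1) (hX _ (by omega))
    rw [sum_Ymat_add_one _ hn, z4, z8, z9, z11] at h
    have h' := (mul_eq_zero.1 h).resolve_right (ne_of_gt ?_)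
    · linarith
    have := three_le_cast hn
    rw [L3, if_neg (by omega), if_neg (by omega), if_pos rfl]
    exact Real.sqrt_pos.2 (mul_pos (by positivity) (by linarith))
  have d3 := u1 3 (by norm_num)
  have d4 := u1 4 (by norm_num)
  have d5 := u1 5 (by norm_num)
  norm_num [eig] at d3 d4 d5
  have z2 : c 2 = 0 := by linarith
  have z10 : c 10 = 0 := by linarith
  have z12 : c 12 = 0 := by linarith
  -- the diagonal
  have u0 : ∀ n : ℕ, 3 ≤ n → c 0 + c 1 * eig n + c 5 * eig n ^ 2 + c 6 * eig n ^ 3 = 0 :=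
    fun n hn => by
    have h := hent n n (hX _ hn)
    have e : ∑ i, c i * Ymat i n n = c 0 * diagMat 0 n n + c 1 * diagMat 1 n n +
        c 5 * diagMat 2 n n + c 6 * diagMat 3 n n := by
      simp only [Fin.sum_univ_succ, Fin.sum_univ_zero, add_zero, ← add_assoc]
      have : c (Fin.succ 0) = c 1 := rfl
      simp [Fin.succ, z2, z3, z4, z7, z8, z9, z10, z11, z12, z13]
      rfl
    rw [e] at h
    simpa [diagMat] using h
  have g3 := u0 3 (by norm_num)
  have g4 := u0 4 (by norm_num)
  have g5 := u0 5 (by norm_num)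
  have g6 := u0 6 (by norm_num)
  norm_num [eig] at g3 g4 g5 g6
  have z0 : c 0 = 0 := by linarith
  have z1 : c 1 = 0 := by linarith
  have z5 : c 5 = 0 := by linarith
  have z6 : c 6 = 0 := by linarith
  funext i
  fin_cases i <;> assumption

/-- The inner product recovers the difference operator from the operator. -/
theorem ip_sum_Y_q (c : Fin 14 → ℝ) (n : ℕ) {m : ℕ} (hm : m ∉ excDegrees) :
    ip ((∑ i, c i • Y i) (q n)) (q m) = ∑ i, c i * Ymat i n m := by
  have hi : ∀ i, Integrable (fun x => (Y i (q n)).1 x * (q m).1 x) wMeasure := fun i =>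
    Temp.integrable_mul (preservesTempered_Y i _ (temp_q n)) (temp_q m)
  simp only [LinearMap.sum_apply, LinearMap.smul_apply, ip, coe_sum, coe_smul, Finset.sum_mul,
    mul_assoc]
  rw [integral_finsetSum _ fun i _ => (hi i).const_mul _]
  refine Finset.sum_congr rfl fun i _ => ?_
  rw [integral_const_mul]
  have := (intertwines_Y i).ip_eq n m
  rw [ip_q_self hm, mul_one] at this
  rw [← this, ip]

theorem linearIndependent_Y : LinearIndependent ℝ Y := by
  rw [Fintype.linearIndependent_iffₛ]
  intro c d h i
  refine sub_eq_zero.1 (congrFun (eq_zero_of_sum_Ymat (c := c - d) fun n m hm => ?_) i)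
  simp only [Pi.sub_apply, sub_mul, Finset.sum_sub_distrib]
  rw [← ip_sum_Y_q c n hm, ← ip_sum_Y_q d n hm, h, sub_self]

end ExcHermite

open ExcHermite in
theorem mainTheorem3 :
    -- the exceptional Hermite polynomials: degrees, and a complete orthonormal system in `L²(w)`
    ((∀ n : ℕ, q n = 0 ↔ n ∈ excDegrees) ∧
      (∀ n : ℕ, n ∉ excDegrees →
        ∃ p : ℝ[X], p.degree = (n : WithBot ℕ) ∧ ∀ x : ℝ, (q n).1 x = p.eval x) ∧
      (∃ b : HilbertBasis {n : ℕ // n ∉ excDegrees} ℝ (Lp ℝ 2 wMeasure),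
        ∀ n : {n : ℕ // n ∉ excDegrees}, ⇑(b n) =ᵐ[wMeasure] (q (n : ℕ)).1)) ∧
    -- the intertwining relations `D_j q_n = (L_j q)_n` with symmetric difference operators `L_j`
    ((∀ j : Fin 4, ((![L0, L1, L2, L3]) j).IsSymm ∧ IsDiffceOp (j : ℕ) ((![L0, L1, L2, L3]) j) ∧
      ∀ n : ℕ, ((![D0, D1, D2, D3]) j) (q n) = diffceApply (j : ℕ) ((![L0, L1, L2, L3]) j) q n)) ∧
    -- the fourteen operators are linearly independent elements of `F_{x,sym}^{3,3}`
    ((∀ i : Fin 14, Y i ∈ fourierSym q 3 3) ∧ LinearIndependent ℝ Y) ∧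
    -- the commuting operator `T`, for all values of the parameters
    (∀ (N : ℕ) (Ω : ℝ),
      T N Ω ∈ fourierSym q 3 3 ∧
      ¬ IsDiffOp 5 (T N Ω) ∧
      T N Ω = symForm N Ω ∧
      IsSymmOn Ω (T N Ω) ∧
      (∀ n : ℕ, n ≤ N →
        ∃ p : ℝ[X], p.natDegree ≤ N ∧ ∀ x : ℝ, (T N Ω (q n)).1 x = p.eval x) ∧
      CommutesWithS N Ω (T N Ω)) := by
  refine ⟨⟨q_eq_zero_iff, fun n hn => ⟨qP n, degree_qP hn, fun x => ?_⟩,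
      HilbertBasis.mkOfOrthogonalEqBot orthonormal_qLp orthogonal_span_qLp, fun n => ?_⟩, ?_,
    ⟨Y_mem_fourierSym, linearIndependent_Y⟩, fun N Ω => ⟨T_mem_fourierSym N Ω, ?_,
      T_eq_symForm N Ω, isSymmOn_T N Ω, fun n hn => exists_T_q_eq_eval N Ω hn,
      commutesWithS_T N Ω⟩⟩
  · rw [q_eq_aeval, coe_aeval]
  · rw [HilbertBasis.coe_mkOfOrthogonalEqBot]
    exact coeFn_qLp n
  · intro j
    fin_cases j
    · exact ⟨isSymm_L0, isDiffceOp_L0, L0_intertwines⟩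
    · exact ⟨isSymm_L1, isDiffceOp_L1, L1_intertwines⟩
    · exact ⟨isSymm_L2, isDiffceOp_L2, L2_intertwines⟩
    · exact ⟨isSymm_L3, isDiffceOp_L3, L3_intertwines⟩
  · rw [T_eq_symForm]
    exact not_isDiffOp_symForm N Ω
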